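/- **Random overlap structures.** A random overlap structure (ROSt) is a random pair $(\xi,Q)$, considered through its law, where $\xi=(\xi_i)_{i\in\mathbb N}$ satisfies $\xi_1\ge\xi_2\ge\dots\ge 0$ and $\sum_i\xi_i\le 1$, and $Q=(q_{ij})_{i,j\in\mathbb N}$ is almost surely a positive definite real symmetric matrix with $q_{ii}=1$. It is *indecomposable* if almost surely $\{q_{ij}:j\ne i\}=\{q_{jl}:j<l\}$ for every $i$. **Correlated evolution.** Let $\psi:\mathbb R\to\mathbb R$ be Borel measurable with $\mathbb E[e^{\lambda\psi(Y)}]<\infty$ for every $\lambda\in\mathbb R$ and with the law of $\psi(Y)$ absolutely continuous with respect to Lebesgue measure, where $Y$ is a standard Gaussian variable. For an integer $r\ge1$ let, conditionally on $(\xi,Q)$, $\kappa=(\kappa_i)_{i\in\mathbb N}$ be a centered Gaussian field with covariance $(q_{ij}^r)_{i,j}$, and put $$\Phi_r(\xi,Q)=\left(\left(\frac{\xi_i e^{\psi(\kappa_i)}}{\sum_j\xi_je^{\psi(\kappa_j)}},\ i\in\mathbb N\right)_{\downarrow},\ \pi Q\pi^{-1}\right),$$ where $\downarrow$ is the reordering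 in decreasing order (ties being broken by the index), $\pi$ is the permutation of $\mathbb N$ that it induces, and $\pi Q\pi^{-1}=(q_{\pi^{-1}(m)\pi^{-1}(n)})_{m,n}$. The ROSt is *quasi-stationary under $\Phi_r$* if $\Phi_r(\xi,Q)$ is almost surely defined and has the same law as $(\xi,Q)$. It is *robustly quasi-stationary* (for $\psi$) if it is quasi-stationary under $\Phi_1$ and under $\Phi_r$ for infinitely many $r\in\mathbb N$. **Ruelle probability cascades.** Let $k\ge1$, $0<x_1<\dots<x_k<1$ and $0\le q_1<\dots<q_k<q_{k+1}=1$. For $\alpha\in\mathbb N^k$ and $0\le l\le k$ let $\alpha(l)=(\alpha_1,\dots,\alpha_l)$. To every $v\in\mathbb N^l$, $0\le l\le k-1$, attach an independent Poisson process on $(0,\infty)$ with intensity measure $x_{l+1}s^{-x_{l+1}-1}\,ds$, with atoms $\eta^v_1\ge\eta^v_2\ge\dots$ in decreasing order. Put $\eta_\alpha=\eta^{\alpha(0)}_{\alpha_1}\eta^{\alpha(1)}_{\alpha_2}\cdots\eta^{\alpha(k-1)}_{\alpha_k}$ for $\alpha\in\mathbb N^k$, let $\Pi:\mathbb N\to\mathbb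 N^k$ be the (almost surely unique) random bijection that lists these weights in decreasing order, and set $$\xi_i=\frac{\eta_{\Pi(i)}}{\sum_{\alpha}\eta_\alpha},\qquad q_{ij}=q_{l(i,j)+1},$$ where $l(i,j)$ is the greatest $l\in\{0,\dots,k\}$ with $\Pi(i)(l)=\Pi(j)(l)$. The pair $(\xi,Q)$ is the $k$-level Ruelle probability cascade with these parameters. **Theorem.** Let $(\xi,Q)$ be a $k$-level Ruelle probability cascade for some $k\ge1$. Then $(\xi,Q)$ is a random overlap structure, it is indecomposable, and for every function $\psi$ as above it is robustly quasi-stationary. -/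

import Mathlib

open MeasureTheory ProbabilityTheory
open scoped ENNReal

universe u

namespace RuelleCascade

/-! ### Random overlap structures -/

/-- Ambient space of the pairs `(ξ, Q)`: a sequence of weights and an `ℕ × ℕ` array of overlaps,
with the product σ-algebra. On the compact space of overlap structures (mass-partitions times
overlap matrices) this σ-algebra induces the Borel σ-algebra; the laws considered below are
carried by that subset, see `IsROSt`. -/
abbrev OverlapStructure : Type := (ℕ → ℝ) × (ℕ → ℕ → ℝ)

/-- Mass-partitions: `s₀ ≥ s₁ ≥ ⋯ ≥ 0` and `∑ sᵢ ≤ 1`. -/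
structure IsMassPartition (s : ℕ → ℝ) : Prop where
  antitone : Antitone s
  nonneg : ∀ i, 0 ≤ s i
  summable : Summable s
  tsum_le_one : ∑' i, s i ≤ 1

/-- A random overlap structure (ROSt), given by its law: a probability measure carried by the
pairs of a mass-partition and a positive definite real symmetric form on `ℕ` with unit diagonal.
(`Matrix.PosDef` includes symmetry and tests the form on finitely supported vectors.) -/
structure IsROSt (P : Measure OverlapStructure) : Prop where
  isProbabilityMeasure : IsProbabilityMeasure P
  massPartition : ∀ᵐ p ∂P, IsMassPartition p.1
  diag : ∀ᵐ p ∂P, ∀ i, p.2 i i = 1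
  posDef : ∀ᵐ p ∂P, (Matrix.of p.2).PosDef

/-! ### The correlated evolution -/

/-- The conditions on the increment function `ψ`: Borel measurability, exponential moments of all
real orders under the standard Gaussian law, and absolute continuity of the law of `ψ(Y)`
for `Y` standard Gaussian. -/
structure IsAdmissible (ψ : ℝ → ℝ) : Prop where
  measurable : Measurable ψ
  integrable_exp : ∀ t : ℝ, Integrable (fun z => Real.exp (t * ψ z)) (gaussianReal 0 1)
  absolutelyContinuous : (gaussianReal 0 1).map ψ ≪ (volume : Measure ℝ)

/-- `σ` lists the indices of `w` by decreasing weight (`σ m` is the index of the `m`-th largest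
weight), ties being broken by the order of the indices. There is at most one such `σ`. -/
def IsDecreasingOrder (w : ℕ → ℝ) (σ : Equiv.Perm ℕ) : Prop :=
  ∀ m n, m < n → w (σ n) < w (σ m) ∨ (w (σ n) = w (σ m) ∧ σ m < σ n)

open Classical in
/-- The reordering of `w` by decreasing weight (the identity if there is none). This is the
inverse `π⁻¹` of the permutation `π` with `π i = m` if the `i`-th weight becomes the `m`-th one. -/
noncomputable def decreasingOrder (w : ℕ → ℝ) : Equiv.Perm ℕ :=
  if h : ∃ σ, IsDecreasingOrder w σ then h.choose else 1

/-- The evolved weights `ξᵢ exp (ψ κᵢ) / ∑ⱼ ξⱼ exp (ψ κⱼ)`, before they are reordered. -/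
noncomputable def evolvedWeight (ψ : ℝ → ℝ) (ξ κ : ℕ → ℝ) (i : ℕ) : ℝ :=
  ξ i * Real.exp (ψ (κ i)) / ∑' j, ξ j * Real.exp (ψ (κ j))

/-- The evolution is defined at `((ξ, Q), κ)`: the normalization is finite and nonzero, and the
evolved weights can be put in decreasing order. -/
def EvolutionDefined (ψ : ℝ → ℝ) (z : OverlapStructure × (ℕ → ℝ)) : Prop :=
  Summable (fun j => z.1.1 j * Real.exp (ψ (z.2 j))) ∧
  0 < ∑' j, z.1.1 j * Real.exp (ψ (z.2 j)) ∧
  ∃ σ, IsDecreasingOrder (evolvedWeight ψ z.1.1 z.2) σ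

/-- The map `((ξ, Q), κ) ↦ ((ξᵢ exp (ψ κᵢ) / ∑ⱼ ξⱼ exp (ψ κⱼ))↓, π Q π⁻¹)`. -/
noncomputable def evolve (ψ : ℝ → ℝ) (z : OverlapStructure × (ℕ → ℝ)) : OverlapStructure :=
  let w := evolvedWeight ψ z.1.1 z.2
  let σ := decreasingOrder w
  (fun m => w (σ m), fun m n => z.1.2 (σ m) (σ n))

/-- `ν` is the centered Gaussian law on `ℝ^ℕ` with covariance `C`. -/
structure IsCenteredGaussian (C : ℕ → ℕ → ℝ) (ν : Measure (ℕ → ℝ)) : Prop where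
  isGaussianProcess : IsGaussianProcess (fun (i : ℕ) (κ : ℕ → ℝ) => κ i) ν
  mean : ∀ i, ∫ κ, κ i ∂ν = 0
  cov : ∀ i j, covariance (fun κ : ℕ → ℝ => κ i) (fun κ => κ j) ν = C i j

/-- The law `P` of `(ξ, Q)` is quasi-stationary under the correlated evolution `Φ_r`: if, given
`(ξ, Q)`, the field `κ` is centered Gaussian with covariance `(q_{ij}^r)`, then the evolution is
almost surely defined and the law of the evolved pair is `P`. (The conditional law `G` of `κ` is
determined `P`-almost everywhere by the covariance.) -/
def IsQuasiStationary (ψ : ℝ → ℝ) (r : ℕ) (P : Measure OverlapStructure) : Prop :=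
  ∃ G : Kernel OverlapStructure (ℕ → ℝ), IsMarkovKernel G ∧
    (∀ᵐ p ∂P, IsCenteredGaussian (fun i j => p.2 i j ^ r) (G p)) ∧
    (∀ᵐ z ∂(P ⊗ₘ G), EvolutionDefined ψ z) ∧
    HasLaw (evolve ψ) P (P ⊗ₘ G)

/-- Robust quasi-stationarity: quasi-stationarity under `Φ_1` and under `Φ_r` for infinitely many
positive integers `r`. -/
def IsRobustlyQuasiStationary (ψ : ℝ → ℝ) (P : Measure OverlapStructure) : Prop :=
  IsQuasiStationary ψ 1 P ∧ {r : ℕ | 1 ≤ r ∧ IsQuasiStationary ψ r P}.Infinite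

/-! ### Indecomposability -/

/-- `S_Q = {q_{ij} : i < j}`. -/
def overlapSet (Q : ℕ → ℕ → ℝ) : Set ℝ := {a | ∃ i j, i < j ∧ a = Q i j}

/-- `S_Q(i) = {q_{ij} : j ≠ i}`. -/
def overlapSetAt (Q : ℕ → ℕ → ℝ) (i : ℕ) : Set ℝ := {a | ∃ j, j ≠ i ∧ a = Q i j}

/-- Almost surely, `S_Q(i) = S_Q` for every `i`. -/
def IsIndecomposable (P : Measure OverlapStructure) : Prop :=
  ∀ᵐ p ∂P, ∀ i, overlapSetAt p.2 i = overlapSet p.2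

/-! ### Poisson processes -/

/-- `N` is a Poisson process with intensity `ν`: for disjoint sets `A₁, …, Aₙ` of finite intensity
the counts `N(A₁), …, N(Aₙ)` are independent Poisson variables with means `ν(A₁), …, ν(Aₙ)`. -/
def IsPoissonProcess {Ω S : Type*} [MeasurableSpace Ω] [MeasurableSpace S]
    (N : Ω → Measure S) (ν : Measure S) (μ : Measure Ω) : Prop :=
  ∀ (n : ℕ) (A : Fin n → Set S), (∀ j, MeasurableSet (A j)) → (∀ j, ν (A j) ≠ ∞) →
    Pairwise (Function.onFun Disjoint A) → ∀ m : Fin n → ℕ,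
      μ {ω | ∀ j, N ω (A j) = m j} =
        ∏ j, ENNReal.ofReal
          ((ν (A j)).toReal ^ m j / (m j).factorial * Real.exp (-(ν (A j)).toReal))

/-- The measure `x s^(-x-1) ds` on `(0, ∞)`, as a measure on `ℝ`. -/
noncomputable def powerIntensity (x : ℝ) : Measure ℝ :=
  (volume.restrict (Set.Ioi 0)).withDensity (fun s => ENNReal.ofReal (x * s ^ (-x - 1)))

/-- `η₀ ≥ η₁ ≥ ⋯ > 0` are the ordered positions of the atoms of a Poisson process on `(0, ∞)` with
intensity measure `x s^(-x-1) ds`. -/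
structure IsOrderedPoisson {Ω : Type*} [MeasurableSpace Ω] (x : ℝ) (η : ℕ → Ω → ℝ)
    (μ : Measure Ω) : Prop where
  measurable : ∀ i, Measurable (η i)
  pos : ∀ᵐ ω ∂μ, ∀ i, 0 < η i ω
  antitone : ∀ᵐ ω ∂μ, Antitone (fun i => η i ω)
  poisson : IsPoissonProcess (fun ω => Measure.sum fun i => Measure.dirac (η i ω))
    (powerIntensity x) μ

/-! ### Ruelle probability cascades -/

/-- The leaves `α = (α₁, …, α_k) ∈ ℕ^k` of the tree. -/
abbrev Address (k : ℕ) : Type := Fin k → ℕ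

/-- The inner vertices of the tree: the tuples in `ℕ^l`, for `0 ≤ l ≤ k - 1`. -/
abbrev Vertex (k : ℕ) : Type := Σ l : Fin k, (Fin (l : ℕ) → ℕ)

/-- The truncation `α(l) = (α₁, …, α_l)`, for `0 ≤ l ≤ k - 1`. -/
def truncate {k : ℕ} (α : Address k) (l : Fin k) : Vertex k :=
  ⟨l, fun j => α (Fin.castLE l.isLt.le j)⟩

/-- `η_α = η^{α(0)}_{α₁} η^{α(1)}_{α₂} ⋯ η^{α(k-1)}_{α_k}`. -/
def leafWeight {k : ℕ} (e : Vertex k → ℕ → ℝ) (α : Address k) : ℝ :=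
  ∏ l : Fin k, e (truncate α l) (α l)

/-- The greatest `l ≤ k` such that `α` and `β` have the same first `l` components. -/
def commonLevel {k : ℕ} (α β : Address k) : ℕ :=
  Nat.findGreatest (fun l => ∀ j : Fin k, (j : ℕ) < l → α j = β j) k

/-- The overlap `q_{l+1}` of two leaves, where `l` is their common level and `q_{k+1} = 1`. Here
`q_1, …, q_k` are the values of `q : Fin k → ℝ`, in this order. -/
def leafOverlap {k : ℕ} (q : Fin k → ℝ) (α β : Address k) : ℝ :=
  if h : commonLevel α β < k then q ⟨commonLevel α β, h⟩ else 1

/-- The pair `(ξ, Q)` read off from the processes `e` at the vertices and the bijection `addr` that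
gives the address of the `i`-th point. -/
noncomputable def cascade {k : ℕ} (q : Fin k → ℝ) (e : Vertex k → ℕ → ℝ)
    (addr : ℕ ≃ Address k) : OverlapStructure :=
  (fun i => leafWeight e (addr i) / ∑' α, leafWeight e α,
    fun i j => leafOverlap q (addr i) (addr j))

/-- `0 < x_1 < ⋯ < x_k < 1` and `0 ≤ q_1 < ⋯ < q_k < 1`. -/
structure IsCascadeParameter {k : ℕ} (x q : Fin k → ℝ) : Prop where
  x_strictMono : StrictMono x
  x_pos : ∀ l, 0 < x l
  x_lt_one : ∀ l, x l < 1
  q_strictMono : StrictMono q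
  q_nonneg : ∀ l, 0 ≤ q l
  q_lt_one : ∀ l, q l < 1

/-- `P` is the law of the Ruelle probability cascade with parameters `x` and `q`, both indexed
by the `k` levels: `P` is the law of the pair `(ξ, Q)` built from independent Poisson processes
`η v`, with intensity `x_{l+1} s^(-x_{l+1}-1) ds` if `v` is at level `l`, the leaves being listed
by decreasing weight. (The list `addr` is almost surely unique, and the law does not depend on the
probability space.) -/
def IsCascadeLaw {k : ℕ} (x q : Fin k → ℝ) (P : Measure OverlapStructure) : Prop :=
  ∃ (Ω : Type u) (_ : MeasurableSpace Ω) (μ : Measure Ω) (η : Vertex k → ℕ → Ω → ℝ)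
    (addr : Ω → (ℕ ≃ Address k)),
    IsProbabilityMeasure μ ∧
    (∀ v, IsOrderedPoisson (x v.1) (η v) μ) ∧
    iIndepFun (fun v ω i => η v i ω) μ ∧
    (∀ᵐ ω ∂μ, Antitone fun i => leafWeight (fun v i => η v i ω) (addr ω i)) ∧
    HasLaw (fun ω => cascade q (fun v i => η v i ω) (addr ω)) P μ

/-- `P` is the law of a `k`-level Ruelle probability cascade, for some parameters. -/
def IsRuelleCascade (k : ℕ) (P : Measure OverlapStructure) : Prop :=
  ∃ x q : Fin k → ℝ, IsCascadeParameter x q ∧ IsCascadeLaw.{u} x q P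

end RuelleCascade

namespace RuelleCascade

open Filter Topology

/-! ### The function `a ↦ exp (-a)` on `[0, ∞]` -/

/-! The cascade is a tree of independent Poisson processes, and everything rests on one property of
the intensity x s^(-x-1) ds: dilation by c multiplies it by a power c^(±x). Hence multiplying the
atoms by independent copies of a positive factor F with E[F^x] = 1, and sorting again, does not
change the law (`HasPowerLaw.measurePreserving_marked`). Laws of decreasing sequences are compared
through their Laplace functionals, which determine them (`ext_of_laplace`).

Quasi-stationarity. The array (q_ij^r) is a sum over the levels of a nonnegative increment times the
indicator that i and j have the same ancestor at that level (`IsHierarchical.pow_eq`). So κ can be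
realised as a sum of independent Gaussian marks, one at the root and one on each edge of the path to
the leaf, and the evolution multiplies each leaf weight by a function of the marks on its path.
`exists_marked_evolution` absorbs this factor by induction on the height. Given the mark m of an
edge at the root, the evolved subtree below it is, up to an automorphism, a constant C'(m) times a
tree whose law does not depend on m. The numbers C'(m)/C, with C = E[C'^x]^(1/x) for the exponent x
of the root, are factors of the kind above and are absorbed by the root process. What remains is the
constant C, which cancels in the normalisation, and an automorphism of the tree, which leaves the
overlaps unchanged. The evolved pair is thus the cascade of a tree with the original law, for every
r.

Two almost sure facts make this meaningful. The total weight is finite because its Laplace transform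
is exp(-B t^y) (`exists_laplace_totalWeight`); here the exponents must increase along the tree. The
leaf weights are distinct (`ae_injective_leafWeight`), so the sorted list of leaves is unique and
the cascade is a function of the tree alone (`IsCascadeLaw.exists_hasLaw`). Positive definiteness
and indecomposability are deterministic consequences of the hierarchical form of Q. -/

/-- `exp (-a)`, with value `0` at `∞`. -/
noncomputable def expNeg (a : ℝ≥0∞) : ℝ≥0∞ := EReal.exp (-(a : EReal))

@[simp] lemma expNeg_zero : expNeg 0 = 1 := by simp [expNeg]

@[simp] lemma expNeg_top : expNeg ∞ = 0 := by simp [expNeg]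

lemma expNeg_ofReal {t : ℝ} (ht : 0 ≤ t) :
    expNeg (ENNReal.ofReal t) = ENNReal.ofReal (Real.exp (-t)) := by
  rw [expNeg, EReal.coe_ennreal_ofReal, max_eq_left ht, ← EReal.coe_neg, EReal.exp_coe]

lemma expNeg_antitone : Antitone expNeg := fun a b h => by
  rw [expNeg, expNeg, EReal.exp_le_exp_iff, EReal.neg_le_neg_iff]
  exact_mod_cast h

lemma expNeg_le_one (a : ℝ≥0∞) : expNeg a ≤ 1 := by
  simpa using expNeg_antitone (zero_le (a := a))

lemma expNeg_ne_top (a : ℝ≥0∞) : expNeg a ≠ ∞ :=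
  ((expNeg_le_one a).trans_lt ENNReal.one_lt_top).ne

lemma continuous_expNeg : Continuous expNeg :=
  ENNReal.continuous_exp.comp (continuous_neg.comp continuous_coe_ennreal_ereal)

lemma measurable_expNeg : Measurable expNeg := continuous_expNeg.measurable

lemma expNeg_injective : Function.Injective expNeg := fun a b h => by
  have h' := EReal.exp_strictMono.injective h
  exact_mod_cast neg_injective h'

lemma expNeg_add (a b : ℝ≥0∞) : expNeg (a + b) = expNeg a * expNeg b := by
  rw [expNeg, expNeg, expNeg, ← EReal.exp_add, EReal.coe_ennreal_add, EReal.neg_add,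
    sub_eq_add_neg]
  · left; simp
  · right; simp

lemma expNeg_sum {ι : Type*} (s : Finset ι) (f : ι → ℝ≥0∞) :
    expNeg (∑ i ∈ s, f i) = ∏ i ∈ s, expNeg (f i) := by
  classical
  induction s using Finset.induction_on with
  | empty => simp
  | insert a s ha ih => rw [Finset.sum_insert ha, Finset.prod_insert ha, expNeg_add, ih]

lemma tendsto_prod_expNeg (f : ℕ → ℝ≥0∞) :
    Tendsto (fun n => ∏ i ∈ Finset.range n, expNeg (f i)) atTop (𝓝 (expNeg (∑' i, f i))) := by
  simp_rw [← expNeg_sum]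
  exact (continuous_expNeg.tendsto _).comp ENNReal.summable.hasSum.tendsto_sum_nat

/-- The inverse of `expNeg` on `[0, 1]`. -/
noncomputable def negLog (u : ℝ≥0∞) : ℝ≥0∞ := (-ENNReal.log u).toENNReal

lemma expNeg_negLog {u : ℝ≥0∞} (hu : u ≤ 1) : expNeg (negLog u) = u := by
  have h : 0 ≤ -ENNReal.log u := by
    rw [← neg_zero, EReal.neg_le_neg_iff]
    simpa using hu
  rw [expNeg, negLog, EReal.coe_toENNReal h, neg_neg, ENNReal.exp_log]

lemma measurable_negLog : Measurable negLog :=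
  (ENNReal.measurable_log.neg).ereal_toENNReal

lemma one_sub_expNeg_le (a : ℝ≥0∞) : 1 - expNeg a ≤ a := by
  induction a using ENNReal.recTopCoe with
  | top => simp
  | coe a =>
    rw [← ENNReal.ofReal_coe_nnreal, expNeg_ofReal a.coe_nonneg, ← ENNReal.ofReal_one,
      ← ENNReal.ofReal_sub _ (Real.exp_pos _).le]
    apply ENNReal.ofReal_le_ofReal
    have := Real.add_one_le_exp (-(a : ℝ))
    linarith

lemma one_sub_expNeg_mono : Monotone fun a => 1 - expNeg a :=
  fun _ _ h => tsub_le_tsub_left (expNeg_antitone h) 1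

lemma measurable_one_sub_expNeg : Measurable fun a => 1 - expNeg a :=
  measurable_const.sub measurable_expNeg

/-! ### Products of probability measures -/

lemma lintegral_infinitePi_prod {ι : Type*} {X : ι → Type*} [∀ i, MeasurableSpace (X i)]
    (μ : ∀ i, Measure (X i)) [∀ i, IsProbabilityMeasure (μ i)] (s : Finset ι)
    {f : ∀ i, X i → ℝ≥0∞} (hf : ∀ i, Measurable (f i)) :
    ∫⁻ a, ∏ i ∈ s, f i (a i) ∂Measure.infinitePi μ = ∏ i ∈ s, ∫⁻ z, f i z ∂μ i := by
  have h := (iIndepFun_infinitePi (P := μ) (X := fun i => f i) hf)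
  have h2 := lintegral_prod_eq_prod_lintegral_of_indepFun s (fun i (a : ∀ i, X i) => f i (a i)) h
    (fun i => (hf i).comp (measurable_pi_apply i))
  have h3 : ∀ i, ∫⁻ a, f i (a i) ∂Measure.infinitePi μ = ∫⁻ z, f i z ∂μ i := fun i => by
    rw [← Measure.infinitePi_map_eval μ i, lintegral_map (hf i) (measurable_pi_apply i)]
  simp_rw [← h3, ← h2]

/-- Independent sequences of independent variables form a sequence of independent pairs. -/
lemma measurePreserving_zip {ι : Type*} {X Y : ι → Type*} [∀ i, MeasurableSpace (X i)]
    [∀ i, MeasurableSpace (Y i)] (μ : ∀ i, Measure (X i)) (ν : ∀ i, Measure (Y i))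
    [∀ i, IsProbabilityMeasure (μ i)] [∀ i, IsProbabilityMeasure (ν i)] :
    MeasurePreserving (fun z : (∀ i, X i) × (∀ i, Y i) => fun i => (z.1 i, z.2 i))
      ((Measure.infinitePi μ).prod (Measure.infinitePi ν))
      (Measure.infinitePi fun i => (μ i).prod (ν i)) := by
  have hm : Measurable (fun z : (∀ i, X i) × (∀ i, Y i) => fun i => (z.1 i, z.2 i)) := by
    fun_prop
  refine ⟨hm, Measure.eq_infinitePi _ fun s t ht => ?_⟩
  have hms : MeasurableSet (Set.pi (s : Set ι) t) :=
    MeasurableSet.pi s.countable_toSet fun i _ => ht i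
  rw [Measure.map_apply hm hms, Measure.prod_apply (hm hms)]
  have : ∀ a : ∀ i, X i, Measure.infinitePi ν (Prod.mk a ⁻¹'
      ((fun z : (∀ i, X i) × (∀ i, Y i) => fun i => (z.1 i, z.2 i)) ⁻¹' Set.pi (s : Set ι) t)) =
      ∏ i ∈ s, ν i (Prod.mk (a i) ⁻¹' t i) := fun a => by
    rw [← Measure.infinitePi_pi ν fun i _ => measurable_prodMk_left (ht i)]
    rfl
  simp_rw [this]
  rw [lintegral_infinitePi_prod μ s fun i => measurable_measure_prodMk_left (ht i)]
  exact Finset.prod_congr rfl fun i _ => (Measure.prod_apply (ht i)).symm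

/-- A family indexed by `Option ι` splits into one variable and an independent family. -/
lemma measurePreserving_optionElim {ι X : Type*} [MeasurableSpace X] (μ₀ : Measure X)
    (μ : ι → Measure X) [IsProbabilityMeasure μ₀] [∀ i, IsProbabilityMeasure (μ i)] :
    MeasurePreserving (fun (z : X × (ι → X)) (o : Option ι) => o.elim z.1 z.2)
      (μ₀.prod (Measure.infinitePi μ)) (Measure.infinitePi fun o : Option ι => o.elim μ₀ μ) := by
  have : ∀ o : Option ι, IsProbabilityMeasure (o.elim μ₀ μ) := fun o => by
    cases o <;> simp only [Option.elim] <;> infer_instance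
  have hm : Measurable (fun (z : X × (ι → X)) (o : Option ι) => o.elim z.1 z.2) := by
    refine measurable_pi_lambda _ fun o => ?_
    cases o <;> simp only [Option.elim] <;> fun_prop
  refine ⟨hm, Measure.eq_infinitePi _ fun s t ht => ?_⟩
  have hms : MeasurableSet (Set.pi (s : Set (Option ι)) t) :=
    MeasurableSet.pi s.countable_toSet fun i _ => ht i
  rw [Measure.map_apply hm hms]
  classical
  have : (fun (z : X × (ι → X)) (o : Option ι) => o.elim z.1 z.2) ⁻¹' Set.pi (s : Set (Option ι)) t
      = (if none ∈ s then t none else Set.univ) ×ˢ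
        Set.pi (s.eraseNone : Set ι) (fun i => t (some i)) := by
    ext z
    simp only [Set.mem_preimage, Set.mem_pi, Finset.mem_coe, Option.forall, Option.elim,
      Set.mem_prod, Finset.mem_eraseNone]
    split_ifs with h <;> simp [h]
  rw [this, Measure.prod_prod, Measure.infinitePi_pi μ fun i _ => ht (some i)]
  by_cases h : none ∈ s
  · rw [if_pos h, ← Finset.insert_erase h, Finset.prod_insert (by simp)]
    simp only [Option.elim]
    congr 1
    rw [Finset.insert_erase h, ← Finset.map_some_eraseNone, Finset.prod_map]
    simp
  · rw [if_neg h, measure_univ, one_mul]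
    conv_rhs => rw [← Finset.erase_eq_of_notMem h, ← Finset.map_some_eraseNone, Finset.prod_map]
    simp

/-! ### Intensity measures -/

instance (x : ℝ) : SFinite (powerIntensity x) := by
  unfold powerIntensity; infer_instance

lemma measurable_powerDensity (x : ℝ) :
    Measurable fun s : ℝ => ENNReal.ofReal (x * s ^ (-x - 1)) := by fun_prop

lemma lintegral_powerIntensity (x : ℝ) {h : ℝ → ℝ≥0∞} (hh : Measurable h) :
    ∫⁻ s, h s ∂powerIntensity x = ∫⁻ s in Set.Ioi 0, ENNReal.ofReal (x * s ^ (-x - 1)) * h s := by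
  rw [powerIntensity, lintegral_withDensity_eq_lintegral_mul _ (measurable_powerDensity x) hh]
  rfl

lemma powerIntensity_Iic_zero (x : ℝ) : powerIntensity x (Set.Iic 0) = 0 := by
  have := withDensity_absolutelyContinuous ((volume : Measure ℝ).restrict (Set.Ioi 0))
    (fun s => ENNReal.ofReal (x * s ^ (-x - 1)))
  apply this
  rw [Measure.restrict_apply measurableSet_Iic]
  convert measure_empty (μ := (volume : Measure ℝ))
  ext s; simp

lemma powerIntensity_ae_pos (x : ℝ) : ∀ᵐ s ∂powerIntensity x, 0 < s := by
  rw [ae_iff]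
  convert powerIntensity_Iic_zero x using 2
  ext s; simp

lemma powerIntensity_Ioi_ne_top {x ε : ℝ} (hx : 0 < x) (hε : 0 < ε) :
    powerIntensity x (Set.Ioi ε) ≠ ∞ := by
  have h := ((integrableOn_Ioi_rpow_of_lt (a := -x - 1) (by linarith) hε).const_mul x)
  have h2 := h.lintegral_lt_top
  rw [powerIntensity, withDensity_apply _ measurableSet_Ioi, Measure.restrict_restrict
    measurableSet_Ioi, Set.inter_eq_left.2 (Set.Ioi_subset_Ioi hε.le)]
  exact h2.ne

/-- Change of variables. This scaling relation is what makes the power intensities stable under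
independent multiplicative factors. -/
lemma lintegral_powerIntensity_comp_mul {x c : ℝ} (hc : 0 < c) {h : ℝ → ℝ≥0∞}
    (hh : Measurable h) :
    ∫⁻ s, h (c * s) ∂powerIntensity x =
      ENNReal.ofReal (c ^ x) * ∫⁻ s, h s ∂powerIntensity x := by
  have hhc : Measurable fun s => h (c * s) := hh.comp (measurable_const_mul c)
  rw [lintegral_powerIntensity x hhc, lintegral_powerIntensity x hh]
  have himg : (fun s : ℝ => c * s) '' Set.Ioi 0 = Set.Ioi 0 := by
    rw [Set.image_mul_left_Ioi hc, mul_zero]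
  conv_rhs => rw [← himg]
  rw [lintegral_image_eq_lintegral_abs_deriv_mul (f' := fun _ => c) measurableSet_Ioi
    (fun s _ => by simpa using ((hasDerivAt_id s).const_mul c).hasDerivWithinAt)
    (fun a _ b _ h => mul_left_cancel₀ hc.ne' h)]
  rw [← lintegral_const_mul' _ _ ENNReal.ofReal_ne_top]
  refine setLIntegral_congr_fun measurableSet_Ioi fun s hs => ?_
  have hs : 0 < s := hs
  rw [← mul_assoc, ← mul_assoc, abs_of_pos hc]
  congr 1
  rw [← ENNReal.ofReal_mul (Real.rpow_nonneg hc.le x), ← ENNReal.ofReal_mul (by positivity)]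
  congr 1
  rw [Real.mul_rpow hc.le hs.le, Real.rpow_sub hc, Real.rpow_neg hc.le, Real.rpow_one]
  field_simp

/-- Above 1 the intensity has finite mass; below 1 the integrand is at most c s^y, and s^(y-x-1) is
integrable at 0 because x < y. -/
lemma lintegral_one_sub_expNeg_rpow_ne_top {x y c : ℝ} (hx : 0 < x) (hxy : x < y) :
    ∫⁻ s, (1 - expNeg (ENNReal.ofReal (c * s ^ y))) ∂powerIntensity x ≠ ∞ := by
  have hm : Measurable fun s : ℝ => 1 - expNeg (ENNReal.ofReal (c * s ^ y)) :=
    measurable_one_sub_expNeg.comp (by fun_prop)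
  rw [← lintegral_add_compl _ (measurableSet_Ioi (a := (1 : ℝ)))]
  refine ENNReal.add_ne_top.2 ⟨?_, ?_⟩
  · refine ne_top_of_le_ne_top (powerIntensity_Ioi_ne_top hx one_pos) ?_
    rw [← setLIntegral_one]
    exact lintegral_mono fun s => tsub_le_self
  · have h1 : IntervalIntegrable (fun s : ℝ => s ^ (y - x - 1)) volume 0 1 :=
      intervalIntegral.intervalIntegrable_rpow' (by linarith)
    have h2 := ((intervalIntegrable_iff_integrableOn_Ioc_of_le zero_le_one).1 h1).const_mul (x * c)
    refine ne_top_of_le_ne_top h2.lintegral_lt_top.ne ?_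
    rw [powerIntensity, restrict_withDensity measurableSet_Ioi.compl,
      lintegral_withDensity_eq_lintegral_mul _ (measurable_powerDensity x) hm,
      Measure.restrict_restrict measurableSet_Ioi.compl]
    have : (Set.Ioi (1 : ℝ))ᶜ ∩ Set.Ioi 0 = Set.Ioc 0 1 := by
      ext s; simp [and_comm]
    rw [this]
    refine setLIntegral_mono' measurableSet_Ioc fun s hs => ?_
    have hs : 0 < s := hs.1
    refine (mul_le_mul_right (one_sub_expNeg_le _) _).trans ?_
    rw [← ENNReal.ofReal_mul (by positivity)]
    apply le_of_eq
    congr 1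
    rw [show y - x - 1 = (-x - 1) + y by ring, Real.rpow_add hs]
    ring

/-! ### Laplace functionals -/

lemma expNeg_mul_natCast (c : ℝ≥0∞) (m : ℕ) : expNeg (c * m) = expNeg c ^ m := by
  rw [mul_comm, ← nsmul_eq_mul, ← Finset.card_range m, ← Finset.sum_const, expNeg_sum,
    Finset.prod_const]

lemma lintegral_expNeg_poissonMeasure (r : NNReal) (c : ℝ≥0∞) :
    ∫⁻ m : ℕ, expNeg (c * m) ∂poissonMeasure r = expNeg ((1 - expNeg c) * r) := by
  obtain ⟨u, hu⟩ : ∃ u : NNReal, (u : ℝ≥0∞) = expNeg c :=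
    ⟨_, ENNReal.coe_toNNReal (expNeg_ne_top c)⟩
  have hu1 : u ≤ 1 := by
    have := expNeg_le_one c
    rw [← hu] at this
    exact_mod_cast this
  simp_rw [expNeg_mul_natCast, ← hu]
  rw [poissonMeasure, lintegral_sum_measure]
  simp_rw [lintegral_smul_measure, lintegral_dirac]
  have hs : HasSum (fun n : ℕ => Real.exp (-r) * ((r * u : ℝ) ^ n / n.factorial))
      (Real.exp (-r) * Real.exp (r * u)) := by
    have := (NormedSpace.expSeries_div_hasSum_exp (r * u : ℝ)).mul_left (Real.exp (-r))
    rwa [← Real.exp_eq_exp_ℝ] at this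
  have : ∀ n : ℕ, ENNReal.ofReal (Real.exp (-r) * r ^ n / n.factorial) • (u : ℝ≥0∞) ^ n
      = ENNReal.ofReal (Real.exp (-r) * ((r * u : ℝ) ^ n / n.factorial)) := fun n => by
    rw [smul_eq_mul, ← ENNReal.ofReal_coe_nnreal, ← ENNReal.ofReal_pow u.coe_nonneg,
      ← ENNReal.ofReal_mul (by positivity)]
    congr 1
    rw [mul_pow]
    ring
  simp_rw [this]
  rw [← ENNReal.ofReal_tsum_of_nonneg (fun n => by positivity) hs.summable, hs.tsum_eq]
  have : (1 - (u : ℝ≥0∞)) * r = ENNReal.ofReal ((1 - u) * r) := by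
    rw [ENNReal.ofReal_mul (by exact_mod_cast sub_nonneg.2 (NNReal.coe_le_coe.2 hu1)),
      ENNReal.ofReal_sub _ u.coe_nonneg]
    simp
  rw [this, expNeg_ofReal (mul_nonneg (sub_nonneg.2 (by exact_mod_cast hu1)) r.coe_nonneg),
    ← Real.exp_add]
  congr 2
  ring

/-! ### Laplace functional of a Poisson process from the law of its counts. -/

section PoissonProcess

variable {Ω S : Type*} [MeasurableSpace Ω] [MeasurableSpace S] {N : Ω → Measure S}
  {ν : Measure S} {μ : Measure Ω} [IsProbabilityMeasure μ]

/-- The two laws agree on each point of ℕ^n, which carries all the mass of the product of Poisson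
laws. This gives an inequality of measures, hence equality because both are probabilities; in
particular the counts are almost surely finite integers. -/
lemma IsPoissonProcess.map_counts (hN : IsPoissonProcess N ν μ) {n : ℕ} {A : Fin n → Set S}
    (hA : ∀ j, MeasurableSet (A j)) (hfin : ∀ j, ν (A j) ≠ ∞)
    (hd : Pairwise (Function.onFun Disjoint A)) (hm : ∀ j, Measurable fun ω => N ω (A j)) :
    μ.map (fun ω j => N ω (A j)) =
      (Measure.infinitePi fun j => poissonMeasure (ν (A j)).toNNReal).map
        (fun (m : Fin n → ℕ) j => (m j : ℝ≥0∞)) := by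
  have hV : Measurable fun ω j => N ω (A j) := measurable_pi_lambda _ hm
  have hc : Measurable (fun (m : Fin n → ℕ) j => (m j : ℝ≥0∞)) := .of_discrete
  have := Measure.isProbabilityMeasure_map (μ := μ) hV.aemeasurable
  have := Measure.isProbabilityMeasure_map
    (μ := Measure.infinitePi fun j => poissonMeasure (ν (A j)).toNNReal) hc.aemeasurable
  symm
  refine Measure.eq_of_le_of_measure_univ_eq (Measure.le_iff.2 fun T hT => ?_) (by simp)
  rw [Measure.map_apply hc hT, Measure.map_apply hV hT]
  set B := (fun (m : Fin n → ℕ) j => (m j : ℝ≥0∞)) ⁻¹' T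
  have h1 : ∀ m : Fin n → ℕ, (Measure.infinitePi fun j => poissonMeasure (ν (A j)).toNNReal) {m} =
      μ {ω | ∀ j, N ω (A j) = m j} := fun m => by
    rw [hN n A hA hfin hd m, Measure.infinitePi_singleton_of_fintype]
    refine Finset.prod_congr rfl fun j _ => ?_
    rw [poissonMeasure_singleton]
    congr 1
    rw [ENNReal.coe_toNNReal_eq_toReal]
    ring
  have hBc : B.Countable := Set.to_countable B
  have hms : ∀ m : Fin n → ℕ, MeasurableSet {ω | ∀ j, N ω (A j) = m j} := fun m => by
    rw [Set.ofPred_forall]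
    exact MeasurableSet.iInter fun j => hm j (measurableSet_singleton _)
  rw [← Set.biUnion_of_singleton B, measure_biUnion hBc
    (fun a _ b _ hab => by simpa using hab) (fun _ _ => measurableSet_singleton _)]
  simp_rw [h1]
  rw [← measure_biUnion hBc (fun a _ b _ hab => ?_) (fun m _ => hms m)]
  · refine measure_mono fun ω hω => ?_
    obtain ⟨m, hmB, hmω⟩ := Set.mem_iUnion₂.1 hω
    have : (fun j => N ω (A j)) = fun j => (m j : ℝ≥0∞) := funext hmω
    simp only [Set.mem_preimage]
    rw [this]
    exact hmB
  · refine Set.disjoint_left.2 fun ω ha hb => hab (funext fun j => ?_)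
    have h := (ha j).symm.trans (hb j)
    exact_mod_cast h

lemma IsPoissonProcess.lintegral_expNeg_counts (hN : IsPoissonProcess N ν μ) {n : ℕ}
    {A : Fin n → Set S} (hA : ∀ j, MeasurableSet (A j)) (hfin : ∀ j, ν (A j) ≠ ∞)
    (hd : Pairwise (Function.onFun Disjoint A)) (hm : ∀ j, Measurable fun ω => N ω (A j))
    (c : Fin n → ℝ≥0∞) :
    ∫⁻ ω, expNeg (∑ j, c j * N ω (A j)) ∂μ = expNeg (∑ j, (1 - expNeg (c j)) * ν (A j)) := by
  have hV : Measurable fun ω j => N ω (A j) := measurable_pi_lambda _ hm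
  have hc : Measurable (fun (m : Fin n → ℕ) j => (m j : ℝ≥0∞)) := .of_discrete
  have hF : Measurable fun v : Fin n → ℝ≥0∞ => expNeg (∑ j, c j * v j) :=
    measurable_expNeg.comp (by fun_prop)
  have h1 := lintegral_map (μ := μ) hF hV
  rw [← h1, hN.map_counts hA hfin hd hm, lintegral_map hF hc]
  simp_rw [expNeg_sum]
  rw [lintegral_infinitePi_prod _ _ (f := fun j (m : ℕ) => expNeg (c j * m))
    (fun _ => .of_discrete)]
  refine Finset.prod_congr rfl fun j _ => ?_
  rw [lintegral_expNeg_poissonMeasure, ENNReal.coe_toNNReal (hfin j)]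

lemma IsPoissonProcess.lintegral_expNeg_simpleFunc (hN : IsPoissonProcess N ν μ)
    (f : SimpleFunc S ℝ≥0∞) (hfin : ν (Function.support f) ≠ ∞)
    (hm : ∀ A, MeasurableSet A → Measurable fun ω => N ω A) :
    ∫⁻ ω, expNeg (∫⁻ s, f s ∂N ω) ∂μ = expNeg (∫⁻ s, (1 - expNeg (f s)) ∂ν) := by
  classical
  -- The value 0 is dropped: its fibre may have infinite intensity, and it contributes nothing to
  -- either side.
  set R := f.range.erase 0 with hR
  have hsub : f.range \ {0} ⊆ R := by
    intro a ha; simpa [hR, and_comm] using ha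
  have e := R.equivFin.symm
  have hs : ∀ (F : ℝ≥0∞ → ℝ≥0∞), ∑ y ∈ R, F y = ∑ j, F (e j) := fun F => by
    rw [← Finset.sum_coe_sort, ← Equiv.sum_comp e]
  have h1 : ∀ M : Measure S, ∫⁻ s, f s ∂M = ∑ j, (e j : ℝ≥0∞) * M (f ⁻¹' {(e j : ℝ≥0∞)}) :=
    fun M => by
      rw [← hs fun y => y * M (f ⁻¹' {y}), ← SimpleFunc.lintegral_eq_of_subset' f hsub,
        SimpleFunc.lintegral_eq_lintegral]
  have h2 : ∫⁻ s, (1 - expNeg (f s)) ∂ν =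
      ∑ j, (1 - expNeg (e j)) * ν (f ⁻¹' {(e j : ℝ≥0∞)}) := by
    have := SimpleFunc.map_lintegral (μ := ν) (fun a => 1 - expNeg a) f
    rw [← SimpleFunc.lintegral_eq_lintegral] at this
    have h3 : ∫⁻ s, (1 - expNeg (f s)) ∂ν = (f.map fun a => 1 - expNeg a).lintegral ν := by
      rw [← SimpleFunc.lintegral_eq_lintegral]; rfl
    rw [h3, SimpleFunc.map_lintegral, ← hs fun y => (1 - expNeg y) * ν (f ⁻¹' {y}), hR]
    symm
    apply Finset.sum_subset (Finset.erase_subset _ _)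
    intro y hy hy'
    have : y = 0 := by by_contra h; exact hy' (Finset.mem_erase.2 ⟨h, hy⟩)
    simp [this]
  simp_rw [h1]
  rw [h2]
  refine hN.lintegral_expNeg_counts (fun j => f.measurableSet_fiber _) (fun j => ?_) ?_
    (fun j => hm _ (f.measurableSet_fiber _)) _
  · refine ne_top_of_le_ne_top hfin (measure_mono fun s hs => ?_)
    have h0 : (e j : ℝ≥0∞) ≠ 0 := (Finset.mem_erase.1 (e j).2).1
    simp only [Set.mem_preimage, Set.mem_singleton_iff] at hs
    simpa [hs] using h0
  · intro i j hij
    refine Set.disjoint_left.2 fun s hi hj => hij ?_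
    exact e.injective (Subtype.ext ((Set.mem_singleton_iff.1 hi).symm.trans hj))

end PoissonProcess

/-- The law of the decreasing sequence of the atoms of a Poisson process with intensity
`powerIntensity x`, described by its Laplace functional. -/
structure HasPowerLaw (x : ℝ) (ρ : Measure (ℕ → ℝ)) : Prop where
  isProbabilityMeasure : IsProbabilityMeasure ρ
  pos : ∀ᵐ η ∂ρ, ∀ i, 0 < η i
  antitone : ∀ᵐ η ∂ρ, Antitone η
  laplace : ∀ f : ℝ → ℝ≥0∞, Measurable f →
    ∫⁻ η, expNeg (∑' i, f (η i)) ∂ρ = expNeg (∫⁻ s, (1 - expNeg (f s)) ∂powerIntensity x)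

lemma lintegral_sum_dirac_eq_tsum (η : ℕ → ℝ) {f : ℝ → ℝ≥0∞} (hf : Measurable f) :
    ∫⁻ s, f s ∂(Measure.sum fun i => Measure.dirac (η i)) = ∑' i, f (η i) := by
  rw [lintegral_sum_measure]
  simp_rw [lintegral_dirac' _ hf]

lemma measurable_sum_dirac_apply {Ω : Type*} [MeasurableSpace Ω] {η : ℕ → Ω → ℝ}
    (hη : ∀ i, Measurable (η i)) {A : Set ℝ} (hA : MeasurableSet A) :
    Measurable fun ω => (Measure.sum fun i => Measure.dirac (η i ω)) A := by
  simp_rw [Measure.sum_apply _ hA]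
  exact Measurable.tsum fun i => (Measure.measurable_coe hA).comp
    (Measure.measurable_dirac.comp (hη i))

/-- The counts give the Laplace functional for simple functions supported on sets of finite
intensity; monotone approximation extends it to all measurable f. -/
lemma IsOrderedPoisson.hasPowerLaw {Ω : Type*} [MeasurableSpace Ω] {μ : Measure Ω}
    [IsProbabilityMeasure μ] {x : ℝ} (hx : 0 < x) {η : ℕ → Ω → ℝ} (h : IsOrderedPoisson x η μ) :
    HasPowerLaw x (μ.map fun ω i => η i ω) := by
  have hη : Measurable fun ω i => η i ω := measurable_pi_lambda _ h.measurable
  refine ⟨Measure.isProbabilityMeasure_map hη.aemeasurable, ?_, ?_, fun f hf => ?_⟩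
  · rw [ae_map_iff hη.aemeasurable]
    · exact h.pos
    · rw [Set.ofPred_forall]
      exact MeasurableSet.iInter fun i => measurableSet_lt measurable_const (measurable_pi_apply i)
  · rw [ae_map_iff hη.aemeasurable]
    · exact h.antitone
    · have : {η : ℕ → ℝ | Antitone η} = ⋂ i, {η | η (i + 1) ≤ η i} := by
        ext η
        simp only [Set.mem_ofPred_eq, Set.mem_iInter]
        exact ⟨fun h i => h (Nat.le_succ i), antitone_nat_of_succ_le⟩
      rw [this]
      exact MeasurableSet.iInter fun i =>
        measurableSet_le (measurable_pi_apply _) (measurable_pi_apply i)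
  · have hm : Measurable fun η : ℕ → ℝ => expNeg (∑' i, f (η i)) :=
      measurable_expNeg.comp (Measurable.tsum fun i => hf.comp (measurable_pi_apply i))
    rw [lintegral_map hm hη]
    -- The cutoff at 1/(n+1) keeps the support of finite intensity. It disappears in the limit
    -- because all atoms are positive.
    set F : ℕ → SimpleFunc ℝ ℝ≥0∞ := fun n =>
      (SimpleFunc.eapprox f n).restrict (Set.Ioi (1 / ((n : ℝ) + 1))) with hF
    have hFa : ∀ n s, F n s = (Set.Ioi (1 / ((n : ℝ) + 1))).indicator (SimpleFunc.eapprox f n) s :=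
      fun n s => by rw [hF]; simp [SimpleFunc.restrict_apply _ measurableSet_Ioi]
    have hmono : ∀ s, Monotone fun n => F n s := fun s m n hmn => by
      simp only [hFa]
      refine (Set.indicator_le_indicator (SimpleFunc.monotone_eapprox f hmn s)).trans ?_
      refine Set.indicator_le_indicator_of_subset (Set.Ioi_subset_Ioi ?_) (fun _ => zero_le) s
      exact one_div_le_one_div_of_le (by positivity) (by exact_mod_cast Nat.succ_le_succ hmn)
    have hlim : ∀ s, 0 < s → Tendsto (fun n => F n s) atTop (𝓝 (f s)) := fun s hs => by
      refine (SimpleFunc.tendsto_eapprox hf s).congr' ?_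
      obtain ⟨n₀, hn₀⟩ := exists_nat_one_div_lt hs
      filter_upwards [eventually_ge_atTop n₀] with n hn
      rw [hFa, Set.indicator_of_mem]
      refine lt_of_le_of_lt ?_ hn₀
      exact one_div_le_one_div_of_le (by positivity) (by exact_mod_cast Nat.succ_le_succ hn)
    have hsup : ∀ s, 0 < s → ⨆ n, F n s = f s := fun s hs =>
      tendsto_nhds_unique (tendsto_atTop_iSup (hmono s)) (hlim s hs)
    have key : ∀ n, ∫⁻ ω, expNeg (∑' i, F n (η i ω)) ∂μ =
        expNeg (∫⁻ s, (1 - expNeg (F n s)) ∂powerIntensity x) := fun n => by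
      rw [← h.poisson.lintegral_expNeg_simpleFunc (F n) ?_
        fun A hA => measurable_sum_dirac_apply h.measurable hA]
      · simp_rw [lintegral_sum_dirac_eq_tsum _ (F n).measurable]
      · refine ne_top_of_le_ne_top
          (powerIntensity_Ioi_ne_top hx (ε := 1 / ((n : ℝ) + 1)) (by positivity))
          (measure_mono fun s hs => ?_)
        rw [Function.mem_support, hFa] at hs
        exact Set.mem_of_indicator_ne_zero hs
    have hL : Tendsto (fun n => ∫⁻ ω, expNeg (∑' i, F n (η i ω)) ∂μ) atTop
        (𝓝 (∫⁻ ω, expNeg (∑' i, f (η i ω)) ∂μ)) := by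
      refine tendsto_lintegral_of_dominated_convergence (fun _ => 1) (fun n => ?_) (fun n => ?_)
        (by simp) ?_
      · exact measurable_expNeg.comp (Measurable.tsum fun i =>
          (F n).measurable.comp (h.measurable i))
      · exact ae_of_all _ fun ω => expNeg_le_one _
      · filter_upwards [h.pos] with ω hω
        refine (continuous_expNeg.tendsto _).comp ?_
        have h1 : Monotone fun n => ∑' i, F n (η i ω) := fun m n hmn =>
          ENNReal.tsum_le_tsum fun i => hmono _ hmn
        have h2 : ⨆ n, ∑' i, F n (η i ω) = ∑' i, f (η i ω) := by
          simp_rw [← hsup _ (hω _), ← lintegral_count]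
          exact (lintegral_iSup (f := fun n i => F n (η i ω)) (fun n => measurable_from_nat)
            fun m n hmn i => hmono _ hmn).symm
        rw [← h2]
        exact tendsto_atTop_iSup h1
    have hR : Tendsto (fun n => expNeg (∫⁻ s, (1 - expNeg (F n s)) ∂powerIntensity x)) atTop
        (𝓝 (expNeg (∫⁻ s, (1 - expNeg (f s)) ∂powerIntensity x))) := by
      refine (continuous_expNeg.tendsto _).comp ?_
      refine lintegral_tendsto_of_tendsto_of_monotone
        (fun n => (measurable_one_sub_expNeg.comp (F n).measurable).aemeasurable)
        (ae_of_all _ fun s m n hmn => one_sub_expNeg_mono (hmono s hmn)) ?_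
      filter_upwards [powerIntensity_ae_pos x] with s hs
      refine ENNReal.Tendsto.sub tendsto_const_nhds
        ((continuous_expNeg.tendsto _).comp (hlim s hs)) (Or.inl ENNReal.one_ne_top)
    exact tendsto_nhds_unique hL (by simpa only [key] using hR)

/-! ### Determination of the law of a decreasing sequence by its Laplace functional -/

/-- The moments determine a probability measure on a cube. -/
lemma ext_of_moments {ι : Type*} [Fintype ι] {μ ν : Measure (ι → Set.Icc (0 : ℝ) 1)}
    [IsProbabilityMeasure μ] [IsProbabilityMeasure ν]
    (h : ∀ n : ι → ℕ, ∫ v, ∏ i, (v i : ℝ) ^ n i ∂μ = ∫ v, ∏ i, (v i : ℝ) ^ n i ∂ν) : μ = ν := by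
  set E := ι → Set.Icc (0 : ℝ) 1
  let X : ι → C(E, ℝ) := fun i => ⟨fun v => v i, by fun_prop⟩
  have hint : ∀ (κ : Measure E) [IsProbabilityMeasure κ] (f : C(E, ℝ)), Integrable f κ :=
    fun κ _ f => (BoundedContinuousFunction.mkOfCompact f).integrable κ
  have hcont : ∀ (κ : Measure E) [IsProbabilityMeasure κ],
      Continuous fun f : C(E, ℝ) => ∫ v, f v ∂κ := fun κ _ => by
    refine (LipschitzWith.of_dist_le_mul (K := 1) fun f g => ?_).continuous
    rw [dist_eq_norm, ← integral_sub (hint κ f) (hint κ g), NNReal.coe_one, one_mul]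
    have := norm_integral_le_of_norm_le_const (μ := κ) (f := fun v => f v - g v) (C := dist f g)
      (ae_of_all _ fun v => by rw [← dist_eq_norm]; exact ContinuousMap.dist_apply_le_dist v)
    simpa using this
  have hA : (Algebra.adjoin ℝ (Set.range X)).topologicalClosure = ⊤ := by
    apply ContinuousMap.subalgebra_topologicalClosure_eq_top_of_separatesPoints
    intro v w hvw
    obtain ⟨i, hi⟩ := Function.ne_iff.1 hvw
    refine ⟨X i, ⟨X i, Algebra.subset_adjoin ⟨i, rfl⟩, rfl⟩, fun h => hi (Subtype.ext h)⟩
  -- The functions with equal integrals form a closed subspace; it contains the monomials, hence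
  -- everything by Stone–Weierstrass.
  let M : Submodule ℝ C(E, ℝ) :=
    { carrier := {f | ∫ v, f v ∂μ = ∫ v, f v ∂ν}
      add_mem' := fun {f g} hf hg => by
        simp only [Set.mem_ofPred_eq, ContinuousMap.add_apply] at hf hg ⊢
        rw [integral_add (hint μ f) (hint μ g), integral_add (hint ν f) (hint ν g), hf, hg]
      zero_mem' := by simp
      smul_mem' := fun c f hf => by
        simp only [Set.mem_ofPred_eq, ContinuousMap.smul_apply] at hf ⊢
        rw [integral_smul, integral_smul, hf] }
  have hM : IsClosed (M : Set C(E, ℝ)) := isClosed_eq (hcont μ) (hcont ν)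
  have hmon : ∀ f ∈ Submonoid.closure (Set.range X), ∃ n : ι → ℕ, f = ∏ i, X i ^ n i := by
    classical
    intro f hf
    induction hf using Submonoid.closure_induction with
    | mem f hf =>
      obtain ⟨i, rfl⟩ := hf
      refine ⟨Pi.single i 1, ?_⟩
      rw [Finset.prod_eq_single i (fun j _ hj => by simp [hj]) (by simp)]
      simp
    | one => exact ⟨0, by simp⟩
    | mul f g _ _ hf hg =>
      obtain ⟨n, rfl⟩ := hf
      obtain ⟨m, rfl⟩ := hg
      exact ⟨n + m, by simp [pow_add, Finset.prod_mul_distrib]⟩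
  have hle : Subalgebra.toSubmodule (Algebra.adjoin ℝ (Set.range X)) ≤ M := by
    rw [Algebra.adjoin_eq_span, Submodule.span_le]
    intro f hf
    obtain ⟨n, rfl⟩ := hmon f hf
    have := h n
    simpa [M, X] using this
  refine ext_of_forall_integral_eq_of_IsFiniteMeasure fun f => ?_
  have hf : f.toContinuousMap ∈ (Algebra.adjoin ℝ (Set.range X)).topologicalClosure := by
    rw [hA]; trivial
  have : f.toContinuousMap ∈ M := closure_minimal hle hM hf
  exact this

/-- Translates between positions and counts: the events that generate the σ-algebra of sequences
become events about the numbers of points in half-lines, which Laplace functionals control. -/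
lemma le_tsum_indicator_Ioi_iff {η : ℕ → ℝ} (hη : Antitone η) (t : ℝ) (i : ℕ) :
    ((i : ℝ≥0∞) + 1 ≤ ∑' j, (Set.Ioi t).indicator 1 (η j)) ↔ t < η i := by
  constructor
  · intro h
    by_contra hi
    have : ∑' j, (Set.Ioi t).indicator (1 : ℝ → ℝ≥0∞) (η j) ≤ i := by
      rw [tsum_eq_sum (s := Finset.range i) fun j hj => ?_]
      · refine (Finset.sum_le_card_nsmul _ _ 1 fun j _ => ?_).trans (by simp)
        exact Set.indicator_le_self' (fun _ _ => zero_le) _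
      · refine Set.indicator_of_notMem (fun hj' => hi ?_) _
        exact lt_of_lt_of_le hj' (hη (by simpa using hj))
    have h2 := h.trans this
    have h3 : (i : ℝ≥0∞) < i + 1 := ENNReal.lt_add_right (by simp) one_ne_zero
    exact absurd h2 (not_le.2 h3)
  · intro hi
    calc (i : ℝ≥0∞) + 1 = ∑ j ∈ Finset.range (i + 1), (Set.Ioi t).indicator 1 (η j) := by
          have : ∀ j ∈ Finset.range (i + 1), (Set.Ioi t).indicator (1 : ℝ → ℝ≥0∞) (η j) = 1 :=
            fun j hj => Set.indicator_of_mem (Set.mem_Ioi.2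
              (lt_of_lt_of_le hi (hη (Nat.lt_succ_iff.1 (Finset.mem_range.1 hj))))) _
          rw [Finset.sum_congr rfl this]
          simp
      _ ≤ _ := ENNReal.sum_le_tsum _

/-- Finite intersections of the events t < η_i form a generating π-system, and on decreasing
sequences they are events about finitely many counts N_p of half-lines. The joint law of the numbers
exp(-N_p), which lie in [0, 1] even when N_p is infinite, is determined by its moments. -/
theorem ext_of_laplace {ρ ρ' : Measure (ℕ → ℝ)} [IsProbabilityMeasure ρ] [IsProbabilityMeasure ρ']
    (hρ : ∀ᵐ η ∂ρ, Antitone η) (hρ' : ∀ᵐ η ∂ρ', Antitone η)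
    (h : ∀ f : ℝ → ℝ≥0∞, Measurable f →
      ∫⁻ η, expNeg (∑' i, f (η i)) ∂ρ = ∫⁻ η, expNeg (∑' i, f (η i)) ∂ρ') : ρ = ρ' := by
  let Ev : Finset (ℕ × ℝ) → Set (ℕ → ℝ) := fun F => ⋂ p ∈ F, {η | p.2 < η p.1}
  have hgen : (MeasurableSpace.pi : MeasurableSpace (ℕ → ℝ)) =
      MeasurableSpace.generateFrom (Set.range Ev) := by
    apply le_antisymm
    · refine iSup_le fun i => ?_
      rw [borel_eq_generateFrom_Ioi ℝ |> (BorelSpace.measurable_eq (α := ℝ)).trans,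
        MeasurableSpace.comap_generateFrom]
      refine MeasurableSpace.generateFrom_le ?_
      rintro _ ⟨_, ⟨t, rfl⟩, rfl⟩
      exact MeasurableSpace.measurableSet_generateFrom ⟨{(i, t)}, by simp [Ev]; rfl⟩
    · refine MeasurableSpace.generateFrom_le ?_
      rintro _ ⟨F, rfl⟩
      exact F.measurableSet_biInter fun p _ =>
        measurableSet_lt measurable_const (measurable_pi_apply _)
  have hpi : IsPiSystem (Set.range Ev) := by
    classical
    rintro _ ⟨F, rfl⟩ _ ⟨G, rfl⟩ _
    exact ⟨F ∪ G, by
      ext η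
      simp only [Ev, Set.mem_inter_iff, Set.mem_iInter, Finset.mem_union, or_imp, forall_and]⟩
  refine ext_of_generate_finite _ hgen hpi ?_ (by simp)
  rintro _ ⟨F, rfl⟩
  let N : F → (ℕ → ℝ) → ℝ≥0∞ := fun p η => ∑' j, (Set.Ioi p.1.2).indicator 1 (η j)
  have hNm : ∀ p, Measurable (N p) := fun p => Measurable.tsum fun j =>
    (measurable_one.indicator measurableSet_Ioi).comp (measurable_pi_apply j)
  let V : (ℕ → ℝ) → F → Set.Icc (0 : ℝ) 1 := fun η p =>
    ⟨(expNeg (N p η)).toReal, ENNReal.toReal_nonneg, by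
      simpa using ENNReal.toReal_mono ENNReal.one_ne_top (expNeg_le_one (N p η))⟩
  have hV : Measurable V := measurable_pi_lambda _ fun p =>
    (measurable_expNeg.comp (hNm p)).ennreal_toReal.subtype_mk
  -- A monomial in the variables exp(-N_p) is exp(-∑ n_p N_p), so its mean is the Laplace functional
  -- at a step function.
  have hmom : ∀ (κ : Measure (ℕ → ℝ)) [IsProbabilityMeasure κ] (n : F → ℕ),
      ∫ v, ∏ p, (v p : ℝ) ^ n p ∂(κ.map V) =
        (∫⁻ η, expNeg (∑' j, ∑ p : F, (n p : ℝ≥0∞) * (Set.Ioi p.1.2).indicator 1 (η j))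
          ∂κ).toReal := fun κ _ n => by
    have hc : Continuous fun v : F → Set.Icc (0 : ℝ) 1 => ∏ p, (v p : ℝ) ^ n p := by fun_prop
    rw [integral_map hV.aemeasurable hc.aestronglyMeasurable, ← integral_toReal]
    · refine integral_congr_ae (ae_of_all _ fun η => ?_)
      have : ∑' j, ∑ p : F, (n p : ℝ≥0∞) * (Set.Ioi p.1.2).indicator 1 (η j)
          = ∑ p : F, N p η * n p := by
        rw [Summable.tsum_finsetSum fun _ _ => ENNReal.summable]
        refine Finset.sum_congr rfl fun p _ => ?_
        rw [ENNReal.tsum_mul_left, mul_comm]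
      simp only [this, expNeg_sum, expNeg_mul_natCast, ENNReal.toReal_prod, ENNReal.toReal_pow, V]
    · refine (measurable_expNeg.comp (Measurable.tsum fun j => Finset.measurable_sum _ fun p _ =>
        ((measurable_one.indicator measurableSet_Ioi).comp
          (measurable_pi_apply j)).const_mul _)).aemeasurable
    · exact ae_of_all _ fun η => (expNeg_ne_top _).lt_top
  have hmapV : ρ.map V = ρ'.map V := by
    have := Measure.isProbabilityMeasure_map (μ := ρ) hV.aemeasurable
    have := Measure.isProbabilityMeasure_map (μ := ρ') hV.aemeasurable
    refine ext_of_moments fun n => ?_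
    rw [hmom ρ n, hmom ρ' n,
      h (fun s => ∑ p : F, (n p : ℝ≥0∞) * (Set.Ioi p.1.2).indicator 1 s)]
    exact Finset.measurable_sum _ fun p _ =>
      (measurable_one.indicator measurableSet_Ioi).const_mul _
  let B : Set (F → Set.Icc (0 : ℝ) 1) :=
    ⋂ p, {v | (v p : ℝ) ≤ (expNeg ((p.1.1 : ℝ≥0∞) + 1)).toReal}
  have hB : MeasurableSet B := MeasurableSet.iInter fun p => measurableSet_le (by fun_prop)
    measurable_const
  have hEv : ∀ η, Antitone η → (η ∈ Ev F ↔ η ∈ V ⁻¹' B) := fun η hη => by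
    simp only [Ev, B, V, Set.mem_iInter, Set.mem_ofPred_eq, Set.mem_preimage, Subtype.forall]
    refine forall₂_congr fun p hp => ?_
    rw [ENNReal.toReal_le_toReal (expNeg_ne_top _) (expNeg_ne_top _),
      ← le_tsum_indicator_Ioi_iff hη]
    have hanti : StrictAnti expNeg := expNeg_antitone.strictAnti_of_injective expNeg_injective
    exact hanti.le_iff_ge.symm
  have hval : ∀ κ : Measure (ℕ → ℝ), (∀ᵐ η ∂κ, Antitone η) → κ (Ev F) = κ.map V B := by
    intro κ hκ
    rw [Measure.map_apply hV hB]
    refine measure_congr ?_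
    filter_upwards [hκ] with η hη
    exact propext (hEv η hη)
  rw [hval ρ hρ, hval ρ' hρ', hmapV]

lemma HasPowerLaw.unique {x : ℝ} {ρ ρ' : Measure (ℕ → ℝ)} (h : HasPowerLaw x ρ)
    (h' : HasPowerLaw x ρ') : ρ = ρ' := by
  have := h.isProbabilityMeasure
  have := h'.isProbabilityMeasure
  exact ext_of_laplace h.antitone h'.antitone fun f hf => by rw [h.laplace f hf, h'.laplace f hf]

/-! ### Decreasing order -/

/-- The index `j` precedes `i` in the decreasing order of the weights `w`. -/
def Precedes (w : ℕ → ℝ) (j i : ℕ) : Prop := w i < w j ∨ (w i = w j ∧ j < i)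

lemma precedes_irrefl (w : ℕ → ℝ) (i : ℕ) : ¬ Precedes w i i := by simp [Precedes]

lemma Precedes.trans {w : ℕ → ℝ} {i j l : ℕ} (h : Precedes w i j) (h' : Precedes w j l) :
    Precedes w i l := by
  unfold Precedes at *
  grind

lemma precedes_trichotomy (w : ℕ → ℝ) {i j : ℕ} (h : i ≠ j) :
    Precedes w i j ∨ Precedes w j i := by
  unfold Precedes
  grind

lemma isDecreasingOrder_iff {w : ℕ → ℝ} {σ : Equiv.Perm ℕ} :
    IsDecreasingOrder w σ ↔ ∀ m n, m < n → Precedes w (σ m) (σ n) := Iff.rfl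

lemma IsDecreasingOrder.precedes_iff {w : ℕ → ℝ} {σ : Equiv.Perm ℕ} (h : IsDecreasingOrder w σ)
    {m n : ℕ} : Precedes w (σ m) (σ n) ↔ m < n := by
  refine ⟨fun hp => ?_, h m n⟩
  by_contra hmn
  rcases (not_lt.1 hmn).eq_or_lt with rfl | hlt
  · exact precedes_irrefl _ _ hp
  · exact precedes_irrefl _ _ (hp.trans (h _ _ hlt))

lemma IsDecreasingOrder.setOf_precedes {w : ℕ → ℝ} {σ : Equiv.Perm ℕ}
    (h : IsDecreasingOrder w σ) (m : ℕ) : {j | Precedes w j (σ m)} = σ '' Set.Iio m := by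
  ext j
  obtain ⟨n, rfl⟩ := σ.surjective j
  simp [h.precedes_iff]

lemma IsDecreasingOrder.unique {w : ℕ → ℝ} {σ τ : Equiv.Perm ℕ} (hσ : IsDecreasingOrder w σ)
    (hτ : IsDecreasingOrder w τ) : σ = τ := by
  ext i
  have h1 := hσ.setOf_precedes i
  have h2 := hτ.setOf_precedes (τ.symm (σ i))
  rw [Equiv.apply_symm_apply, h1] at h2
  have h3 := congrArg Set.ncard h2
  rw [Set.ncard_image_of_injective _ σ.injective, Set.ncard_image_of_injective _ τ.injective,
    Set.ncard_Iio_nat, Set.ncard_Iio_nat] at h3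
  conv_rhs => rw [h3]
  simp

lemma decreasingOrder_eq {w : ℕ → ℝ} {σ : Equiv.Perm ℕ} (h : IsDecreasingOrder w σ) :
    decreasingOrder w = σ := by
  have hex : ∃ σ, IsDecreasingOrder w σ := ⟨σ, h⟩
  rw [decreasingOrder, dif_pos hex]
  exact hex.choose_spec.unique h

/-- If every index has finitely many predecessors, their number is its position. This rank is
injective by trichotomy, and surjective because its range is infinite and closed downwards. -/
lemma exists_isDecreasingOrder_iff {w : ℕ → ℝ} :
    (∃ σ, IsDecreasingOrder w σ) ↔ ∀ i, {j | Precedes w j i}.Finite := by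
  constructor
  · rintro ⟨σ, h⟩ i
    obtain ⟨m, rfl⟩ := σ.surjective i
    rw [h.setOf_precedes]
    exact (Set.finite_Iio m).image _
  · intro h
    let rank : ℕ → ℕ := fun i => {j | Precedes w j i}.ncard
    have hlt : ∀ {i j}, Precedes w i j → rank i < rank j := fun {i j} hij =>
      Set.ncard_lt_ncard ⟨fun l hl => Precedes.trans hl hij, fun hsub =>
        precedes_irrefl w i (hsub hij)⟩ (h j)
    have hinj : Function.Injective rank := fun i j hij => by
      by_contra hne
      rcases precedes_trichotomy w hne with h1 | h1 <;> have := hlt h1 <;> omega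
    have himg : ∀ i, rank '' {j | Precedes w j i} = Set.Iio (rank i) := fun i => by
      refine Set.eq_of_subset_of_ncard_le ?_ ?_ (Set.finite_Iio _)
      · rintro _ ⟨j, hj, rfl⟩
        exact hlt hj
      · rw [Set.ncard_Iio_nat, Set.ncard_image_of_injective _ hinj]
    have hsurj : Function.Surjective rank := fun n => by
      have hinf : (Set.range rank).Infinite := Set.infinite_range_of_injective hinj
      obtain ⟨_, ⟨i, rfl⟩, hi⟩ := hinf.exists_gt n
      have : n ∈ rank '' {j | Precedes w j i} := by rw [himg]; exact hi
      obtain ⟨j, -, hj⟩ := this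
      exact ⟨j, hj⟩
    let e := Equiv.ofBijective rank ⟨hinj, hsurj⟩
    refine ⟨e.symm, isDecreasingOrder_iff.2 fun m n hmn => ?_⟩
    have hm : rank (e.symm m) = m := e.apply_symm_apply m
    have hn : rank (e.symm n) = n := e.apply_symm_apply n
    rcases precedes_trichotomy w (i := e.symm m) (j := e.symm n)
      (fun h => hmn.ne (e.symm.injective h)) with h1 | h1
    · exact h1
    · have := hlt h1
      omega

lemma exists_isDecreasingOrder {w : ℕ → ℝ} (hs : Summable w) (hpos : ∀ i, 0 < w i) :
    ∃ σ, IsDecreasingOrder w σ := by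
  refine exists_isDecreasingOrder_iff.2 fun i => ?_
  have h := hs.tendsto_cofinite_zero.eventually (gt_mem_nhds (hpos i))
  refine (Filter.eventually_cofinite.1 h).subset fun j hj => ?_
  rcases hj with hj | hj
  · exact not_lt.2 hj.le
  · exact not_lt.2 hj.1.le

lemma isDecreasingOrder_decreasingOrder {w : ℕ → ℝ} (h : ∃ σ, IsDecreasingOrder w σ) :
    IsDecreasingOrder w (decreasingOrder w) := by
  obtain ⟨σ, hσ⟩ := h
  rwa [decreasingOrder_eq hσ]

lemma IsDecreasingOrder.antitone {w : ℕ → ℝ} {σ : Equiv.Perm ℕ} (h : IsDecreasingOrder w σ) :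
    Antitone fun m => w (σ m) := antitone_nat_of_succ_le fun n => by
  rcases h n (n + 1) n.lt_succ_self with h | h
  exacts [h.le, h.1.le]

lemma isDecreasingOrder_of_strictAnti {w : ℕ → ℝ} {σ : Equiv.Perm ℕ}
    (h : StrictAnti fun m => w (σ m)) : IsDecreasingOrder w σ := fun _ _ hmn => Or.inl (h hmn)

lemma measurableSet_precedes (i j : ℕ) : MeasurableSet {w : ℕ → ℝ | Precedes w i j} := by
  refine (measurableSet_lt (measurable_pi_apply j) (measurable_pi_apply i)).union ?_
  exact (measurableSet_eq_fun (measurable_pi_apply j) (measurable_pi_apply i)).inter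
    (MeasurableSet.const _)

lemma measurableSet_exists_isDecreasingOrder :
    MeasurableSet {w : ℕ → ℝ | ∃ σ, IsDecreasingOrder w σ} := by
  have : {w : ℕ → ℝ | ∃ σ, IsDecreasingOrder w σ} =
      ⋂ i, ⋃ F : Finset ℕ, ⋂ j ∈ {j | j ∉ F}, {w | Precedes w j i}ᶜ := by
    ext w
    simp only [Set.mem_ofPred_eq, exists_isDecreasingOrder_iff, Set.mem_iInter, Set.mem_iUnion,
      Set.mem_compl_iff]
    refine forall_congr' fun i => ⟨fun h => ⟨h.toFinset, fun j hj => by simpa using hj⟩, ?_⟩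
    rintro ⟨F, hF⟩
    exact F.finite_toSet.subset fun j hj => by_contra fun h => hF j h hj
  rw [this]
  exact MeasurableSet.iInter fun i => MeasurableSet.iUnion fun F =>
    MeasurableSet.biInter (Set.to_countable _) fun j _ => (measurableSet_precedes j i).compl

lemma measurable_decreasingOrder (m : ℕ) :
    Measurable fun w : ℕ → ℝ => decreasingOrder w m := by
  have hex := measurableSet_exists_isDecreasingOrder
  refine measurable_to_countable' fun i => ?_
  -- The index i has position m exactly when its predecessors form a set of m elements, and there
  -- are countably many finite sets. The second piece is the default value, the identity.
  have : (fun w : ℕ → ℝ => decreasingOrder w m) ⁻¹' {i} =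
      ({w | ∃ σ, IsDecreasingOrder w σ} ∩ ⋃ F ∈ {F : Finset ℕ | F.card = m},
        ⋂ j, {w | j ∈ F ↔ Precedes w j i}) ∪
      ({w | ∃ σ, IsDecreasingOrder w σ}ᶜ ∩ {_w | m = i}) := by
    ext w
    by_cases h : ∃ σ, IsDecreasingOrder w σ
    · simp only [Set.mem_preimage, Set.mem_singleton_iff, Set.mem_union, Set.mem_inter_iff,
        Set.mem_ofPred_eq, h, true_and, Set.mem_compl_iff, not_true_eq_false, false_and, or_false,
        Set.mem_iUnion, Set.mem_iInter, exists_prop]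
      obtain ⟨σ, hσ⟩ := h
      rw [decreasingOrder_eq hσ]
      constructor
      · rintro rfl
        refine ⟨(Finset.range m).map σ.toEmbedding, by simp, fun j => ?_⟩
        have := Set.ext_iff.1 (hσ.setOf_precedes m) j
        simp only [Set.mem_ofPred_eq] at this
        rw [this]
        simp
      · rintro ⟨F, hF, hFi⟩
        obtain ⟨n, rfl⟩ := σ.surjective i
        have h1 : (F : Set ℕ) = σ '' Set.Iio n := by
          rw [← hσ.setOf_precedes]
          ext j
          exact hFi j
        have h2 := congrArg Set.ncard h1
        rw [Set.ncard_image_of_injective _ σ.injective, Set.ncard_Iio_nat,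
          Set.ncard_coe_finset, hF] at h2
        rw [h2]
    · simp [decreasingOrder, h]
  rw [this]
  refine (hex.inter (MeasurableSet.biUnion (Set.to_countable _) fun F _ =>
    MeasurableSet.iInter fun j => ?_)).union (hex.compl.inter (MeasurableSet.const _))
  by_cases hj : j ∈ F
  · simpa [hj] using measurableSet_precedes j i
  · simp only [hj, false_iff]
    exact (measurableSet_precedes j i).compl

lemma measurable_apply_decreasingOrder (m : ℕ) :
    Measurable fun w : ℕ → ℝ => w (decreasingOrder w m) := by
  have : Measurable fun p : (ℕ → ℝ) × ℕ => p.1 p.2 :=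
    measurable_from_prod_countable_left fun n => measurable_pi_apply n
  exact this.comp (measurable_id.prodMk (measurable_decreasingOrder m))

/-! ### Marked Poisson processes -/

section Marked

variable {M : Type*} [MeasurableSpace M] {τ : Measure M} [IsProbabilityMeasure τ] {x : ℝ}
  {ρ : Measure (ℕ → ℝ)}

/-- Independence turns the mean into an infinite product; `negLog` rewrites it as the exponential of
a sum, the form to which a Laplace functional applies. -/
lemma lintegral_expNeg_tsum_infinitePi {g : ℕ → M → ℝ≥0∞} (hg : ∀ i, Measurable (g i)) :
    ∫⁻ m, expNeg (∑' i, g i (m i)) ∂Measure.infinitePi (fun _ : ℕ => τ) =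
      expNeg (∑' i, negLog (∫⁻ a, expNeg (g i a) ∂τ)) := by
  have hle : ∀ i, ∫⁻ a, expNeg (g i a) ∂τ ≤ 1 := fun i => by
    refine (lintegral_mono fun a => expNeg_le_one (g i a)).trans ?_
    simp
  have h1 := tendsto_prod_expNeg fun i => negLog (∫⁻ a, expNeg (g i a) ∂τ)
  simp_rw [expNeg_negLog (hle _)] at h1
  refine tendsto_nhds_unique ?_ h1
  have h2 : ∀ n, ∏ i ∈ Finset.range n, ∫⁻ a, expNeg (g i a) ∂τ =
      ∫⁻ m, ∏ i ∈ Finset.range n, expNeg (g i (m i)) ∂Measure.infinitePi (fun _ : ℕ => τ) :=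
    fun n => (lintegral_infinitePi_prod (fun _ : ℕ => τ) (Finset.range n)
      (f := fun i a => expNeg (g i a)) fun i => measurable_expNeg.comp (hg i)).symm
  simp_rw [h2]
  refine tendsto_lintegral_of_dominated_convergence (fun _ => 1) (fun n => ?_) (fun n => ?_)
    (by simp) ?_
  · exact Finset.measurable_prod _ fun i _ =>
      (measurable_expNeg.comp (hg i)).comp (measurable_pi_apply i)
  · exact ae_of_all _ fun m => Finset.prod_le_one' fun i _ => expNeg_le_one _
  · exact ae_of_all _ fun m => tendsto_prod_expNeg fun i => g i (m i)

lemma lintegral_one_sub_expNeg {g : M → ℝ≥0∞} (hg : Measurable g) :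
    ∫⁻ m, (1 - expNeg (g m)) ∂τ = 1 - ∫⁻ m, expNeg (g m) ∂τ := by
  have hle : ∫⁻ m, expNeg (g m) ∂τ ≤ 1 :=
    (lintegral_mono fun a => expNeg_le_one (g a)).trans (by simp)
  have hm : Measurable fun m => expNeg (g m) := measurable_expNeg.comp hg
  rw [lintegral_sub hm (ne_top_of_le_ne_top ENNReal.one_ne_top hle)
    (ae_of_all _ fun a => expNeg_le_one _)]
  simp

/-- The marking theorem: integrating out the marks replaces f by -log E[exp(-f(s, ·))], and the
Laplace functional of the unmarked process is evaluated there. -/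
lemma HasPowerLaw.lintegral_marked (h : HasPowerLaw x ρ) {f : ℝ → M → ℝ≥0∞}
    (hf : Measurable (Function.uncurry f)) :
    ∫⁻ z, expNeg (∑' i, f (z.1 i) (z.2 i)) ∂(ρ.prod (Measure.infinitePi fun _ : ℕ => τ)) =
      expNeg (∫⁻ s, ∫⁻ m, (1 - expNeg (f s m)) ∂τ ∂powerIntensity x) := by
  have := h.isProbabilityMeasure
  have hfs : ∀ s, Measurable (f s) := fun s => hf.comp measurable_prodMk_left
  have hE : Measurable fun s => ∫⁻ a, expNeg (f s a) ∂τ :=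
    (measurable_expNeg.comp hf).lintegral_prod_right'
  rw [lintegral_prod]
  · simp only []
    rw [lintegral_congr fun η : ℕ → ℝ => lintegral_expNeg_tsum_infinitePi fun i => hfs (η i),
      h.laplace (fun s => negLog (∫⁻ a, expNeg (f s a) ∂τ)) (measurable_negLog.comp hE)]
    congr 1
    refine lintegral_congr fun s => ?_
    have hle : ∫⁻ a, expNeg (f s a) ∂τ ≤ 1 :=
      (lintegral_mono fun a => expNeg_le_one (f s a)).trans (by simp)
    rw [expNeg_negLog hle, lintegral_one_sub_expNeg (hfs s)]
  · have hm : ∀ i, Measurable fun z : (ℕ → ℝ) × (ℕ → M) => f (z.1 i) (z.2 i) := fun i => by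
      have hp : Measurable fun z : (ℕ → ℝ) × (ℕ → M) => (z.1 i, z.2 i) := by fun_prop
      exact hf.comp hp
    exact (measurable_expNeg.comp (Measurable.tsum hm)).aemeasurable

/-- By scaling under the integral over the marks, independent factors multiply the intensity by the
constant E[F^x]. -/
lemma HasPowerLaw.lintegral_marked_mul (h : HasPowerLaw x ρ) {F : M → ℝ} (hF : Measurable F)
    (hpos : ∀ m, 0 < F m) {f : ℝ → ℝ≥0∞} (hf : Measurable f) :
    ∫⁻ z, expNeg (∑' i, f (z.1 i * F (z.2 i))) ∂(ρ.prod (Measure.infinitePi fun _ : ℕ => τ)) =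
      expNeg ((∫⁻ m, ENNReal.ofReal (F m ^ x) ∂τ) *
        ∫⁻ s, (1 - expNeg (f s)) ∂powerIntensity x) := by
  have hm : Measurable fun p : ℝ × M => p.1 * F p.2 := by fun_prop
  have hm1 : Measurable fun s => 1 - expNeg (f s) := measurable_one_sub_expNeg.comp hf
  rw [h.lintegral_marked (f := fun s m => f (s * F m)) (hf.comp hm),
    lintegral_lintegral_swap (f := fun s m => 1 - expNeg (f (s * F m)))
      ((hm1.comp hm).aemeasurable), ← lintegral_mul_const _ (by fun_prop)]
  congr 1
  refine lintegral_congr fun m => ?_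
  rw [← lintegral_powerIntensity_comp_mul (hpos m) hm1]
  simp_rw [mul_comm (F m)]

/-- For t > 0 the variable exp(-tS) is at most the indicator of S < ∞, and its mean tends to 1 as t
decreases to 0. -/
lemma ae_lt_top_of_laplace {Ω : Type*} [MeasurableSpace Ω] {μ : Measure Ω}
    [IsProbabilityMeasure μ] {S : Ω → ℝ≥0∞} (hS : Measurable S) {y : ℝ} (hy : 0 < y)
    {B : ℝ≥0∞} (hB : B ≠ ∞) (h : ∀ t : ℝ, 0 < t →
      ∫⁻ ω, expNeg (ENNReal.ofReal t * S ω) ∂μ = expNeg (ENNReal.ofReal (t ^ y) * B)) :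
    ∀ᵐ ω ∂μ, S ω < ∞ := by
  have hms : MeasurableSet {ω | S ω < ∞} := measurableSet_lt hS measurable_const
  have hle : ∀ t : ℝ, 0 < t → expNeg (ENNReal.ofReal (t ^ y) * B) ≤ μ {ω | S ω < ∞} := by
    intro t ht
    rw [← h t ht, ← lintegral_indicator_one hms]
    refine lintegral_mono fun ω => ?_
    by_cases hω : S ω < ∞
    · rw [Set.indicator_of_mem (by exact hω)]
      exact expNeg_le_one _
    · rw [not_lt_top_iff.1 hω, ENNReal.mul_top (by simpa using ht), expNeg_top]
      exact zero_le
  have hlim : Tendsto (fun t : ℝ => expNeg (ENNReal.ofReal (t ^ y) * B)) (𝓝[>] 0) (𝓝 1) := by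
    rw [← expNeg_zero]
    refine (continuous_expNeg.tendsto _).comp ?_
    have h1 : Tendsto (fun t : ℝ => ENNReal.ofReal (t ^ y)) (𝓝[>] 0) (𝓝 0) := by
      have := (Real.continuousAt_rpow_const (0 : ℝ) y (Or.inr hy.le)).tendsto
      rw [Real.zero_rpow hy.ne'] at this
      have h2 := (ENNReal.continuous_ofReal.tendsto 0).comp 
        (this.mono_left (nhdsWithin_le_nhds (s := Set.Ioi 0)))
      rwa [ENNReal.ofReal_zero] at h2
    simpa using ENNReal.Tendsto.mul_const h1 (Or.inr hB)
  have h1 : 1 ≤ μ {ω | S ω < ∞} :=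
    le_of_tendsto hlim (eventually_nhdsWithin_of_forall fun t ht => hle t ht)
  exact (mem_ae_iff_prob_eq_one hms).2 (le_antisymm prob_le_one h1)

variable {F : M → ℝ}

lemma HasPowerLaw.ae_summable_marked (h : HasPowerLaw x ρ) (hx : 0 < x) (hx1 : x < 1)
    (hF : Measurable F) (hpos : ∀ m, 0 < F m) (hint : ∫⁻ m, ENNReal.ofReal (F m ^ x) ∂τ ≠ ∞) :
    ∀ᵐ z ∂(ρ.prod (Measure.infinitePi fun _ : ℕ => τ)),
      (∀ i, 0 < z.1 i * F (z.2 i)) ∧ Summable fun i => z.1 i * F (z.2 i) := by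
  have := h.isProbabilityMeasure
  have hp : ∀ᵐ z ∂(ρ.prod (Measure.infinitePi fun _ : ℕ => τ)), ∀ i, 0 < z.1 i :=
    Measure.quasiMeasurePreserving_fst.ae h.pos
  have hS : ∀ᵐ z ∂(ρ.prod (Measure.infinitePi fun _ : ℕ => τ)),
      ∑' i, ENNReal.ofReal (z.1 i * F (z.2 i)) < ∞ := by
    -- This is where x < 1 enters: 1 - exp(-s) is integrable against the intensity.
    have hid : ∫⁻ s : ℝ, (1 - expNeg (ENNReal.ofReal (1 * s ^ (1 : ℝ)))) ∂powerIntensity x ≠ ∞ :=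
      lintegral_one_sub_expNeg_rpow_ne_top hx hx1
    refine ae_lt_top_of_laplace (Measurable.tsum fun i => by fun_prop) hx
      (ENNReal.mul_ne_top hint hid) fun t ht => ?_
    have h1 := h.lintegral_marked_mul (τ := τ) hF hpos
      (f := fun s => ENNReal.ofReal t * ENNReal.ofReal s) (by fun_prop)
    simp_rw [ENNReal.tsum_mul_left] at h1
    rw [h1, mul_left_comm]
    congr 2
    rw [← lintegral_powerIntensity_comp_mul ht]
    · refine lintegral_congr fun s => ?_
      rw [one_mul, Real.rpow_one, ENNReal.ofReal_mul ht.le]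
    · exact measurable_one_sub_expNeg.comp (by fun_prop)
  filter_upwards [hp, hS] with z hz hzS
  have hpz : ∀ i, 0 < z.1 i * F (z.2 i) := fun i => mul_pos (hz i) (hpos _)
  refine ⟨hpz, ?_⟩
  have := ENNReal.summable_toReal hzS.ne
  simpa only [ENNReal.toReal_ofReal (hpz _).le] using this

/-- The points of a Poisson process with intensity `powerIntensity x`, multiplied by independent
identically distributed factors with `x`-th moment `1` and put in decreasing order, have the same
law as before. -/
theorem HasPowerLaw.measurePreserving_marked (h : HasPowerLaw x ρ) (hx : 0 < x) (hx1 : x < 1)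
    (hF : Measurable F) (hpos : ∀ m, 0 < F m) (hint : ∫⁻ m, ENNReal.ofReal (F m ^ x) ∂τ = 1) :
    MeasurePreserving (fun (z : (ℕ → ℝ) × (ℕ → M)) n =>
        z.1 (decreasingOrder (fun i => z.1 i * F (z.2 i)) n) *
          F (z.2 (decreasingOrder (fun i => z.1 i * F (z.2 i)) n)))
      (ρ.prod (Measure.infinitePi fun _ : ℕ => τ)) ρ := by
  have := h.isProbabilityMeasure
  have hb : Measurable fun (z : (ℕ → ℝ) × (ℕ → M)) i => z.1 i * F (z.2 i) := by fun_prop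
  have hm : Measurable (fun (z : (ℕ → ℝ) × (ℕ → M)) n =>
        z.1 (decreasingOrder (fun i => z.1 i * F (z.2 i)) n) *
          F (z.2 (decreasingOrder (fun i => z.1 i * F (z.2 i)) n))) :=
    measurable_pi_lambda _ fun n => (measurable_apply_decreasingOrder n).comp hb
  refine ⟨hm, ?_⟩
  have := Measure.isProbabilityMeasure_map
    (μ := ρ.prod (Measure.infinitePi fun _ : ℕ => τ)) hm.aemeasurable
  refine ext_of_laplace ?_ h.antitone fun f hf => ?_
  · have hms : MeasurableSet {η : ℕ → ℝ | Antitone η} := by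
      have : {η : ℕ → ℝ | Antitone η} = ⋂ i, {η | η (i + 1) ≤ η i} := by
        ext η
        simp only [Set.mem_ofPred_eq, Set.mem_iInter]
        exact ⟨fun h i => h (Nat.le_succ i), antitone_nat_of_succ_le⟩
      rw [this]
      exact MeasurableSet.iInter fun i =>
        measurableSet_le (measurable_pi_apply _) (measurable_pi_apply i)
    rw [ae_map_iff hm.aemeasurable hms]
    filter_upwards [h.ae_summable_marked hx hx1 hF hpos (by rw [hint]; simp)] with z hz
    exact (isDecreasingOrder_decreasingOrder (exists_isDecreasingOrder hz.2 hz.1)).antitone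
  · have hfm : Measurable fun η : ℕ → ℝ => expNeg (∑' i, f (η i)) :=
      measurable_expNeg.comp (Measurable.tsum fun i => hf.comp (measurable_pi_apply i))
    rw [lintegral_map hfm hm, h.laplace f hf]
    have h1 := h.lintegral_marked_mul (τ := τ) hF hpos hf
    rw [hint, one_mul] at h1
    rw [← h1]
    -- Sorting only permutes the terms of the sum of f over the points.
    refine lintegral_congr fun z => ?_
    congr 1
    exact Equiv.tsum_eq (decreasingOrder fun i => z.1 i * F (z.2 i))
      fun i => f (z.1 i * F (z.2 i))

/-- Stability of sums along a marked Poisson process. -/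
lemma HasPowerLaw.lintegral_stable (h : HasPowerLaw x ρ) (hx : 0 < x) {y : ℝ} (hxy : x < y)
    {Z : M → ℝ≥0∞} (hZ : Measurable Z) {B : ℝ≥0∞} (hB : B ≠ ∞) (hZB : ∀ t : ℝ, 0 < t →
      ∫⁻ m, expNeg (ENNReal.ofReal t * Z m) ∂τ = expNeg (ENNReal.ofReal (t ^ y) * B)) :
    ∃ B' : ℝ≥0∞, B' ≠ ∞ ∧ ∀ t : ℝ, 0 < t →
      ∫⁻ z, expNeg (ENNReal.ofReal t * ∑' i, ENNReal.ofReal (z.1 i) * Z (z.2 i))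
        ∂(ρ.prod (Measure.infinitePi fun _ : ℕ => τ)) = expNeg (ENNReal.ofReal (t ^ x) * B') := by
  obtain ⟨b, rfl⟩ : ∃ b : NNReal, (b : ℝ≥0∞) = B := ⟨_, ENNReal.coe_toNNReal hB⟩
  -- For s > 0, H(s) = 1 - E[exp(-sZ)]. Its integral is the constant B', finite because x < y, and
  -- dilation by t produces the factor t^x.
  set H : ℝ → ℝ≥0∞ := fun s => 1 - expNeg (ENNReal.ofReal (b * s ^ y)) with hH
  have hHm : Measurable H := measurable_one_sub_expNeg.comp (by fun_prop)
  refine ⟨∫⁻ s, H s ∂powerIntensity x, lintegral_one_sub_expNeg_rpow_ne_top hx hxy, fun t ht => ?_⟩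
  have h1 := h.lintegral_marked (τ := τ)
    (f := fun s m => ENNReal.ofReal t * (ENNReal.ofReal s * Z m))
    (by unfold Function.uncurry; fun_prop)
  simp_rw [ENNReal.tsum_mul_left] at h1
  rw [h1, ← lintegral_powerIntensity_comp_mul ht hHm]
  congr 1
  refine lintegral_congr_ae ?_
  filter_upwards [powerIntensity_ae_pos x] with s hs
  rw [lintegral_one_sub_expNeg (by fun_prop)]
  simp_rw [← mul_assoc, ← ENNReal.ofReal_mul ht.le]
  rw [hZB _ (mul_pos ht hs), hH]
  congr 2
  rw [ENNReal.ofReal_mul b.coe_nonneg, ENNReal.ofReal_coe_nnreal, mul_comm]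

end Marked

/-! ### The tree -/

variable {k : ℕ}

/-- The root of a tree of positive height. -/
def rootVertex : Vertex (k + 1) := ⟨0, fun _ => 0⟩

/-- The vertex `v` of the subtree at the `i`-th child of the root. -/
def consVertex (i : ℕ) (v : Vertex k) : Vertex (k + 1) :=
  ⟨v.1.succ, (Fin.cons i v.2 : Fin ((v.1 : ℕ) + 1) → ℕ)⟩

/-- A vertex is the root or belongs to the subtree at one of its children. -/
noncomputable def vertexEquiv (k : ℕ) : Option (ℕ × Vertex k) ≃ Vertex (k + 1) :=
  Equiv.ofBijective (fun o => o.elim rootVertex fun p => consVertex p.1 p.2) <| by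
    constructor
    · rintro (_ | ⟨i, ⟨l, t⟩⟩) (_ | ⟨j, ⟨m, s⟩⟩) h
      · rfl
      · exact absurd (congrArg Sigma.fst h) (Fin.succ_ne_zero m).symm
      · exact absurd (congrArg Sigma.fst h) (Fin.succ_ne_zero l)
      · obtain rfl : l = m := Fin.succ_injective _ (congrArg Sigma.fst h)
        have h2 := eq_of_heq (Sigma.mk.inj_iff.1 h).2
        obtain ⟨rfl, rfl⟩ := Fin.cons_injective2 h2
        rfl
    · rintro ⟨l, t⟩
      induction l using Fin.cases with
      | zero => exact ⟨none, Sigma.ext rfl (heq_of_eq (funext fun j => j.elim0))⟩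
      | succ l =>
        let t' : Fin ((l : ℕ) + 1) → ℕ := t
        exact ⟨some (t' 0, ⟨l, Fin.tail t'⟩),
          Sigma.ext rfl (heq_of_eq (Fin.cons_self_tail t'))⟩

@[simp] lemma vertexEquiv_none : vertexEquiv k none = rootVertex := rfl

@[simp] lemma vertexEquiv_some (p : ℕ × Vertex k) :
    vertexEquiv k (some p) = consVertex p.1 p.2 := rfl

lemma truncate_zero (α : Address (k + 1)) : truncate α 0 = rootVertex :=
  Sigma.ext rfl (heq_of_eq (funext fun j => j.elim0))

lemma truncate_succ (α : Address (k + 1)) (l : Fin k) :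
    truncate α l.succ = consVertex (α 0) (truncate (Fin.tail α) l) := by
  refine Sigma.ext rfl (heq_of_eq ?_)
  funext j
  change Fin ((l : ℕ) + 1) at j
  induction j using Fin.cases with
  | zero => rfl
  | succ j => rfl

lemma leafWeight_succ (e : Vertex (k + 1) → ℕ → ℝ) (α : Address (k + 1)) :
    leafWeight e α = e rootVertex (α 0) *
      leafWeight (fun v => e (consVertex (α 0) v)) (Fin.tail α) := by
  simp only [leafWeight, Fin.prod_univ_succ, truncate_zero, truncate_succ]
  rfl

lemma le_commonLevel_iff {α β : Address k} {l : ℕ} (hl : l ≤ k) :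
    l ≤ commonLevel α β ↔ ∀ j : Fin k, (j : ℕ) < l → α j = β j := by
  constructor
  · intro h j hj
    have := Nat.findGreatest_spec (P := fun l => ∀ j : Fin k, (j : ℕ) < l → α j = β j)
      (n := k) (Nat.zero_le k) (by simp)
    exact this j (lt_of_lt_of_le hj h)
  · intro h
    exact Nat.le_findGreatest hl h

lemma commonLevel_le (α β : Address k) : commonLevel α β ≤ k := Nat.findGreatest_le k

/-- The bijections between the leaves that preserve the tree structure. -/
def IsTreeAut (θ : Equiv.Perm (Address k)) : Prop :=
  ∀ (α β : Address k) (l : ℕ), (∀ j : Fin k, (j : ℕ) < l → θ α j = θ β j) ↔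
    ∀ j : Fin k, (j : ℕ) < l → α j = β j

lemma IsTreeAut.commonLevel {θ : Equiv.Perm (Address k)} (h : IsTreeAut θ) (α β : Address k) :
    commonLevel (θ α) (θ β) = commonLevel α β := by
  apply le_antisymm
  · have := commonLevel_le (θ α) (θ β)
    rw [le_commonLevel_iff this, ← h, ← le_commonLevel_iff this]
  · have := commonLevel_le α β
    rw [le_commonLevel_iff this, h, ← le_commonLevel_iff this]

/-- The automorphism that permutes the children of the root by `σ` and acts by `θ i` on the
subtree at the image of the `i`-th child. -/
def consAut (σ : Equiv.Perm ℕ) (θ : ℕ → Equiv.Perm (Address k)) :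
    Equiv.Perm (Address (k + 1)) where
  toFun α := Fin.cons (σ (α 0)) (θ (α 0) (Fin.tail α))
  invFun α := Fin.cons (σ.symm (α 0)) ((θ (σ.symm (α 0))).symm (Fin.tail α))
  left_inv α := by
    simp only [Fin.cons_zero, Fin.tail_cons, Equiv.symm_apply_apply]
    exact Fin.cons_self_tail α
  right_inv α := by
    simp only [Fin.cons_zero, Fin.tail_cons, Equiv.apply_symm_apply]
    exact Fin.cons_self_tail α

lemma isTreeAut_consAut {σ : Equiv.Perm ℕ} {θ : ℕ → Equiv.Perm (Address k)}
    (h : ∀ i, IsTreeAut (θ i)) : IsTreeAut (consAut σ θ) := by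
  intro α β l
  rcases l with _ | l
  · simp
  have aux : ∀ a b : Address (k + 1), (∀ j : Fin (k + 1), (j : ℕ) < l + 1 → a j = b j) ↔
      a 0 = b 0 ∧ ∀ j : Fin k, (j : ℕ) < l → Fin.tail a j = Fin.tail b j := fun a b => by
    simp [Fin.forall_fin_succ, Fin.tail]
  rw [aux, aux]
  simp only [consAut, Equiv.coe_fn_mk, Fin.cons_zero, Fin.tail_cons, σ.injective.eq_iff]
  refine and_congr_right fun h0 => ?_
  rw [← h0]
  exact h (α 0) _ _ l

/-! ### Random trees -/

/-- The law of a family of independent variables attached to the vertices, with law `ρ l` at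
level `l`. -/
noncomputable def treeLaw {S : Type*} [MeasurableSpace S] (ρ : Fin k → Measure S)
    [∀ l, IsProbabilityMeasure (ρ l)] : Measure (Vertex k → S) :=
  Measure.infinitePi fun v : Vertex k => ρ v.1

instance {S : Type*} [MeasurableSpace S] (ρ : Fin k → Measure S)
    [∀ l, IsProbabilityMeasure (ρ l)] : IsProbabilityMeasure (treeLaw ρ) := by
  unfold treeLaw; infer_instance

lemma measurePreserving_option {ι X : Type*} [MeasurableSpace X] (μ : Option ι → Measure X)
    [∀ o, IsProbabilityMeasure (μ o)] :
    MeasurePreserving (fun f : Option ι → X => (f none, fun i => f (some i)))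
      (Measure.infinitePi μ) ((μ none).prod (Measure.infinitePi fun i => μ (some i))) := by
  have h := measurePreserving_optionElim (μ none) fun i => μ (some i)
  have hμ : (fun o : Option ι => o.elim (μ none) fun i => μ (some i)) = μ := by
    funext o; cases o <;> rfl
  have hm : Measurable (fun f : Option ι → X => (f none, fun i => f (some i))) := by fun_prop
  refine ⟨hm, ?_⟩
  have h2 := h.map_eq
  have : Measure.infinitePi μ = Measure.map (fun (z : X × (ι → X)) (o : Option ι) =>
      o.elim z.1 z.2) ((μ none).prod (Measure.infinitePi fun i => μ (some i))) := by
    rw [h2]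
    congr 1
    exact hμ.symm
  rw [this, Measure.map_map hm h.measurable]
  exact Measure.map_id

/-- The self-similarity of the tree behind every induction on the height: a root label, and
independent copies of the tree of one level less at the children of the root. -/
lemma measurePreserving_split {S : Type*} [MeasurableSpace S] (ρ : Fin (k + 1) → Measure S)
    [∀ l, IsProbabilityMeasure (ρ l)] :
    MeasurePreserving (fun e : Vertex (k + 1) → S =>
        (e rootVertex, fun (i : ℕ) (v : Vertex k) => e (consVertex i v)))
      (treeLaw ρ) ((ρ 0).prod (Measure.infinitePi fun _ : ℕ => treeLaw fun l => ρ l.succ)) := by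
  have h1 : MeasurePreserving (fun (e : Vertex (k + 1) → S) o => e (vertexEquiv k o))
      (treeLaw ρ) (Measure.infinitePi fun o => ρ (vertexEquiv k o).1) :=
    ⟨by fun_prop, Measure.map_infinitePi_infinitePi_of_inj (P := fun v : Vertex (k + 1) => ρ v.1)
      (vertexEquiv k).injective⟩
  have h2 := measurePreserving_option fun o => ρ (vertexEquiv k o).1
  have h3 : MeasurePreserving (MeasurableEquiv.curry ℕ (Vertex k) S)
      (Measure.infinitePi fun p : ℕ × Vertex k => ρ p.2.1.succ)
      (Measure.infinitePi fun _ : ℕ => treeLaw fun l => ρ l.succ) :=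
    ⟨(MeasurableEquiv.curry ℕ (Vertex k) S).measurable,
      Measure.infinitePi_map_curry fun (_ : ℕ) (v : Vertex k) => ρ v.1.succ⟩
  exact ((MeasurePreserving.id (ρ 0)).prod h3).comp (h2.comp h1)

/-! ### The total weight of the leaves. -/

section Weights

variable {x : Fin k → ℝ} {ρ : Fin k → Measure (ℕ → ℝ)} [∀ l, IsProbabilityMeasure (ρ l)]

lemma ae_tree_pos (h : ∀ l, HasPowerLaw (x l) (ρ l)) :
    ∀ᵐ e ∂treeLaw ρ, ∀ v i, 0 < e v i := by
  rw [ae_all_iff]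
  intro v
  exact (measurePreserving_eval_infinitePi (fun v : Vertex k => ρ v.1) v).quasiMeasurePreserving.ae
    (h v.1).pos

lemma leafWeight_pos {e : Vertex k → ℕ → ℝ} (h : ∀ v i, 0 < e v i) (α : Address k) :
    0 < leafWeight e α := Finset.prod_pos fun _ _ => h _ _

lemma measurable_leafWeight (α : Address k) :
    Measurable fun e : Vertex k → ℕ → ℝ => leafWeight e α := by
  unfold leafWeight; fun_prop

/-- The total weight, as an extended nonnegative real. -/
noncomputable def totalWeight (e : Vertex k → ℕ → ℝ) : ℝ≥0∞ :=
  ∑' α, ENNReal.ofReal (leafWeight e α)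

lemma measurable_totalWeight : Measurable (totalWeight (k := k)) :=
  Measurable.tsum fun α => (measurable_leafWeight α).ennreal_ofReal

lemma totalWeight_succ {e : Vertex (k + 1) → ℕ → ℝ} (h : ∀ i, 0 ≤ e rootVertex i) :
    totalWeight e = ∑' i, ENNReal.ofReal (e rootVertex i) *
      totalWeight (fun v => e (consVertex i v)) := by
  rw [totalWeight, ← (Fin.consEquiv fun _ : Fin (k + 1) => ℕ).tsum_eq, ENNReal.tsum_prod']
  refine tsum_congr fun i => ?_
  rw [totalWeight, ← ENNReal.tsum_mul_left]
  refine tsum_congr fun α => ?_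
  rw [leafWeight_succ, ← ENNReal.ofReal_mul (h i)]
  simp [Fin.consEquiv]

end Weights

/-- The total weight is the sum over the children of the root of η_i times independent copies of the
total weight of a shorter tree. If the latter is stable of index y > x_0, the sum is stable of index
x_0. At height 0 the weight is the constant 1, of index y = 1. The clause on z covers both cases: it
makes y exceed the exponent of any root added above. -/
lemma exists_laplace_totalWeight {k : ℕ} {x : Fin k → ℝ} {ρ : Fin k → Measure (ℕ → ℝ)}
    [∀ l, IsProbabilityMeasure (ρ l)] (h : ∀ l, HasPowerLaw (x l) (ρ l)) (hx : StrictMono x)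
    (hpos : ∀ l, 0 < x l) (hlt : ∀ l, x l < 1) :
    ∃ (y : ℝ) (B : ℝ≥0∞), 0 < y ∧ B ≠ ∞ ∧ (∀ z < 1, (∀ l, z < x l) → z < y) ∧
      ∀ t : ℝ, 0 < t → ∫⁻ e, expNeg (ENNReal.ofReal t * totalWeight e) ∂treeLaw ρ =
        expNeg (ENNReal.ofReal (t ^ y) * B) := by
  induction k with
  | zero =>
    refine ⟨1, 1, one_pos, ENNReal.one_ne_top, fun z hz _ => hz, fun t ht => ?_⟩
    have : ∀ e : Vertex 0 → ℕ → ℝ, totalWeight e = 1 := fun e => by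
      rw [totalWeight, tsum_fintype]
      simp [leafWeight]
    simp [this]
  | succ k ih =>
    obtain ⟨y, B, -, hB, hxy, hL⟩ := ih (x := fun l => x l.succ) (ρ := fun l => ρ l.succ)
      (fun l => h l.succ) (hx.comp (Fin.strictMono_succ)) (fun l => hpos _) (fun l => hlt _)
    obtain ⟨B', hB', hL'⟩ := (h 0).lintegral_stable (hpos 0)
      (hxy (x 0) (hlt 0) fun l => hx (Fin.succ_pos l)) measurable_totalWeight hB hL
    refine ⟨x 0, B', hpos 0, hB', fun z _ hz => hz 0, fun t ht => ?_⟩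
    rw [← hL' t ht, ← (measurePreserving_split ρ).lintegral_comp]
    · refine lintegral_congr_ae ?_
      filter_upwards [ae_tree_pos h] with e he
      rw [totalWeight_succ fun i => (he rootVertex i).le]
    · refine measurable_expNeg.comp (Measurable.const_mul (Measurable.tsum fun i => ?_) _)
      exact ((measurable_pi_apply i).comp measurable_fst).ennreal_ofReal.mul
        (measurable_totalWeight.comp ((measurable_pi_apply i).comp measurable_snd))

lemma ae_summable_leafWeight {x : Fin k → ℝ} {ρ : Fin k → Measure (ℕ → ℝ)}
    [∀ l, IsProbabilityMeasure (ρ l)] (h : ∀ l, HasPowerLaw (x l) (ρ l)) (hx : StrictMono x)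
    (hpos : ∀ l, 0 < x l) (hlt : ∀ l, x l < 1) :
    ∀ᵐ e ∂treeLaw ρ, (∀ v i, 0 < e v i) ∧ Summable (leafWeight e) := by
  obtain ⟨y, B, hy, hB, -, hL⟩ := exists_laplace_totalWeight h hx hpos hlt
  filter_upwards [ae_tree_pos h, ae_lt_top_of_laplace measurable_totalWeight hy hB hL]
    with e he hS
  refine ⟨he, ?_⟩
  have := ENNReal.summable_toReal hS.ne
  simpa only [ENNReal.toReal_ofReal (leafWeight_pos he _).le] using this

/-! ### Evolution of a marked tree -/

section Join

variable {k : ℕ} {S : Type*}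

/-- The tree with given label at the root and given subtrees at its children. -/
noncomputable def joinTree (r : S) (c : ℕ → Vertex k → S) (v : Vertex (k + 1)) : S :=
  ((vertexEquiv k).symm v).elim r fun p => c p.1 p.2

@[simp] lemma joinTree_root (r : S) (c : ℕ → Vertex k → S) : joinTree r c rootVertex = r := by
  rw [joinTree, ← vertexEquiv_none, Equiv.symm_apply_apply]; rfl

@[simp] lemma joinTree_cons (r : S) (c : ℕ → Vertex k → S) (i : ℕ) (v : Vertex k) :
    joinTree r c (consVertex i v) = c i v := by
  rw [joinTree, ← vertexEquiv_some (i, v), Equiv.symm_apply_apply]; rfl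

lemma joinTree_split (e : Vertex (k + 1) → S) :
    joinTree (e rootVertex) (fun i v => e (consVertex i v)) = e := by
  funext v
  obtain ⟨_ | p, rfl⟩ := (vertexEquiv k).surjective v
  · simp
  · simp

variable [MeasurableSpace S]

lemma measurable_joinTree :
    Measurable fun z : S × (ℕ → Vertex k → S) => joinTree z.1 z.2 := by
  refine measurable_pi_lambda _ fun v => ?_
  obtain ⟨_ | p, rfl⟩ := (vertexEquiv k).surjective v
  · simpa using measurable_fst
  · simp only [vertexEquiv_some, joinTree_cons]
    fun_prop

lemma measurePreserving_joinTree (ρ : Fin (k + 1) → Measure S) [∀ l, IsProbabilityMeasure (ρ l)] :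
    MeasurePreserving (fun z : S × (ℕ → Vertex k → S) => joinTree z.1 z.2)
      ((ρ 0).prod (Measure.infinitePi fun _ : ℕ => treeLaw fun l => ρ l.succ)) (treeLaw ρ) := by
  refine ⟨measurable_joinTree, ?_⟩
  rw [← (measurePreserving_split ρ).map_eq, Measure.map_map measurable_joinTree
    (measurePreserving_split ρ).measurable]
  convert Measure.map_id
  funext e
  exact joinTree_split e

end Join

/-- The labels of a tree whose branches carry weights and marks. -/
abbrev Marked : Type := (ℕ → ℝ) × (ℕ → ℝ)

/-- The marks on the path from the root to a leaf. -/
def pathMarks {k : ℕ} (g : Vertex k → ℕ → ℝ) (α : Address k) : Fin k → ℝ :=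
  fun l => g (truncate α l) (α l)

lemma pathMarks_succ {k : ℕ} (g : Vertex (k + 1) → ℕ → ℝ) (α : Address (k + 1)) :
    pathMarks g α = Fin.cons (g rootVertex (α 0))
      (pathMarks (fun v => g (consVertex (α 0) v)) (Fin.tail α)) := by
  funext l
  induction l using Fin.cases with
  | zero => simp [pathMarks, truncate_zero]
  | succ l => simp [pathMarks, truncate_succ, Fin.tail]

/-! ### One level of the evolution: the root process and the subtrees at its children. -/

section Step

variable {k : ℕ} {Θ : Type}

/-- The order of the weights at a vertex after multiplication with the factors `F θ`. -/
noncomputable def markOrder (F : Θ → ℝ → ℝ) (θ : Θ) (z : Marked) : Equiv.Perm ℕ :=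
  decreasingOrder fun i => z.1 i * F θ (z.2 i)

/-- The weights at a vertex, multiplied by the factors `F θ` and reordered. -/
noncomputable def markedWeights (F : Θ → ℝ → ℝ) (θ : Θ) (z : Marked) (n : ℕ) : ℝ :=
  z.1 (markOrder F θ z n) * F θ (z.2 (markOrder F θ z n))

/-- The subtrees at the children of the root, evolved and reordered. -/
noncomputable def markedSubtrees (F : Θ → ℝ → ℝ)
    (Φ : Θ × ℝ → (Vertex k → Marked) → Vertex k → ℕ → ℝ) (θ : Θ) (z : Marked)
    (c : ℕ → Vertex k → Marked) (j : ℕ) : Vertex k → ℕ → ℝ :=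
  Φ (θ, z.2 (markOrder F θ z j)) (c (markOrder F θ z j))

variable {F : Θ → ℝ → ℝ} {Φ : Θ × ℝ → (Vertex k → Marked) → Vertex k → ℕ → ℝ}

lemma measurable_apply_index {Z X : Type*} [MeasurableSpace Z] [MeasurableSpace X]
    {f : Z → ℕ → X} {n : Z → ℕ} (hf : Measurable f) (hn : Measurable n) :
    Measurable fun z => f z (n z) := by
  have : Measurable fun p : (ℕ → X) × ℕ => p.1 p.2 :=
    measurable_from_prod_countable_left fun n => measurable_pi_apply n
  exact this.comp (hf.prodMk hn)

lemma measurable_markOrder [MeasurableSpace Θ] (hF : Measurable (Function.uncurry F)) (n : ℕ) :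
    Measurable fun p : Θ × Marked => markOrder F p.1 p.2 n := by
  refine (measurable_decreasingOrder n).comp (measurable_pi_lambda _ fun i => ?_)
  have h1 : Measurable fun p : Θ × Marked => (p.1, p.2.2 i) := by fun_prop
  have h2 : Measurable fun p : Θ × Marked => p.2.1 i := by fun_prop
  exact h2.mul (hF.comp h1)

lemma measurable_markedWeights [MeasurableSpace Θ] (hF : Measurable (Function.uncurry F)) :
    Measurable fun p : Θ × Marked => markedWeights F p.1 p.2 := by
  refine measurable_pi_lambda _ fun n => ?_
  have h1 : Measurable fun p : Θ × Marked => p.2.1 (markOrder F p.1 p.2 n) :=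
    measurable_apply_index (by fun_prop) (measurable_markOrder hF n)
  have h2 : Measurable fun p : Θ × Marked => p.2.2 (markOrder F p.1 p.2 n) :=
    measurable_apply_index (by fun_prop) (measurable_markOrder hF n)
  exact h1.mul (hF.comp (measurable_fst.prodMk h2))

lemma measurable_markedSubtrees [MeasurableSpace Θ] (hF : Measurable (Function.uncurry F))
    (hΦ : Measurable (Function.uncurry Φ)) :
    Measurable fun p : Θ × Marked × (ℕ → Vertex k → Marked) =>
      markedSubtrees F Φ p.1 p.2.1 p.2.2 := by
  refine measurable_pi_lambda _ fun n => ?_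
  have h0 : Measurable fun p : Θ × Marked × (ℕ → Vertex k → Marked) => (p.1, p.2.1) := by fun_prop
  have hn := (measurable_markOrder hF n).comp h0
  have h1 : Measurable fun p : Θ × Marked × (ℕ → Vertex k → Marked) =>
      p.2.1.2 (markOrder F p.1 p.2.1 n) :=
    measurable_apply_index (by fun_prop) hn
  have h2 : Measurable fun p : Θ × Marked × (ℕ → Vertex k → Marked) =>
      p.2.2 (markOrder F p.1 p.2.1 n) :=
    measurable_apply_index (by fun_prop) hn
  exact hΦ.comp ((measurable_fst.prodMk h1).prodMk h2)

/-- For a fixed root label the permutation is fixed, so the permuted subtrees are still independent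
copies; `Φ p` sends them to the same law whatever p is. Hence the evolved subtrees do not depend on
the root label, although both the order and the parameters do. -/
lemma measurePreserving_markedSubtrees {T : Measure (Vertex k → Marked)}
    {T' : Measure (Vertex k → ℕ → ℝ)} [IsProbabilityMeasure T] [IsProbabilityMeasure T']
    (hΦ : ∀ p, MeasurePreserving (Φ p) T T') (θ : Θ) (z : Marked) :
    (Measure.infinitePi fun _ : ℕ => T).map (markedSubtrees F Φ θ z) =
      Measure.infinitePi fun _ : ℕ => T' := by
  have h1 : (Measure.infinitePi fun _ : ℕ => T).map
      (fun c j => c (markOrder F θ z j)) = Measure.infinitePi fun _ : ℕ => T :=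
    Measure.map_infinitePi_infinitePi_of_inj (P := fun _ : ℕ => T)
      (markOrder F θ z).injective
  have h2 := Measure.infinitePi_map_pi (fun _ : ℕ => T)
    (f := fun j => Φ (θ, z.2 (markOrder F θ z j))) fun j => (hΦ _).measurable
  simp_rw [(hΦ _).map_eq] at h2
  rw [← h2]
  conv_rhs => rw [← h1]
  have hm : Measurable fun (c : ℕ → Vertex k → Marked) j =>
      Φ (θ, z.2 (markOrder F θ z j)) (c j) :=
    measurable_pi_lambda _ fun j => (hΦ _).measurable.comp (measurable_pi_apply j)
  rw [Measure.map_map hm (by fun_prop)]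
  rfl

/-- The root process is preserved by the marking theorem, and conditionally on the root the evolved
subtrees have a fixed product law; so the two are independent and together form a tree with the
original law. -/
lemma measurePreserving_joinTree_marked [MeasurableSpace Θ] {x₀ : ℝ}
    {ρ : Fin (k + 1) → Measure (ℕ → ℝ)}
    [∀ l, IsProbabilityMeasure (ρ l)] (γ : Measure ℝ) [IsProbabilityMeasure γ]
    (h : HasPowerLaw x₀ (ρ 0)) (hx : 0 < x₀) (hx1 : x₀ < 1) (hF : Measurable (Function.uncurry F))
    (hFpos : ∀ θ m, 0 < F θ m) (hΦm : Measurable (Function.uncurry Φ))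
    (hΦ : ∀ p, MeasurePreserving (Φ p)
      (treeLaw fun l => (ρ (Fin.succ l)).prod (Measure.infinitePi fun _ : ℕ => γ))
      (treeLaw fun l => ρ (Fin.succ l)))
    (θ : Θ) (hint : ∫⁻ m, ENNReal.ofReal (F θ m ^ x₀) ∂γ = 1) :
    MeasurePreserving (fun d : Vertex (k + 1) → Marked =>
        joinTree (markedWeights F θ (d rootVertex))
          (markedSubtrees F Φ θ (d rootVertex) fun i v => d (consVertex i v)))
      (treeLaw fun l => (ρ l).prod (Measure.infinitePi fun _ : ℕ => γ)) (treeLaw ρ) := by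
  have h1 := measurePreserving_split
    fun l => (ρ l).prod (Measure.infinitePi fun _ : ℕ => γ)
  have h2 : MeasurePreserving (markedWeights F θ)
      ((ρ 0).prod (Measure.infinitePi fun _ : ℕ => γ)) (ρ 0) :=
    h.measurePreserving_marked hx hx1 (F := F θ) (by fun_prop) (hFpos θ) hint
  have h3 : Measurable (Function.uncurry (markedSubtrees F Φ θ)) :=
    (measurable_markedSubtrees hF hΦm).comp (measurable_const.prodMk measurable_id)
  have h4 := h2.skew_product h3
    (ae_of_all _ fun z => measurePreserving_markedSubtrees hΦ θ z)
  exact (measurePreserving_joinTree ρ).comp (h4.comp h1)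

end Step

/-- Multiplying the leaf weights of a random tree by functions `W θ` of independent identically
distributed marks along the branches amounts, up to a constant and an automorphism of the tree, to
a transformation that preserves the law of the tree. -/
theorem exists_marked_evolution {k : ℕ} {x : Fin k → ℝ} {ρ : Fin k → Measure (ℕ → ℝ)}
    [∀ l, IsProbabilityMeasure (ρ l)] (h : ∀ l, HasPowerLaw (x l) (ρ l))
    (hpos : ∀ l, 0 < x l) (hlt : ∀ l, x l < 1) (γ : Measure ℝ) [IsProbabilityMeasure γ]
    {Θ : Type} [MeasurableSpace Θ] {W : Θ → (Fin k → ℝ) → ℝ}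
    (hW : Measurable (Function.uncurry W)) (hWpos : ∀ θ t, 0 < W θ t)
    (hint : ∀ θ, ∫⁻ t, ENNReal.ofReal (W θ t) ∂(Measure.pi fun _ => γ) ≠ ∞) :
    ∃ (C : Θ → ℝ) (Φ : Θ → (Vertex k → Marked) → Vertex k → ℕ → ℝ)
      (G : Set (Θ × (Vertex k → Marked))),
      Measurable C ∧ (∀ θ, 0 < C θ) ∧
      (∀ θ, ENNReal.ofReal (C θ) ≤ ∫⁻ t, ENNReal.ofReal (W θ t) ∂(Measure.pi fun _ => γ)) ∧
      Measurable (Function.uncurry Φ) ∧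
      (∀ θ, MeasurePreserving (Φ θ)
        (treeLaw fun l => (ρ l).prod (Measure.infinitePi fun _ : ℕ => γ)) (treeLaw ρ)) ∧
      MeasurableSet G ∧
      (∀ θ, ∀ᵐ d ∂(treeLaw fun l => (ρ l).prod (Measure.infinitePi fun _ : ℕ => γ)),
        (θ, d) ∈ G) ∧
      ∀ θ d, (θ, d) ∈ G → ∃ a : Equiv.Perm (Address k), IsTreeAut a ∧ ∀ α,
        leafWeight (fun v => (d v).1) (a α) * W θ (pathMarks (fun v => (d v).2) (a α)) =
          C θ * leafWeight (Φ θ d) α := by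
  -- The mark of the first edge becomes part of the parameter of the subtree below it, so the
  -- parameter space grows to Θ × ℝ.
  induction k generalizing Θ with
  | zero =>
    refine ⟨fun θ => W θ Fin.elim0, fun _ d v => (d v).1, Set.univ, ?_, fun θ => hWpos θ _, ?_, ?_,
      ?_, MeasurableSet.univ, fun θ => by simp, ?_⟩
    · exact hW.comp (measurable_id.prodMk measurable_const)
    · intro θ
      have : ∀ t, W θ t = W θ Fin.elim0 := fun t => by congr 1; exact Subsingleton.elim _ _
      simp [this]
    · unfold Function.uncurry; fun_prop
    · intro θ
      refine ⟨by fun_prop, ?_⟩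
      have := Measure.infinitePi_map_pi
        (fun v : Vertex 0 => (ρ v.1).prod (Measure.infinitePi fun _ : ℕ => γ))
        (f := fun _ => Prod.fst) fun _ => measurable_fst
      rw [treeLaw, this]
      simp [treeLaw]
    · intro θ d _
      refine ⟨1, fun α β l => by simp, fun α => ?_⟩
      have : pathMarks (fun v => (d v).2) ((1 : Equiv.Perm (Address 0)) α) = Fin.elim0 :=
        Subsingleton.elim _ _
      rw [this]
      simp [leafWeight]
  | succ k ih =>
    -- The mean gain given the mark of the first edge. It is finite only for almost every mark.
    set J : Θ × ℝ → ℝ≥0∞ := fun p =>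
      ∫⁻ t, ENNReal.ofReal (W p.1 (Fin.cons p.2 t : Fin (k + 1) → ℝ)) ∂(Measure.pi fun _ => γ)
      with hJ
    have hcons : Measurable fun q : ℝ × (Fin k → ℝ) => (Fin.cons q.1 q.2 : Fin (k + 1) → ℝ) := by
      refine measurable_pi_lambda _ fun l => ?_
      induction l using Fin.cases with
      | zero => simpa using measurable_fst
      | succ l => simp only [Fin.cons_succ]; fun_prop
    have hWc : Measurable fun q : (Θ × ℝ) × (Fin k → ℝ) =>
        W q.1.1 (Fin.cons q.1.2 q.2 : Fin (k + 1) → ℝ) := by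
      have h1 : Measurable fun q : (Θ × ℝ) × (Fin k → ℝ) => (q.1.2, q.2) := by fun_prop
      exact hW.comp ((measurable_fst.comp measurable_fst).prodMk (hcons.comp h1))
    have hJm : Measurable J := hWc.ennreal_ofReal.lintegral_prod_right'
    have hJW : ∀ θ, ∫⁻ m, J (θ, m) ∂γ =
        ∫⁻ t, ENNReal.ofReal (W θ t) ∂(Measure.pi fun _ : Fin (k + 1) => γ) := fun θ => by
      have hmp := (measurePreserving_piFinSuccAbove (fun _ : Fin (k + 1) => γ) 0).symm
      have hWθ : Measurable fun t => ENNReal.ofReal (W θ t) :=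
        (hW.comp (measurable_const.prodMk measurable_id)).ennreal_ofReal
      rw [← hmp.lintegral_comp hWθ, lintegral_prod]
      · simp only [hJ, MeasurableEquiv.piFinSuccAbove_symm_apply, Fin.insertNthEquiv_zero]
        rfl
      · exact (hWθ.comp hmp.measurable).aemeasurable
    set Gd : Set (Θ × ℝ) := {p | J p ≠ ∞} with hGd
    have hGdm : MeasurableSet Gd := (hJm (measurableSet_singleton ∞)).compl
    classical
    -- The induction hypothesis asks for a finite mean at every parameter, so the gain is replaced
    -- by 1 at the exceptional marks.
    let W' : Θ × ℝ → (Fin k → ℝ) → ℝ := fun p t =>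
      if p ∈ Gd then W p.1 (Fin.cons p.2 t : Fin (k + 1) → ℝ) else 1
    have hW'm : Measurable (Function.uncurry W') :=
      Measurable.ite (measurable_fst hGdm) hWc measurable_const
    have hW'pos : ∀ p t, 0 < W' p t := fun p t => by
      simp only [W']
      split_ifs
      exacts [hWpos _ _, one_pos]
    have hW'int : ∀ p, ∫⁻ t, ENNReal.ofReal (W' p t) ∂(Measure.pi fun _ => γ) ≠ ∞ := fun p => by
      by_cases hp : p ∈ Gd
      · simp only [W', hp, if_true]
        exact hp
      · simp [W', hp]
    obtain ⟨C', Φ', G', hC'm, hC'pos, hC'le, hΦ'm, hΦ', hG'm, hG', hid⟩ :=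
      ih (x := fun l => x l.succ) (ρ := fun l => ρ l.succ) (fun l => h l.succ)
        (fun l => hpos _) (fun l => hlt _) hW'm hW'pos hW'int
    have hgood : ∀ θ, ∀ᵐ m ∂γ, (θ, m) ∈ Gd := fun θ => by
      have h1 : ∫⁻ m, J (θ, m) ∂γ ≠ ∞ := by rw [hJW]; exact hint θ
      filter_upwards [ae_lt_top (hJm.comp measurable_prodMk_left) h1] with m hm
      exact hm.ne
    set A : Θ → ℝ≥0∞ := fun θ => ∫⁻ m, ENNReal.ofReal (C' (θ, m) ^ x 0) ∂γ with hA
    have hpow : Measurable fun p : Θ × ℝ => ENNReal.ofReal (C' p ^ x 0) := by fun_prop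
    have hAm : Measurable A := hpow.lintegral_prod_right'
    have hC'int : ∀ θ, ∫⁻ m, ENNReal.ofReal (C' (θ, m)) ∂γ ≤
        ∫⁻ t, ENNReal.ofReal (W θ t) ∂(Measure.pi fun _ : Fin (k + 1) => γ) := fun θ => by
      rw [← hJW]
      refine lintegral_mono_ae ?_
      filter_upwards [hgood θ] with m hm
      refine (hC'le (θ, m)).trans (le_of_eq ?_)
      simp [W', hm, hJ]
    -- Since x_0 < 1, the first moment controls the moment of order x_0. This makes A finite, and it
    -- passes the bound of C by the mean gain on to the next level.
    have hJensen : ∀ θ, A θ ^ (1 / x 0) ≤ ∫⁻ m, ENNReal.ofReal (C' (θ, m)) ∂γ := fun θ => by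
      have hm : Measurable fun m => C' (θ, m) := hC'm.comp measurable_prodMk_left
      have := eLpNorm'_le_eLpNorm'_of_exponent_le (μ := γ) (hpos 0) (hlt 0).le
        (hm.aestronglyMeasurable)
      simp only [eLpNorm', ENNReal.rpow_one, div_one] at this
      have he : ∀ m, ‖C' (θ, m)‖ₑ = ENNReal.ofReal (C' (θ, m)) := fun m =>
        Real.enorm_of_nonneg (hC'pos _).le
      simp_rw [he, ENNReal.ofReal_rpow_of_pos (hC'pos _)] at this
      exact this
    have hAtop : ∀ θ, A θ ≠ ∞ := fun θ hA' => by
      have h1 := (hJensen θ).trans (hC'int θ)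
      rw [hA', ENNReal.top_rpow_of_pos (one_div_pos.2 (hpos 0))] at h1
      exact hint θ (top_le_iff.1 h1)
    have hA0 : ∀ θ, A θ ≠ 0 := fun θ hA' => by
      have hm : Measurable fun m => ENNReal.ofReal (C' (θ, m) ^ x 0) :=
        hpow.comp measurable_prodMk_left
      have h1 := (lintegral_eq_zero_iff hm).1 hA'
      have h2 : ∀ᵐ _ ∂γ, False := by
        filter_upwards [h1] with m hm
        have := Real.rpow_pos_of_pos (hC'pos (θ, m)) (x 0)
        simp only [Pi.zero_apply, ENNReal.ofReal_eq_zero] at hm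
        linarith
      simp [ae_iff] at h2
    -- The normalisation for which C'/C has x_0-th moment 1, so that the root process absorbs it.
    set C : Θ → ℝ := fun θ => (A θ).toReal ^ (1 / x 0) with hC
    have hApos : ∀ θ, 0 < (A θ).toReal := fun θ => ENNReal.toReal_pos (hA0 θ) (hAtop θ)
    have hCpos : ∀ θ, 0 < C θ := fun θ => Real.rpow_pos_of_pos (hApos θ) _
    have hCm : Measurable C := hAm.ennreal_toReal.pow_const _
    set F : Θ → ℝ → ℝ := fun θ m => C' (θ, m) / C θ with hF
    have hFm : Measurable (Function.uncurry F) := by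
      have : Measurable fun p : Θ × ℝ => C' p / C p.1 := by fun_prop
      exact this
    have hFpos : ∀ θ m, 0 < F θ m := fun θ m => div_pos (hC'pos _) (hCpos _)
    have hFint : ∀ θ, ∫⁻ m, ENNReal.ofReal (F θ m ^ x 0) ∂γ = 1 := fun θ => by
      have h1 : ∀ m, ENNReal.ofReal (F θ m ^ x 0) =
          (A θ)⁻¹ * ENNReal.ofReal (C' (θ, m) ^ x 0) := fun m => by
        rw [hF, Real.div_rpow (hC'pos _).le (hCpos _).le, hC, ← Real.rpow_mul (hApos θ).le,
          one_div_mul_cancel (hpos 0).ne', Real.rpow_one, div_eq_inv_mul,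
          ENNReal.ofReal_mul (inv_nonneg.2 (hApos θ).le), ENNReal.ofReal_inv_of_pos (hApos θ),
          ENNReal.ofReal_toReal (hAtop θ)]
      simp_rw [h1]
      rw [lintegral_const_mul' _ _ (ENNReal.inv_ne_top.2 (hA0 θ))]
      exact ENNReal.inv_mul_cancel (hA0 θ) (hAtop θ)
    -- The exceptional set is kept jointly measurable in the parameter and the tree because one
    -- level higher the parameter is random and Fubini is needed.
    let G : Set (Θ × (Vertex (k + 1) → Marked)) :=
      {p | ∀ i, (p.1, (p.2 rootVertex).2 i) ∈ Gd ∧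
        ((p.1, (p.2 rootVertex).2 i), fun v => p.2 (consVertex i v)) ∈ G'}
    refine ⟨C, fun θ d => joinTree (markedWeights F θ (d rootVertex))
      (markedSubtrees F Φ' θ (d rootVertex) fun i v => d (consVertex i v)), G, hCm, hCpos, ?_, ?_,
      fun θ => measurePreserving_joinTree_marked γ (h 0) (hpos 0) (hlt 0) hFm hFpos hΦ'm hΦ' θ
        (hFint θ), ?_, ?_, ?_⟩
    · intro θ
      change ENNReal.ofReal ((A θ).toReal ^ (1 / x 0)) ≤ _
      rw [ENNReal.toReal_rpow, ENNReal.ofReal_toReal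
        (ENNReal.rpow_ne_top_of_nonneg (one_div_pos.2 (hpos 0)).le (hAtop θ))]
      exact (hJensen θ).trans (hC'int θ)
    · have h1 : Measurable fun p : Θ × (Vertex (k + 1) → Marked) => (p.1, p.2 rootVertex) := by
        fun_prop
      have h2 : Measurable fun p : Θ × (Vertex (k + 1) → Marked) =>
          (p.1, p.2 rootVertex, fun (i : ℕ) (v : Vertex k) => p.2 (consVertex i v)) := by
        fun_prop
      exact measurable_joinTree.comp (((measurable_markedWeights hFm).comp h1).prodMk
        ((measurable_markedSubtrees hFm hΦ'm).comp h2))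
    · simp only [G, Set.ofPred_forall]
      refine MeasurableSet.iInter fun i => MeasurableSet.inter ?_ ?_
      · have : Measurable fun p : Θ × (Vertex (k + 1) → Marked) =>
            (p.1, (p.2 rootVertex).2 i) := by fun_prop
        exact this hGdm
      · have : Measurable fun p : Θ × (Vertex (k + 1) → Marked) =>
            ((p.1, (p.2 rootVertex).2 i), fun v => p.2 (consVertex i v)) := by fun_prop
        exact this hG'm
    · intro θ
      have hs := measurePreserving_split
        fun l => (ρ l).prod (Measure.infinitePi fun _ : ℕ => γ)
      simp only [G, Set.mem_ofPred_eq, ae_all_iff]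
      intro i
      refine hs.quasiMeasurePreserving.ae
        (p := fun z : Marked × (ℕ → Vertex k → Marked) => (θ, z.1.2 i) ∈ Gd ∧
          ((θ, z.1.2 i), z.2 i) ∈ G') ?_
      have h1 : ∀ᵐ z : Marked ∂(ρ 0).prod (Measure.infinitePi fun _ : ℕ => γ), (θ, z.2 i) ∈ Gd := by
        have hq := (measurePreserving_eval_infinitePi (fun _ : ℕ => γ) i).comp
          (measurePreserving_snd (μ := ρ 0) (ν := Measure.infinitePi fun _ : ℕ => γ))
        exact hq.quasiMeasurePreserving.ae (hgood θ)
      have h2 : ∀ᵐ z ∂((ρ 0).prod (Measure.infinitePi fun _ : ℕ => γ)).prod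
          (Measure.infinitePi fun _ : ℕ => treeLaw fun l =>
            (ρ (Fin.succ l)).prod (Measure.infinitePi fun _ : ℕ => γ)),
          ((θ, z.1.2 i), z.2 i) ∈ G' := by
        have hm : Measurable fun z : Marked × (ℕ → Vertex k → Marked) =>
          ((θ, z.1.2 i), z.2 i) := by fun_prop
        rw [Measure.ae_prod_iff_ae_ae (hm hG'm)]
        refine ae_of_all _ fun z => ?_
        exact (measurePreserving_eval_infinitePi (fun _ : ℕ => treeLaw fun l =>
            (ρ (Fin.succ l)).prod (Measure.infinitePi fun _ : ℕ => γ)) i).quasiMeasurePreserving.ae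
          (hG' (θ, z.2 i))
      exact (Measure.quasiMeasurePreserving_fst.ae h1).and h2
    · intro θ d hd
      choose a ha hida using fun i => hid (θ, (d rootVertex).2 i)
        (fun v => d (consVertex i v)) (hd i).2
      set σ := markOrder F θ (d rootVertex) with hσ
      -- The j-th child of the new root is the child σ j of the old one, whose subtree carries its
      -- own automorphism.
      refine ⟨consAut σ fun j => a (σ j), isTreeAut_consAut fun j => ha _, fun α => ?_⟩
      have h0 : (consAut σ fun j => a (σ j)) α =
          (Fin.cons (σ (α 0)) (a (σ (α 0)) (Fin.tail α)) : Fin (k + 1) → ℕ) := rfl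
      rw [h0, leafWeight_succ, pathMarks_succ, leafWeight_succ]
      simp only [Fin.cons_zero, Fin.tail_cons, joinTree_root, joinTree_cons, markedWeights,
        markedSubtrees, ← hσ]
      have h1 := hida (σ (α 0)) (Fin.tail α)
      simp only [W', (hd (σ (α 0))).1, if_true] at h1
      rw [mul_assoc, h1, hF]
      have := (hCpos θ).ne'
      field_simp

/-! ### The weights of the leaves are distinct -/

lemma map_treeLaw_eval_prod {k : ℕ} (γ : Measure ℝ) [IsProbabilityMeasure γ]
    {a b : Vertex k × ℕ} (hab : a ≠ b) :
    (treeLaw fun _ : Fin k => Measure.infinitePi fun _ : ℕ => γ).map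
      (fun g => (g a.1 a.2, g b.1 b.2)) = γ.prod γ := by
  have h1 := Measure.infinitePi_map_curry (ι := Vertex k) (κ := ℕ) (X := ℝ) fun _ _ => γ
  rw [treeLaw, ← h1, Measure.map_map (by fun_prop) (by fun_prop)]
  exact Measure.infinitePi_map_eval_prod (P := fun _ : Vertex k × ℕ => γ) hab

/-- Distinct leaves have distinct last edges, hence independent marks there. -/
lemma truncate_last_injective {n : ℕ} : Function.Injective fun α : Address (n + 1) =>
    ((truncate α (Fin.last n), α (Fin.last n)) : Vertex (n + 1) × ℕ) := by
  intro α β h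
  obtain ⟨h1, h2⟩ := Prod.ext_iff.1 h
  have h3 := eq_of_heq (Sigma.mk.inj_iff.1 h1).2
  funext j
  induction j using Fin.lastCases with
  | last => exact h2
  | cast j => exact congrFun h3 j

lemma prod_mul_exp_ne (γ : Measure ℝ) [IsProbabilityMeasure γ] [NullSingletonClass γ]
    {u w : ℝ} (hw : w ≠ 0) :
    ∀ᵐ p ∂γ.prod γ, u * Real.exp p.1 ≠ w * Real.exp p.2 := by
  have hm : MeasurableSet {p : ℝ × ℝ | u * Real.exp p.1 = w * Real.exp p.2} :=
    measurableSet_eq_fun (by fun_prop) (by fun_prop)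
  refine (Measure.ae_prod_iff_ae_ae hm.compl).2 (ae_of_all _ fun a => ?_)
  change ∀ᵐ b ∂γ, u * Real.exp a ≠ w * Real.exp b
  rw [ae_iff]
  refine Set.Subsingleton.measure_zero (fun b hb c hc => ?_) γ
  simp only [ne_eq, not_not, Set.mem_ofPred_eq] at hb hc
  exact Real.exp_injective (mul_left_cancel₀ hw (hb.symm.trans hc))

/-- Invariance replaces a density computation. Evolve the tree with gain exp(g), where g is the
Gaussian mark of the last edge. Given the tree, two evolved weights coincide with probability 0,
since the marks of their last edges are independent and have no atoms. Up to a constant and a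
permutation the evolved weights are those of a tree with the original law, so the latter are
distinct as well. -/
lemma ae_injective_leafWeight {k : ℕ} {x : Fin k → ℝ} {ρ : Fin k → Measure (ℕ → ℝ)}
    [∀ l, IsProbabilityMeasure (ρ l)] (h : ∀ l, HasPowerLaw (x l) (ρ l))
    (hpos : ∀ l, 0 < x l) (hlt : ∀ l, x l < 1) :
    ∀ᵐ e ∂treeLaw ρ, Function.Injective (leafWeight e) := by
  rcases k with _ | n
  · exact ae_of_all _ fun e => Function.injective_of_subsingleton _
  set γ := gaussianReal 0 1 with hγ
  have : NullSingletonClass γ := nullSingletonClass_gaussianReal one_ne_zero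
  have hWint : ∫⁻ t : Fin (n + 1) → ℝ, ENNReal.ofReal (Real.exp (t (Fin.last n)))
      ∂(Measure.pi fun _ => γ) ≠ ∞ := by
    have h1 := measurePreserving_eval (fun _ : Fin (n + 1) => γ) (Fin.last n)
    have h2 := integrable_exp_mul_gaussianReal (μ := 0) (v := 1) 1
    simp only [one_mul] at h2
    have h3 : Measurable fun z : ℝ => ENNReal.ofReal (Real.exp z) := by fun_prop
    have h4 := h1.lintegral_comp h3
    rw [show (∫⁻ t : Fin (n + 1) → ℝ, ENNReal.ofReal (Real.exp (t (Fin.last n)))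
      ∂(Measure.pi fun _ => γ)) = _ from h4]
    exact h2.lintegral_lt_top.ne
  obtain ⟨C, Φ, G, -, hCpos, -, -, hΦ, -, hG, hid⟩ := exists_marked_evolution h hpos hlt γ
    (Θ := Unit) (W := fun _ t => Real.exp (t (Fin.last n))) (by unfold Function.uncurry; fun_prop)
    (fun _ _ => Real.exp_pos _) (fun _ => hWint)
  have hms : MeasurableSet {e : Vertex (n + 1) → ℕ → ℝ | Function.Injective (leafWeight e)} := by
    simp only [Function.Injective, Set.ofPred_forall]
    refine MeasurableSet.iInter fun α => MeasurableSet.iInter fun β => ?_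
    by_cases hab : α = β
    · simp [hab]
    · simp only [hab, imp_false]
      exact (measurableSet_eq_fun (measurable_leafWeight α) (measurable_leafWeight β)).compl
  rw [← (hΦ ()).map_eq, ae_map_iff (hΦ ()).measurable.aemeasurable hms]
  have hne : ∀ᵐ d ∂(treeLaw fun l => (ρ l).prod (Measure.infinitePi fun _ : ℕ => γ)),
      ∀ α β : Address (n + 1), α ≠ β →
        leafWeight (fun v => (d v).1) α * Real.exp (pathMarks (fun v => (d v).2) α (Fin.last n)) ≠
        leafWeight (fun v => (d v).1) β *
          Real.exp (pathMarks (fun v => (d v).2) β (Fin.last n)) := by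
    simp only [ae_all_iff]
    intro α β hab
    have hz := measurePreserving_zip (fun v : Vertex (n + 1) => ρ v.1)
      (fun _ : Vertex (n + 1) => Measure.infinitePi fun _ : ℕ => γ)
    have hmeq : ∀ α : Address (n + 1), Measurable fun d : Vertex (n + 1) → Marked =>
        leafWeight (fun v => (d v).1) α *
          Real.exp (pathMarks (fun v => (d v).2) α (Fin.last n)) := fun α => by
      have h1 : Measurable fun (d : Vertex (n + 1) → Marked) v => (d v).1 := by fun_prop
      exact ((measurable_leafWeight α).comp h1).mul (by unfold pathMarks; fun_prop)
    have hset := (measurableSet_eq_fun (hmeq α) (hmeq β)).compl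
    rw [treeLaw, ← hz.map_eq]
    refine (ae_map_iff hz.measurable.aemeasurable hset).2 ?_
    refine (Measure.ae_prod_iff_ae_ae (hz.measurable hset)).2 ?_
    filter_upwards [ae_tree_pos h] with e he
    have hab' := (truncate_last_injective (n := n)).ne hab
    have h1 := map_treeLaw_eval_prod γ hab'
    have h2 := prod_mul_exp_ne γ (u := leafWeight e α) (leafWeight_pos he β).ne'
    have h3 : Measurable fun g : Vertex (n + 1) → ℕ → ℝ =>
        (pathMarks g α (Fin.last n), pathMarks g β (Fin.last n)) := by
      unfold pathMarks; fun_prop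
    rw [← h1] at h2
    have h4 := ae_of_ae_map h3.aemeasurable h2
    exact h4
  filter_upwards [hne, hG ()] with d hd hdG
  obtain ⟨a, -, ha⟩ := hid () d hdG
  intro α β hαβ
  by_contra hab
  refine hd (a α) (a β) (a.injective.ne hab) ?_
  rw [ha α, ha β, hαβ]

/-! ### The canonical cascade -/

section Canonical

variable {k : ℕ}

/-- The leaves in decreasing order of their weights; `enc` enumerates the leaves. -/
noncomputable def sortedAddress (enc : ℕ ≃ Address k) (e : Vertex k → ℕ → ℝ) : ℕ ≃ Address k :=
  (decreasingOrder fun n => leafWeight e (enc n)).trans enc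

/-- The cascade with the leaves listed by `sortedAddress`. -/
noncomputable def sortedCascade (enc : ℕ ≃ Address k) (q : Fin k → ℝ) (e : Vertex k → ℕ → ℝ) :
    OverlapStructure :=
  cascade q e (sortedAddress enc e)

/-- Without ties the decreasing list is unique, so neither the auxiliary enumeration nor the choice
of the list matters. -/
lemma sortedAddress_eq (enc : ℕ ≃ Address k) {e : Vertex k → ℕ → ℝ}
    (he : Function.Injective (leafWeight e)) {addr : ℕ ≃ Address k}
    (h : Antitone fun i => leafWeight e (addr i)) : sortedAddress enc e = addr := by
  have h1 : StrictAnti fun i => leafWeight e (addr i) :=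
    h.strictAnti_of_injective (he.comp addr.injective)
  have h2 : IsDecreasingOrder (fun n => leafWeight e (enc n)) (addr.trans enc.symm) :=
    isDecreasingOrder_of_strictAnti (by simpa using h1)
  rw [sortedAddress, decreasingOrder_eq h2]
  ext i : 1
  simp

lemma antitone_leafWeight_sortedAddress (enc : ℕ ≃ Address k) {e : Vertex k → ℕ → ℝ}
    (hpos : ∀ v i, 0 < e v i) (hs : Summable (leafWeight e)) :
    Antitone fun i => leafWeight e (sortedAddress enc e i) :=
  (isDecreasingOrder_decreasingOrder (exists_isDecreasingOrder
    ((enc.summable_iff (f := leafWeight e)).2 hs) fun _ => leafWeight_pos hpos _)).antitone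

lemma measurable_sortedAddress (enc : ℕ ≃ Address k) (n : ℕ) :
    Measurable fun e => sortedAddress enc e n :=
  (measurable_from_nat (f := enc)).comp ((measurable_decreasingOrder n).comp
    (measurable_pi_lambda _ fun i => measurable_leafWeight (enc i)))

lemma measurable_sortedCascade (enc : ℕ ≃ Address k) (q : Fin k → ℝ) :
    Measurable (sortedCascade enc q) := by
  refine Measurable.prodMk (measurable_pi_lambda _ fun n => ?_)
    (measurable_pi_lambda _ fun m => measurable_pi_lambda _ fun n => ?_)
  · refine Measurable.div ?_ (Measurable.tsum measurable_leafWeight)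
    exact (measurable_apply_decreasingOrder n).comp
      (measurable_pi_lambda _ fun i => measurable_leafWeight (enc i))
  · have h : Measurable fun p : Address k × Address k => leafOverlap q p.1 p.2 := .of_discrete
    exact h.comp ((measurable_sortedAddress enc m).prodMk (measurable_sortedAddress enc n))

/-- A cascade law is the law of the canonical cascade over a random tree. -/
lemma IsCascadeLaw.exists_hasLaw {x q : Fin k → ℝ} {P : Measure OverlapStructure}
    (hxq : IsCascadeParameter x q) (hP : IsCascadeLaw.{u} x q P) :
    ∃ (ρ : Fin k → Measure (ℕ → ℝ)) (_ : ∀ l, IsProbabilityMeasure (ρ l)),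
      (∀ l, HasPowerLaw (x l) (ρ l)) ∧
      ∀ enc : ℕ ≃ Address k, HasLaw (sortedCascade enc q) P (treeLaw ρ) := by
  obtain ⟨Ω, mΩ, μ, η, addr, hμ, hη, hind, hanti, hlaw⟩ := hP
  have hpl : ∀ v, HasPowerLaw (x v.1) (μ.map fun ω i => η v i ω) := fun v =>
    (hη v).hasPowerLaw (hxq.x_pos v.1)
  -- All vertices of a level have the same law, by uniqueness of the power law; the vertex with
  -- address 0…0 represents it.
  let ρ : Fin k → Measure (ℕ → ℝ) := fun l => μ.map fun ω i => η ⟨l, fun _ => 0⟩ i ω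
  have hρ : ∀ l, HasPowerLaw (x l) (ρ l) := fun l => hpl ⟨l, fun _ => 0⟩
  have hprob : ∀ l, IsProbabilityMeasure (ρ l) := fun l => (hρ l).isProbabilityMeasure
  refine ⟨ρ, hprob, hρ, fun enc => ?_⟩
  have hm : Measurable fun ω v i => η v i ω :=
    measurable_pi_lambda _ fun v => measurable_pi_lambda _ fun i => (hη v).measurable i
  have hT : μ.map (fun ω v i => η v i ω) = treeLaw ρ := by
    have h1 := (iIndepFun_iff_map_fun_eq_infinitePi_map
      fun v => measurable_pi_lambda _ (hη v).measurable).1 hind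
    have h2 : (fun v : Vertex k => μ.map fun ω i => η v i ω) = fun v => ρ v.1 :=
      funext fun v => (hpl v).unique (hρ v.1)
    rw [h1]
    simp only [treeLaw]
    congr 1
  refine ⟨(measurable_sortedCascade enc q).aemeasurable, ?_⟩
  rw [← hT, Measure.map_map (measurable_sortedCascade enc q) hm, ← hlaw.map_eq]
  refine Measure.map_congr ?_
  have hinj : ∀ᵐ ω ∂μ, Function.Injective (leafWeight fun v i => η v i ω) := by
    have := ae_injective_leafWeight hρ hxq.x_pos hxq.x_lt_one
    rw [← hT] at this
    exact ae_of_ae_map hm.aemeasurable this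
  filter_upwards [hinj, hanti] with ω h1 h2
  simp only [Function.comp, sortedCascade, sortedAddress_eq enc h1 h2]

end Canonical

/-! ### Overlap levels -/

section Levels

variable {k : ℕ}

/-- The overlap `q_{l+1}` of two leaves with common level `l`. -/
noncomputable def level (q : Fin k → ℝ) (l : ℕ) : ℝ := if h : l < k then q ⟨l, h⟩ else 1

@[simp] lemma level_top (q : Fin k → ℝ) : level q k = 1 := by simp [level]

variable {x q : Fin k → ℝ}

lemma IsCascadeParameter.level_nonneg (h : IsCascadeParameter x q) (l : ℕ) : 0 ≤ level q l := by
  unfold level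
  split_ifs
  exacts [h.q_nonneg _, zero_le_one]

lemma IsCascadeParameter.level_lt (h : IsCascadeParameter x q) {l m : ℕ} (hlm : l < m)
    (hm : m ≤ k) : level q l < level q m := by
  have hl : l < k := hlm.trans_le hm
  rcases hm.lt_or_eq with hm | rfl
  · simp only [level, hl, hm, dif_pos]
    exact h.q_strictMono hlm
  · simp only [level, hl, dif_pos, lt_irrefl, not_false_eq_true, dif_neg]
    exact h.q_lt_one _

lemma IsCascadeParameter.level_le_iff (h : IsCascadeParameter x q) {l m : ℕ} (hl : l ≤ k)
    (hm : m ≤ k) : level q l ≤ level q m ↔ l ≤ m := by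
  constructor
  · intro hle
    by_contra hlt
    exact absurd (h.level_lt (not_le.1 hlt) hl) (not_lt.2 hle)
  · intro hle
    rcases hle.eq_or_lt with rfl | hlt
    exacts [le_rfl, (h.level_lt hlt hm).le]

/-- The increments of the `r`-th powers of the overlap levels. -/
noncomputable def levelStep (q : Fin k → ℝ) (r l : ℕ) : ℝ :=
  level q l ^ r - if l = 0 then 0 else level q (l - 1) ^ r

lemma sum_levelStep (q : Fin k → ℝ) (r L : ℕ) :
    ∑ l ∈ Finset.range (L + 1), levelStep q r l = level q L ^ r := by
  induction L with
  | zero => simp [levelStep]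
  | succ L ih => rw [Finset.sum_range_succ, ih]; simp [levelStep]

lemma IsCascadeParameter.levelStep_nonneg (h : IsCascadeParameter x q) (r : ℕ) {l : ℕ}
    (hl : l ≤ k) : 0 ≤ levelStep q r l := by
  unfold levelStep
  split_ifs with h0
  · simpa using pow_nonneg (h.level_nonneg l) r
  · exact sub_nonneg.2 (pow_le_pow_left₀ (h.level_nonneg _)
      (h.level_lt (Nat.sub_lt (Nat.pos_of_ne_zero h0) one_pos) hl).le r)

lemma IsCascadeParameter.levelStep_top_pos (h : IsCascadeParameter x q) {r : ℕ} (hr : r ≠ 0) :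
    0 < levelStep q r k := by
  unfold levelStep
  split_ifs with h0
  · simp
  · exact sub_pos.2 (pow_lt_pow_left₀ (h.level_lt (Nat.sub_lt (Nat.pos_of_ne_zero h0) one_pos)
      le_rfl) (h.level_nonneg _) hr)

open Classical in
/-- The first index whose overlap with `i` is at least the level `l`. -/
noncomputable def levelRep (q : Fin k → ℝ) (Q : ℕ → ℕ → ℝ) (l i : ℕ) : ℕ :=
  Nat.find (⟨i, Or.inr rfl⟩ : ∃ j, level q l ≤ Q i j ∨ j = i)

lemma measurable_levelRep (q : Fin k → ℝ) (l i : ℕ) :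
    Measurable fun Q : ℕ → ℕ → ℝ => levelRep q Q l i := by
  classical
  refine measurable_find (p := fun (Q : ℕ → ℕ → ℝ) j => level q l ≤ Q i j ∨ j = i) _ fun j => ?_
  have h : Measurable fun Q : ℕ → ℕ → ℝ => Q i j := by fun_prop
  exact (measurableSet_le measurable_const h).union (MeasurableSet.const _)

/-! ### Overlap arrays as nested partitions of the indices. -/

/-- The overlap arrays of the cascades with levels `q`. -/
structure IsHierarchical (q : Fin k → ℝ) (Q : ℕ → ℕ → ℝ) : Prop where
  eq_level : ∀ i j, ∃ L ≤ k, Q i j = level q L ∧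
    (∀ l ≤ k, levelRep q Q l i = levelRep q Q l j ↔ l ≤ L) ∧ (L = k ↔ i = j)
  exists_eq : ∀ i, ∀ L < k, ∃ j, Q i j = level q L

lemma measurableSet_isHierarchical (q : Fin k → ℝ) : MeasurableSet {Q | IsHierarchical q Q} := by
  have h1 : ∀ i j L, MeasurableSet {Q : ℕ → ℕ → ℝ | Q i j = level q L} := fun i j L =>
    measurableSet_eq_fun (by fun_prop) measurable_const
  have h2 : ∀ i j L, MeasurableSet {Q : ℕ → ℕ → ℝ | ∀ l ≤ k,
      levelRep q Q l i = levelRep q Q l j ↔ l ≤ L} := fun i j L => by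
    simp only [Set.ofPred_forall]
    refine MeasurableSet.iInter fun l => MeasurableSet.iInter fun _ => ?_
    have h3 := measurableSet_eq_fun (measurable_levelRep q l i) (measurable_levelRep q l j)
    by_cases hl : l ≤ L
    · simpa only [hl, iff_true] using h3
    · simp only [hl, iff_false]
      exact h3.compl
  have : {Q | IsHierarchical q Q} =
      (⋂ i, ⋂ j, ⋃ L ∈ {L | L ≤ k}, {Q | Q i j = level q L} ∩ ({Q | ∀ l ≤ k,
        levelRep q Q l i = levelRep q Q l j ↔ l ≤ L} ∩ {_Q | L = k ↔ i = j})) ∩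
      ⋂ i, ⋂ L ∈ {L | L < k}, ⋃ j, {Q | Q i j = level q L} := by
    ext Q
    simp only [Set.mem_ofPred_eq, Set.mem_inter_iff, Set.mem_iInter, Set.mem_iUnion, exists_prop]
    exact ⟨fun h => ⟨h.1, h.2⟩, fun h => ⟨h.1, h.2⟩⟩
  rw [this]
  refine MeasurableSet.inter ?_ ?_
  · exact MeasurableSet.iInter fun i => MeasurableSet.iInter fun j =>
      MeasurableSet.biUnion (Set.to_countable _) fun L _ =>
        (h1 i j L).inter ((h2 i j L).inter (MeasurableSet.const _))
  · exact MeasurableSet.iInter fun i => MeasurableSet.biInter (Set.to_countable _) fun L _ =>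
      MeasurableSet.iUnion fun j => h1 i j L

/-- The increments telescope: i and j share their class exactly at the levels l ≤ L, where Q i j is
the overlap of level L. This decomposition yields both positive definiteness and the Gaussian field.
-/
lemma IsHierarchical.pow_eq {Q : ℕ → ℕ → ℝ} (h : IsHierarchical q Q) (r i j : ℕ) :
    Q i j ^ r = ∑ l ∈ Finset.range (k + 1), levelStep q r l *
      if levelRep q Q l i = levelRep q Q l j then 1 else 0 := by
  obtain ⟨L, hL, hQ, hrep, -⟩ := h.eq_level i j
  rw [hQ, ← sum_levelStep, ← Finset.sum_subset (Finset.range_mono (Nat.succ_le_succ hL))]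
  · refine Finset.sum_congr rfl fun l hl => ?_
    have hl : l ≤ L := Nat.lt_succ_iff.1 (Finset.mem_range.1 hl)
    rw [if_pos ((hrep l (hl.trans hL)).2 hl), mul_one]
  · intro l hl hl'
    have h1 : l ≤ k := Nat.lt_succ_iff.1 (Finset.mem_range.1 hl)
    have h2 : ¬ l ≤ L := fun h => hl' (Finset.mem_range.2 (Nat.lt_succ_iff.2 h))
    rw [if_neg (fun h => h2 ((hrep l h1).1 h)), mul_zero]

lemma IsHierarchical.diag {Q : ℕ → ℕ → ℝ} (h : IsHierarchical q Q) (i : ℕ) : Q i i = 1 := by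
  obtain ⟨L, -, hQ, -, hLk⟩ := h.eq_level i i
  rw [hQ, hLk.2 rfl, level_top]

/-- Off the diagonal only the levels L < k occur, and each of them occurs in every row. -/
lemma IsHierarchical.overlapSet_eq {Q : ℕ → ℕ → ℝ} (h : IsHierarchical q Q)
    (hq : IsCascadeParameter x q) (i : ℕ) : overlapSetAt Q i = overlapSet Q := by
  have hne : ∀ i j L, L < k → Q i j = level q L → i ≠ j := fun i j L hL hQ hij => by
    rw [hij, h.diag, ← level_top q] at hQ
    exact absurd hQ (hq.level_lt hL le_rfl).ne'
  have hlt : ∀ i j, i ≠ j → ∃ L < k, Q i j = level q L := fun i j hij => by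
    obtain ⟨L, hL, hQ, -, hLk⟩ := h.eq_level i j
    exact ⟨L, lt_of_le_of_ne hL fun h => hij (hLk.1 h), hQ⟩
  have hsymm : ∀ i j, Q i j = Q j i := fun i j => by
    have h1 := h.pow_eq 1 i j
    have h2 := h.pow_eq 1 j i
    rw [pow_one] at h1 h2
    rw [h1, h2]
    simp only [eq_comm]
  ext a
  constructor
  · rintro ⟨j, hj, rfl⟩
    rcases lt_or_gt_of_ne hj with hlt | hlt
    · exact ⟨j, i, hlt, hsymm i j⟩
    · exact ⟨i, j, hlt, rfl⟩
  · rintro ⟨m, n, hmn, rfl⟩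
    obtain ⟨L, hL, hQ⟩ := hlt m n hmn.ne
    obtain ⟨j, hj⟩ := h.exists_eq i L hL
    exact ⟨j, (hne i j L hL hj).symm, by rw [hQ, hj]⟩

/-- The quadratic form is a nonnegative combination of sums of squares of class sums. At level k the
classes are singletons and the coefficient is positive, because the overlaps off the diagonal are
smaller than 1. -/
lemma IsHierarchical.posDef {Q : ℕ → ℕ → ℝ} (h : IsHierarchical q Q)
    (hq : IsCascadeParameter x q) : (Matrix.of Q).PosDef := by
  have hQ : ∀ i j, Q i j = ∑ l ∈ Finset.range (k + 1), levelStep q 1 l *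
      if levelRep q Q l i = levelRep q Q l j then 1 else 0 := fun i j => by
    rw [← h.pow_eq, pow_one]
  refine ⟨?_, fun v hv => ?_⟩
  · ext i j
    simp only [Matrix.conjTranspose_apply, Matrix.of_apply, star_trivial]
    rw [hQ, hQ]
    simp only [eq_comm]
  · have hsq : ∀ f : ℕ → ℕ, (v.sum fun i a => v.sum fun j b =>
        a * b * if f i = f j then 1 else 0) =
        ∑ n ∈ v.support.image f, (∑ i ∈ v.support with f i = n, v i) ^ 2 := fun f => by
      simp only [Finsupp.sum]
      rw [← Finset.sum_fiberwise_of_maps_to (t := v.support.image f) (g := f)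
        fun i hi => Finset.mem_image_of_mem f hi]
      refine Finset.sum_congr rfl fun n _ => ?_
      rw [sq, Finset.sum_mul_sum]
      refine Finset.sum_congr rfl fun i hi => ?_
      rw [Finset.sum_filter]
      refine Finset.sum_congr rfl fun j _ => ?_
      rw [(Finset.mem_filter.1 hi).2]
      by_cases hj : f j = n
      · simp [hj]
      · simp [hj, Ne.symm hj]
    have hform : (v.sum fun i a => v.sum fun j b => star a * Matrix.of Q i j * b) =
        ∑ l ∈ Finset.range (k + 1), levelStep q 1 l *
          ∑ n ∈ v.support.image (levelRep q Q l),
            (∑ i ∈ v.support with levelRep q Q l i = n, v i) ^ 2 := by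
      simp_rw [← hsq]
      simp only [Finsupp.sum, Matrix.of_apply, star_trivial, Finset.mul_sum]
      conv_rhs => rw [Finset.sum_comm]
      refine Finset.sum_congr rfl fun i _ => ?_
      conv_rhs => rw [Finset.sum_comm]
      refine Finset.sum_congr rfl fun j _ => ?_
      rw [hQ, Finset.mul_sum, Finset.sum_mul]
      exact Finset.sum_congr rfl fun l _ => by ring
    rw [hform]
    refine Finset.sum_pos' (fun l hl => mul_nonneg
      (hq.levelStep_nonneg 1 (Nat.lt_succ_iff.1 (Finset.mem_range.1 hl)))
      (Finset.sum_nonneg fun _ _ => sq_nonneg _)) ⟨k, Finset.self_mem_range_succ k, ?_⟩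
    refine mul_pos (hq.levelStep_top_pos one_ne_zero) ?_
    have hinj : ∀ i j, levelRep q Q k i = levelRep q Q k j ↔ i = j := fun i j => by
      obtain ⟨L, hL, -, hrep, hLk⟩ := h.eq_level i j
      rw [hrep k le_rfl, ← hLk]
      exact ⟨fun h => le_antisymm hL h, fun h => h.ge⟩
    obtain ⟨i, hi⟩ := Finsupp.support_nonempty_iff.2 hv
    refine Finset.sum_pos' (fun _ _ => sq_nonneg _) ⟨levelRep q Q k i,
      Finset.mem_image_of_mem _ hi, ?_⟩
    have : {j ∈ v.support | levelRep q Q k j = levelRep q Q k i} = {i} := by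
      ext j
      simp only [Finset.mem_filter, Finset.mem_singleton, hinj]
      exact ⟨fun h => h.2, fun h => ⟨h ▸ hi, h⟩⟩
    rw [this, Finset.sum_singleton]
    exact sq_pos_of_ne_zero (Finsupp.mem_support_iff.1 hi)

lemma commonLevel_eq_top_iff {α β : Address k} : commonLevel α β = k ↔ α = β := by
  rw [← (commonLevel_le α β).ge_iff_eq, le_commonLevel_iff le_rfl]
  exact ⟨fun h => funext fun j => h j j.2, fun h j _ => by rw [h]⟩

/-- The index of the first listed leaf that agrees with `α` up to level `l`. -/
noncomputable def firstIndex (addr : ℕ ≃ Address k) (l : ℕ) (α : Address k) : ℕ :=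
  sInf {j | ∀ m : Fin k, (m : ℕ) < l → α m = addr j m}

/-- The conditional law of the field may depend on Q only, whereas the marks live on the tree. This
identifies the classes read off from Q with the ancestors of the leaves. -/
lemma levelRep_cascade (hq : IsCascadeParameter x q) (e : Vertex k → ℕ → ℝ)
    (addr : ℕ ≃ Address k) {l : ℕ} (hl : l ≤ k) (i : ℕ) :
    levelRep q (cascade q e addr).2 l i = firstIndex addr l (addr i) := by
  classical
  have hp : ∀ j, (level q l ≤ (cascade q e addr).2 i j ∨ j = i) ↔
      ∀ m : Fin k, (m : ℕ) < l → addr i m = addr j m := fun j => by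
    change (level q l ≤ level q (commonLevel (addr i) (addr j)) ∨ j = i) ↔ _
    rw [hq.level_le_iff hl (commonLevel_le _ _), le_commonLevel_iff hl]
    refine ⟨?_, Or.inl⟩
    rintro (h | rfl)
    exacts [h, fun _ _ => rfl]
  refine le_antisymm (Nat.find_min' _ ((hp _).2 ?_)) (Nat.sInf_le ((hp _).1 (Nat.find_spec
    (⟨i, Or.inr rfl⟩ : ∃ j, level q l ≤ (cascade q e addr).2 i j ∨ j = i))))
  exact Nat.sInf_mem (s := {j | ∀ m : Fin k, (m : ℕ) < l → addr i m = addr j m})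
    ⟨i, fun _ _ => rfl⟩

lemma firstIndex_eq_iff (addr : ℕ ≃ Address k) (l : ℕ) (α β : Address k) :
    firstIndex addr l α = firstIndex addr l β ↔ ∀ m : Fin k, (m : ℕ) < l → α m = β m := by
  have hmem : ∀ α, firstIndex addr l α ∈ {j | ∀ m : Fin k, (m : ℕ) < l → α m = addr j m} :=
    fun α => Nat.sInf_mem ⟨addr.symm α, fun m _ => by rw [addr.apply_symm_apply]⟩
  constructor
  · intro h m hm
    rw [hmem α m hm, hmem β m hm, h]
  · intro h
    simp only [firstIndex]
    congr 1
    ext j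
    exact forall₂_congr fun m hm => by rw [h m hm]

lemma isHierarchical_cascade (hq : IsCascadeParameter x q) (e : Vertex k → ℕ → ℝ)
    (addr : ℕ ≃ Address k) : IsHierarchical q (cascade q e addr).2 := by
  refine ⟨fun i j => ⟨commonLevel (addr i) (addr j), commonLevel_le _ _, rfl, fun l hl => ?_, ?_⟩,
    fun i L hL => ?_⟩
  · rw [levelRep_cascade hq e addr hl, levelRep_cascade hq e addr hl, firstIndex_eq_iff,
      le_commonLevel_iff hl]
  · rw [commonLevel_eq_top_iff, addr.injective.eq_iff]
  -- Changing the entry at position L alone gives a leaf whose common level with the given one is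
  -- exactly L.
  · set β := Function.update (addr i) ⟨L, hL⟩ (addr i ⟨L, hL⟩ + 1) with hβ
    refine ⟨addr.symm β, ?_⟩
    change level q (commonLevel (addr i) (addr (addr.symm β))) = _
    rw [addr.apply_symm_apply]
    congr 1
    apply le_antisymm
    · by_contra hlt
      have h1 := (le_commonLevel_iff (α := addr i) (β := β) (l := L + 1) hL).1 (not_le.1 hlt)
        ⟨L, hL⟩ (Nat.lt_succ_self L)
      simp [hβ] at h1
    · rw [le_commonLevel_iff hL.le]
      intro j hj
      rw [hβ, Function.update_of_ne]
      rintro rfl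
      exact lt_irrefl _ hj

end Levels

/-! ### Gaussian fields -/

section WhiteNoise

variable {I L : Type*}

/-- The law of a family of independent standard Gaussian variables. -/
noncomputable def whiteNoise (I : Type*) : Measure (I → ℝ) :=
  Measure.infinitePi fun _ : I => gaussianReal 0 1

instance : IsProbabilityMeasure (whiteNoise I) := by unfold whiteNoise; infer_instance

lemma hasLaw_whiteNoise (i : I) :
    HasLaw (fun g : I → ℝ => g i) (gaussianReal 0 1) (whiteNoise I) where
  aemeasurable := (measurable_pi_apply i).aemeasurable
  map_eq := Measure.infinitePi_map_eval _ i

lemma isGaussianProcess_whiteNoise :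
    IsGaussianProcess (fun (i : I) (g : I → ℝ) => g i) (whiteNoise I) where
  hasGaussianLaw J := by
    have h : iIndepFun (fun (i : I) (g : I → ℝ) => g i) (whiteNoise I) :=
      iIndepFun_infinitePi (X := fun _ ω => ω) fun _ => measurable_id
    exact (h.precomp (g := fun i : J => (i : I)) Subtype.val_injective).hasGaussianLaw
      fun i => (hasLaw_whiteNoise (i : I)).hasGaussianLaw

lemma integral_whiteNoise (i : I) : ∫ g, g i ∂whiteNoise I = 0 := by
  have := (hasLaw_whiteNoise i).integral_eq
  rw [integral_id_gaussianReal] at this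
  exact this

lemma memLp_whiteNoise (i : I) : MemLp (fun g : I → ℝ => g i) 2 (whiteNoise I) :=
  (hasLaw_whiteNoise i).hasGaussianLaw.memLp_two

lemma covariance_whiteNoise [DecidableEq I] (i j : I) :
    covariance (fun g : I → ℝ => g i) (fun g => g j) (whiteNoise I) = if i = j then 1 else 0 := by
  split_ifs with hij
  · subst hij
    rw [covariance_self (measurable_pi_apply i).aemeasurable, (hasLaw_whiteNoise i).variance_eq,
      variance_id_gaussianReal]
    rfl
  · have h : iIndepFun (fun (i : I) (g : I → ℝ) => g i) (whiteNoise I) :=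
      iIndepFun_infinitePi (X := fun _ ω => ω) fun _ => measurable_id
    exact (h.indepFun hij).covariance_eq_zero (memLp_whiteNoise i) (memLp_whiteNoise j)

/-- The linear combination `∑ c_l g_{n_l}` of the variables `g`. -/
noncomputable def combination (s : Finset L) (c : L → ℝ) (n : L → I) (g : I → ℝ) : ℝ :=
  ∑ l ∈ s, c l * g (n l)

lemma isGaussianProcess_combination {S : Type*} (s : Finset L) (c : L → ℝ) (n : S → L → I) :
    IsGaussianProcess (fun i => combination s c (n i)) (whiteNoise I) := by
  classical
  refine isGaussianProcess_whiteNoise.of_isGaussianProcess fun i => ⟨s.image (n i),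
    ∑ l ∈ s.attach, c l • ContinuousLinearMap.proj
      ⟨n i l, Finset.mem_image_of_mem _ l.2⟩, fun g => ?_⟩
  simp only [combination, sum_apply, smul_apply, ContinuousLinearMap.proj_apply, smul_eq_mul,
    Finset.restrict]
  exact (Finset.sum_attach s fun l => c l * g (n i l)).symm

lemma integral_combination (s : Finset L) (c : L → ℝ) (n : L → I) :
    ∫ g, combination s c n g ∂whiteNoise I = 0 := by
  simp only [combination]
  rw [integral_finsetSum]
  · simp [integral_const_mul, integral_whiteNoise]
  · intro l _
    exact ((memLp_whiteNoise (n l)).integrable (by norm_num)).const_mul _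

lemma covariance_combination [DecidableEq I] (s : Finset L) (c : L → ℝ) (n m : L → I) :
    covariance (combination s c n) (combination s c m) (whiteNoise I) =
      ∑ l ∈ s, ∑ j ∈ s, c l * c j * if n l = m j then 1 else 0 := by
  have h : ∀ (n : L → I) l, l ∈ s → MemLp (fun g : I → ℝ => c l * g (n l)) 2 (whiteNoise I) :=
    fun n l _ => (memLp_whiteNoise (n l)).const_mul _
  have := covariance_fun_sum_fun_sum' (h n) (h m)
  refine this.trans (Finset.sum_congr rfl fun l _ => Finset.sum_congr rfl fun j _ => ?_)
  rw [covariance_const_mul_left, covariance_const_mul_right, covariance_whiteNoise, mul_assoc]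

lemma map_combination (s : Finset L) (c : L → ℝ) {n : L → I} (hn : Function.Injective n)
    (hc : ∑ l ∈ s, c l ^ 2 = 1) : (whiteNoise I).map (combination s c n) = gaussianReal 0 1 := by
  classical
  have h := (isGaussianProcess_combination s c fun _ : Unit => n).hasGaussianLaw_eval ()
  rw [h.map_eq_gaussianReal, integral_combination, ← covariance_self h.aemeasurable,
    covariance_combination]
  have : ∑ l ∈ s, ∑ j ∈ s, c l * c j * (if n l = n j then (1 : ℝ) else 0) = 1 := by
    refine Eq.trans ?_ hc
    refine Finset.sum_congr rfl fun l hl => ?_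
    rw [Finset.sum_eq_single_of_mem l hl fun j _ hj => by
      rw [if_neg (fun h => hj (hn h).symm), mul_zero], if_pos rfl, mul_one, sq]
  rw [this, Real.toNNReal_one]

end WhiteNoise

section Field

variable {k : ℕ} {x q : Fin k → ℝ}

/-- The coefficients of the field with covariance `Q ^ r`. -/
noncomputable def levelCoeff (q : Fin k → ℝ) (r l : ℕ) : ℝ := √(levelStep q r l)

lemma IsCascadeParameter.levelCoeff_sq (h : IsCascadeParameter x q) (r : ℕ) {l : ℕ} (hl : l ≤ k) :
    levelCoeff q r l ^ 2 = levelStep q r l := Real.sq_sqrt (h.levelStep_nonneg r hl)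

lemma IsCascadeParameter.sum_levelCoeff_sq (h : IsCascadeParameter x q) (r : ℕ) :
    ∑ l ∈ Finset.range (k + 1), levelCoeff q r l ^ 2 = 1 := by
  have h1 := sum_levelStep q r k
  rw [level_top, one_pow] at h1
  rw [← h1]
  exact Finset.sum_congr rfl fun l hl =>
    h.levelCoeff_sq r (Nat.lt_succ_iff.1 (Finset.mem_range.1 hl))

/-- A field with covariance `Q ^ r`, built from one Gaussian variable for each class of indices at
each level. -/
noncomputable def field (q : Fin k → ℝ) (r : ℕ) (Q : ℕ → ℕ → ℝ) (g : ℕ × ℕ → ℝ) (i : ℕ) : ℝ :=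
  combination (Finset.range (k + 1)) (levelCoeff q r) (fun l => (l, levelRep q Q l i)) g

lemma measurable_field (q : Fin k → ℝ) (r : ℕ) :
    Measurable fun z : (ℕ → ℕ → ℝ) × (ℕ × ℕ → ℝ) => field q r z.1 z.2 := by
  refine measurable_pi_lambda _ fun i => ?_
  unfold field combination
  refine Finset.measurable_sum _ fun l _ => Measurable.const_mul ?_ _
  exact measurable_apply_index (f := fun (z : (ℕ → ℕ → ℝ) × (ℕ × ℕ → ℝ)) n => z.2 (l, n))
    (by fun_prop) ((measurable_levelRep q l i).comp measurable_fst)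

/-- Different levels use different rows of the noise, so the covariance has no cross terms and
reduces to the decomposition of Q^r by levels. -/
lemma isCenteredGaussian_field (hq : IsCascadeParameter x q) (r : ℕ)
    {Q : ℕ → ℕ → ℝ} (hQ : IsHierarchical q Q) :
    IsCenteredGaussian (fun i j => Q i j ^ r) ((whiteNoise (ℕ × ℕ)).map (field q r Q)) := by
  have hm : Measurable (field q r Q) := (measurable_field q r).comp measurable_prodMk_left
  have hmi : ∀ i, Measurable fun g => field q r Q g i := fun i => (measurable_pi_apply i).comp hm
  have hid : Measurable fun κ : ℕ → ℝ => κ := measurable_id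
  refine ⟨⟨fun J => ⟨?_⟩⟩, fun i => ?_, fun i j => ?_⟩
  · have hJ : Measurable fun κ : ℕ → ℝ => J.restrict κ := by fun_prop
    rw [Measure.map_map hJ hm]
    exact ((isGaussianProcess_combination (Finset.range (k + 1)) (levelCoeff q r)
      fun i l => (l, levelRep q Q l i)).hasGaussianLaw J).isGaussian_map
  · rw [integral_map hm.aemeasurable (measurable_pi_apply i).aestronglyMeasurable]
    exact integral_combination _ _ _
  · rw [covariance_map (measurable_pi_apply i).aestronglyMeasurable
      (measurable_pi_apply j).aestronglyMeasurable hm.aemeasurable]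
    refine (covariance_combination (Finset.range (k + 1)) (levelCoeff q r)
      (fun l => (l, levelRep q Q l i)) (fun l => (l, levelRep q Q l j))).trans ?_
    rw [hQ.pow_eq]
    refine Finset.sum_congr rfl fun l hl => ?_
    rw [Finset.sum_eq_single l]
    · simp only [Prod.mk.injEq, true_and]
      rw [← sq, hq.levelCoeff_sq r (Nat.lt_succ_iff.1 (Finset.mem_range.1 hl))]
    · intro m _ hm
      rw [if_neg (fun h => hm (Prod.mk.inj h).1.symm), mul_zero]
    · exact fun h => absurd hl h

/-! ### The field as a kernel, and the mean gain along a branch. -/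

/-- The conditional law of the field of the evolution. -/
noncomputable def fieldKernel (q : Fin k → ℝ) (r : ℕ) : Kernel OverlapStructure (ℕ → ℝ) :=
  (Kernel.id ×ₖ Kernel.const OverlapStructure (whiteNoise (ℕ × ℕ))).map
    fun z => field q r z.1.2 z.2

lemma measurable_field_snd (q : Fin k → ℝ) (r : ℕ) :
    Measurable fun z : OverlapStructure × (ℕ × ℕ → ℝ) => field q r z.1.2 z.2 :=
  (measurable_field q r).comp (measurable_fst.snd.prodMk measurable_snd)

instance (q : Fin k → ℝ) (r : ℕ) : IsMarkovKernel (fieldKernel q r) :=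
  Kernel.IsMarkovKernel.map _ (measurable_field_snd q r)

lemma fieldKernel_apply (q : Fin k → ℝ) (r : ℕ) (p : OverlapStructure) :
    fieldKernel q r p = (whiteNoise (ℕ × ℕ)).map (field q r p.2) := by
  rw [fieldKernel, Kernel.map_apply _ (measurable_field_snd q r), Kernel.prod_apply,
    Kernel.id_apply, Kernel.const_apply, Measure.dirac_prod,
    Measure.map_map (measurable_field_snd q r) measurable_prodMk_left]
  rfl

lemma compProd_fieldKernel (q : Fin k → ℝ) (r : ℕ) (P : Measure OverlapStructure) [SFinite P] :
    P ⊗ₘ fieldKernel q r =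
      (P.prod (whiteNoise (ℕ × ℕ))).map fun z => (z.1, field q r z.1.2 z.2) := by
  have hm : Measurable fun z : OverlapStructure × (ℕ × ℕ → ℝ) => (z.1, field q r z.1.2 z.2) :=
    measurable_fst.prodMk (measurable_field_snd q r)
  refine Measure.ext_of_lintegral _ fun f hf => ?_
  rw [Measure.lintegral_compProd hf, lintegral_map hf hm,
    lintegral_prod (fun z : OverlapStructure × (ℕ × ℕ → ℝ) => f (z.1, field q r z.1.2 z.2))
      (hf.comp hm).aemeasurable]
  refine lintegral_congr fun p => ?_
  have h1 : Measurable (field q r p.2) := (measurable_field q r).comp measurable_prodMk_left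
  have h2 : Measurable fun κ => f (p, κ) := hf.comp measurable_prodMk_left
  rw [fieldKernel_apply, lintegral_map h2 h1]

/-- The increment of the evolution along a branch, as a function of the root variable and the
variables of the branch. -/
noncomputable def branchGain (ψ : ℝ → ℝ) (q : Fin k → ℝ) (r : ℕ) (θ : ℝ) (t : Fin k → ℝ) : ℝ :=
  Real.exp (ψ (levelCoeff q r 0 * θ + ∑ l : Fin k, levelCoeff q r (l + 1) * t l))

lemma measurable_branchGain {ψ : ℝ → ℝ} (hψ : Measurable ψ) (q : Fin k → ℝ) (r : ℕ) :
    Measurable (Function.uncurry (branchGain ψ q r)) := by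
  unfold branchGain Function.uncurry
  fun_prop

/-- The squares of the coefficients sum to 1, so ψ is evaluated at a standard Gaussian variable and
the exponential moment of order 1 applies. -/
lemma lintegral_branchGain_ne_top {ψ : ℝ → ℝ} (hψ : IsAdmissible ψ) (hq : IsCascadeParameter x q)
    (r : ℕ) : ∫⁻ θ, ∫⁻ t, ENNReal.ofReal (branchGain ψ q r θ t)
      ∂(Measure.pi fun _ : Fin k => gaussianReal 0 1) ∂(gaussianReal 0 1) ≠ ∞ := by
  have hmp := (measurePreserving_piFinSuccAbove (fun _ : Fin (k + 1) => gaussianReal 0 1) 0)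
  have hg : Measurable fun z : ℝ × (Fin k → ℝ) => ENNReal.ofReal (branchGain ψ q r z.1 z.2) :=
    (measurable_branchGain hψ.measurable q r).ennreal_ofReal
  rw [← lintegral_prod (fun z : ℝ × (Fin k → ℝ) => ENNReal.ofReal (branchGain ψ q r z.1 z.2))
    hg.aemeasurable]
  have h1 : ∫⁻ z : ℝ × (Fin k → ℝ), ENNReal.ofReal (branchGain ψ q r z.1 z.2)
      ∂((gaussianReal 0 1).prod (Measure.pi fun _ : Fin k => gaussianReal 0 1)) =
      ∫⁻ t, ENNReal.ofReal (Real.exp (ψ (∑ l : Fin (k + 1), levelCoeff q r l * t l)))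
        ∂(whiteNoise (Fin (k + 1))) := by
    rw [whiteNoise, Measure.infinitePi_eq_pi, ← hmp.lintegral_comp hg]
    refine lintegral_congr fun t => ?_
    simp only [branchGain, Fin.sum_univ_succ]
    rfl
  rw [h1]
  have hsq : ∑ l : Fin (k + 1), levelCoeff q r l ^ 2 = 1 := by
    rw [← hq.sum_levelCoeff_sq r, Finset.sum_range]
  have h2 := map_combination Finset.univ (fun l : Fin (k + 1) => levelCoeff q r l)
    Function.injective_id hsq
  have hmc : Measurable (combination Finset.univ (fun l : Fin (k + 1) => levelCoeff q r l) id) := by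
    unfold combination
    fun_prop
  have he : Measurable fun y => ENNReal.ofReal (Real.exp (ψ y)) := by
    have := hψ.measurable
    fun_prop
  have h3 := lintegral_map (μ := whiteNoise (Fin (k + 1))) he hmc
  rw [h2] at h3
  refine (h3.symm.trans_lt ?_).ne
  have := (hψ.integrable_exp 1).lintegral_lt_top
  simpa only [one_mul] using this

end Field

/-! ### Marks on the edges of the tree -/

section Marks

variable {k : ℕ} {x q : Fin k → ℝ}

lemma measurable_firstIndex {Z : Type*} [MeasurableSpace Z] {addr : Z → (ℕ ≃ Address k)}
    (h : ∀ n, Measurable fun z => addr z n) (l : ℕ) (α : Address k) :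
    Measurable fun z => firstIndex (addr z) l α := by
  classical
  have hex : ∀ z, ∃ j, ∀ m : Fin k, (m : ℕ) < l → α m = addr z j m := fun z =>
    ⟨(addr z).symm α, fun m _ => by rw [(addr z).apply_symm_apply]⟩
  have heq : (fun z => firstIndex (addr z) l α) = fun z => Nat.find (hex z) := by
    funext z
    exact le_antisymm (Nat.sInf_le (Nat.find_spec (hex z)))
      (Nat.find_min' _ (Nat.sInf_mem (s := {j | ∀ m : Fin k, (m : ℕ) < l → α m = addr z j m})
        (hex z)))
  rw [heq]
  refine measurable_find hex fun j => ?_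
  exact h j (Set.to_countable {β : Address k | ∀ m : Fin k, (m : ℕ) < l → α m = β m}).measurableSet

/-- A leaf below the child `c` of the vertex `v`. -/
def leafBelow (v : Vertex k) (c : ℕ) : Address k := fun m =>
  -- Only the entries up to the edge from v matter; the later ones are arbitrary, and c is repeated
  -- there.
  if h : (m : ℕ) < v.1 then v.2 ⟨m, h⟩ else c

/-- The position in the array of Gaussian variables of the mark of the edge from `v` to its
child `c`. -/
noncomputable def edgeIndex (addr : ℕ ≃ Address k) (p : Vertex k × ℕ) : ℕ × ℕ :=
  (p.1.1 + 1, firstIndex addr (p.1.1 + 1) (leafBelow p.1 p.2))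

lemma edgeIndex_truncate (addr : ℕ ≃ Address k) (α : Address k) (l : Fin k) :
    edgeIndex addr (truncate α l, α l) = ((l : ℕ) + 1, firstIndex addr (l + 1) α) := by
  have : firstIndex addr (l + 1) (leafBelow (truncate α l) (α l)) = firstIndex addr (l + 1) α := by
    rw [firstIndex_eq_iff]
    intro m hm
    unfold leafBelow
    split_ifs with h
    · rfl
    · have : m = l := Fin.ext (le_antisymm (Nat.lt_succ_iff.1 hm) (not_lt.1 h))
      rw [this]
  exact Prod.ext rfl this

/-- Each edge has its own entry of the noise, so for every fixed enumeration the marks are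
independent standard Gaussian variables. -/
lemma edgeIndex_injective (addr : ℕ ≃ Address k) : Function.Injective (edgeIndex addr) := by
  rintro ⟨⟨l, a⟩, c⟩ ⟨⟨l', b⟩, d⟩ h
  obtain ⟨h1, h2⟩ := Prod.ext_iff.1 h
  obtain rfl : l = l' := Fin.ext (Nat.succ_injective h1)
  have h3 := (firstIndex_eq_iff addr _ _ _).1 h2
  have hab : a = b := by
    funext m
    have := h3 (Fin.castLE l.isLt.le m) (m.isLt.trans (Nat.lt_succ_self _))
    simpa [leafBelow] using this
  have hcd : c = d := by
    have := h3 l (Nat.lt_succ_self _)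
    simpa [leafBelow] using this
  rw [hab, hcd]

/-- The position of the root mark and of the marks of the edges. -/
noncomputable def markIndex (addr : ℕ ≃ Address k) (o : Option (Vertex k × ℕ)) : ℕ × ℕ :=
  -- At level 0 all leaves form one class, with first index 0; the edges use the rows from 1 on.
  o.elim (0, 0) (edgeIndex addr)

lemma markIndex_injective (addr : ℕ ≃ Address k) : Function.Injective (markIndex addr) := by
  rintro (_ | p) (_ | p') h
  · rfl
  · exact absurd (congrArg Prod.fst h) (Nat.succ_ne_zero _).symm
  · exact absurd (congrArg Prod.fst h) (Nat.succ_ne_zero _)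
  · exact congrArg some (edgeIndex_injective addr h)

/-- The marks of the edges, read off from an array of variables. -/
noncomputable def edgeMarks (addr : ℕ ≃ Address k) (g : ℕ × ℕ → ℝ) (v : Vertex k) (c : ℕ) : ℝ :=
  g (edgeIndex addr (v, c))

lemma measurePreserving_edgeMarks (addr : ℕ ≃ Address k) :
    MeasurePreserving (fun g : ℕ × ℕ → ℝ => (g (0, 0), edgeMarks addr g)) (whiteNoise (ℕ × ℕ))
      ((gaussianReal 0 1).prod
        (treeLaw fun _ : Fin k => Measure.infinitePi fun _ : ℕ => gaussianReal 0 1)) := by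
  have h1 : MeasurePreserving (fun (g : ℕ × ℕ → ℝ) o => g (markIndex addr o)) (whiteNoise (ℕ × ℕ))
      (Measure.infinitePi fun _ : Option (Vertex k × ℕ) => gaussianReal 0 1) :=
    ⟨by fun_prop, Measure.map_infinitePi_infinitePi_of_inj
      (P := fun _ : ℕ × ℕ => gaussianReal 0 1) (markIndex_injective addr)⟩
  have h2 := measurePreserving_option fun _ : Option (Vertex k × ℕ) => gaussianReal 0 1
  have h3 : MeasurePreserving (MeasurableEquiv.curry (Vertex k) ℕ ℝ)
      (Measure.infinitePi fun _ : Vertex k × ℕ => gaussianReal 0 1)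
      (treeLaw fun _ : Fin k => Measure.infinitePi fun _ : ℕ => gaussianReal 0 1) :=
    ⟨(MeasurableEquiv.curry (Vertex k) ℕ ℝ).measurable,
      Measure.infinitePi_map_curry fun (_ : Vertex k) (_ : ℕ) => gaussianReal 0 1⟩
  exact ((MeasurePreserving.id (gaussianReal 0 1)).prod h3).comp (h2.comp h1)

/-- The root mark, and the tree with a mark on each edge. -/
noncomputable def markedTree (enc : ℕ ≃ Address k) (z : (Vertex k → ℕ → ℝ) × (ℕ × ℕ → ℝ)) :
    ℝ × (Vertex k → Marked) :=
  (z.2 (0, 0), fun v => (z.1 v, edgeMarks (sortedAddress enc z.1) z.2 v))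

/-- The enumeration depends on the tree, but for each tree the marks have the same law; so they are
independent of the tree and can be attached to its vertices. -/
lemma measurePreserving_markedTree (enc : ℕ ≃ Address k) (ρ : Fin k → Measure (ℕ → ℝ))
    [∀ l, IsProbabilityMeasure (ρ l)] :
    MeasurePreserving (markedTree enc) ((treeLaw ρ).prod (whiteNoise (ℕ × ℕ)))
      ((gaussianReal 0 1).prod
        (treeLaw fun l => (ρ l).prod (Measure.infinitePi fun _ : ℕ => gaussianReal 0 1))) := by
  have hm : Measurable (Function.uncurry fun (e : Vertex k → ℕ → ℝ) (g : ℕ × ℕ → ℝ) =>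
      (g (0, 0), edgeMarks (sortedAddress enc e) g)) := by
    refine Measurable.prodMk (by fun_prop)
      (measurable_pi_lambda _ fun v => measurable_pi_lambda _ fun c => ?_)
    refine measurable_apply_index (f := fun (z : (Vertex k → ℕ → ℝ) × (ℕ × ℕ → ℝ)) n =>
      z.2 ((v.1 : ℕ) + 1, n)) (by fun_prop) ?_
    exact (measurable_firstIndex (fun n => measurable_sortedAddress enc n) _ _).comp measurable_fst
  have h1 := (MeasurePreserving.id (treeLaw ρ)).skew_product hm
    (ae_of_all _ fun e => (measurePreserving_edgeMarks (sortedAddress enc e)).map_eq)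
  have h2 := (measurePreserving_zip (fun v : Vertex k => ρ v.1)
    (fun _ : Vertex k => Measure.infinitePi fun _ : ℕ => gaussianReal 0 1)).comp
      Measure.measurePreserving_swap
  exact (((MeasurePreserving.id (gaussianReal 0 1)).prod h2).comp
    (measurePreserving_prodAssoc _ _ _)).comp (Measure.measurePreserving_swap.comp h1)

/-- The field at a leaf is the root variable plus the marks along its path, each with its
coefficient: the form required by `exists_marked_evolution`. -/
lemma exp_field_sortedCascade (hq : IsCascadeParameter x q) (enc : ℕ ≃ Address k) (ψ : ℝ → ℝ)
    (r : ℕ) (e : Vertex k → ℕ → ℝ) (g : ℕ × ℕ → ℝ) (i : ℕ) :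
    Real.exp (ψ (field q r (sortedCascade enc q e).2 g i)) =
      branchGain ψ q r (g (0, 0))
        (pathMarks (edgeMarks (sortedAddress enc e) g) (sortedAddress enc e i)) := by
  set addr := sortedAddress enc e
  have h1 : ∀ l ≤ k, levelRep q (sortedCascade enc q e).2 l i = firstIndex addr l (addr i) :=
    fun l hl => levelRep_cascade hq e addr hl i
  have h0 : firstIndex addr 0 (addr i) = 0 := by
    unfold firstIndex
    exact Nat.sInf_eq_zero.2 (Or.inl fun m hm => absurd hm (Nat.not_lt_zero _))
  have h2 : field q r (sortedCascade enc q e).2 g i = levelCoeff q r 0 * g (0, 0) +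
      ∑ l : Fin k, levelCoeff q r (l + 1) * pathMarks (edgeMarks addr g) (addr i) l := by
    rw [field, combination, Finset.sum_range, Fin.sum_univ_succ]
    congr 1
    · simp [h1, h0]
    · refine Finset.sum_congr rfl fun l _ => ?_
      simp only [Fin.val_succ, pathMarks, edgeMarks, edgeIndex_truncate, h1 _ l.isLt]
  rw [h2, branchGain]

end Marks

/-! ### Measurability of the evolution -/

section Measurability

variable {ψ : ℝ → ℝ}

lemma summable_iff_tsum_ofReal_abs_ne_top {f : ℕ → ℝ} :
    Summable f ↔ ∑' j, ENNReal.ofReal |f j| ≠ ∞ := by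
  rw [← summable_abs_iff]
  refine ⟨fun h => h.tsum_ofReal_ne_top, fun h => ?_⟩
  simpa only [ENNReal.toReal_ofReal (abs_nonneg _)] using ENNReal.summable_toReal h

lemma measurableSet_summable {Z : Type*} [MeasurableSpace Z] {f : ℕ → Z → ℝ}
    (hf : ∀ j, Measurable (f j)) : MeasurableSet {z | Summable fun j => f j z} := by
  simp only [summable_iff_tsum_ofReal_abs_ne_top]
  have : Measurable fun z => ∑' j, ENNReal.ofReal |f j z| := Measurable.tsum fun j => by
    have := hf j
    fun_prop
  exact (this (measurableSet_singleton ∞)).compl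

lemma measurable_mul_exp (hψ : Measurable ψ) (j : ℕ) :
    Measurable fun z : OverlapStructure × (ℕ → ℝ) => z.1.1 j * Real.exp (ψ (z.2 j)) := by
  fun_prop

lemma measurable_evolvedWeight (hψ : Measurable ψ) :
    Measurable fun z : OverlapStructure × (ℕ → ℝ) => evolvedWeight ψ z.1.1 z.2 :=
  measurable_pi_lambda _ fun i =>
    (measurable_mul_exp hψ i).div (Measurable.tsum (measurable_mul_exp hψ))

lemma measurableSet_evolutionDefined (hψ : Measurable ψ) :
    MeasurableSet {z | EvolutionDefined ψ z} :=
  (measurableSet_summable (measurable_mul_exp hψ)).inter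
    ((measurableSet_lt measurable_const (Measurable.tsum (measurable_mul_exp hψ))).inter
      (measurable_evolvedWeight hψ measurableSet_exists_isDecreasingOrder))

lemma measurable_evolve (hψ : Measurable ψ) : Measurable (evolve ψ) := by
  have hw := measurable_evolvedWeight hψ
  have hσ : ∀ m, Measurable fun z : OverlapStructure × (ℕ → ℝ) =>
      decreasingOrder (evolvedWeight ψ z.1.1 z.2) m := fun m =>
    (measurable_decreasingOrder m).comp hw
  refine Measurable.prodMk (measurable_pi_lambda _ fun m =>
    (measurable_apply_decreasingOrder m).comp hw)
    (measurable_pi_lambda _ fun m => measurable_pi_lambda _ fun n => ?_)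
  have hQ : Measurable fun z : OverlapStructure × (ℕ → ℝ) => z.1.2 := by fun_prop
  exact measurable_apply_index (measurable_apply_index hQ (hσ m)) (hσ n)

lemma measurableSet_isMassPartition : MeasurableSet {s : ℕ → ℝ | IsMassPartition s} := by
  have : {s : ℕ → ℝ | IsMassPartition s} = (⋂ i, {s | s (i + 1) ≤ s i}) ∩ ((⋂ i, {s | 0 ≤ s i}) ∩
      ({s | Summable fun i => s i} ∩ {s | ∑' i, s i ≤ 1})) := by
    ext s
    simp only [Set.mem_ofPred_eq, Set.mem_inter_iff, Set.mem_iInter]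
    exact ⟨fun h => ⟨fun i => h.antitone i.le_succ, h.nonneg, h.summable, h.tsum_le_one⟩,
      fun h => ⟨antitone_nat_of_succ_le h.1, h.2.1, h.2.2.1, h.2.2.2⟩⟩
  rw [this]
  refine (MeasurableSet.iInter fun i => ?_).inter ((MeasurableSet.iInter fun i => ?_).inter
    ((measurableSet_summable measurable_pi_apply).inter ?_))
  · exact measurableSet_le (measurable_pi_apply _) (measurable_pi_apply _)
  · exact measurableSet_le measurable_const (measurable_pi_apply _)
  · exact measurableSet_le (Measurable.tsum measurable_pi_apply) measurable_const

end Measurability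

/-! ### The evolution of a cascade -/

section Evolution

variable {k : ℕ} {x q : Fin k → ℝ}

lemma isMassPartition_sortedCascade (enc : ℕ ≃ Address k) (q : Fin k → ℝ) {e : Vertex k → ℕ → ℝ}
    (hpos : ∀ v i, 0 < e v i) (hs : Summable (leafWeight e)) :
    IsMassPartition (sortedCascade enc q e).1 := by
  have hS : 0 < ∑' α, leafWeight e α :=
    hs.tsum_pos (fun α => (leafWeight_pos hpos α).le) (enc 0) (leafWeight_pos hpos _)
  have hs' := ((sortedAddress enc e).summable_iff (f := leafWeight e)).2 hs
  refine ⟨fun i j hij => ?_, fun i => ?_, hs'.div_const _, ?_⟩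
  · exact div_le_div_of_nonneg_right (antitone_leafWeight_sortedAddress enc hpos hs hij) hS.le
  · exact div_nonneg (leafWeight_pos hpos _).le hS.le
  · change ∑' i, leafWeight e (sortedAddress enc e i) / _ ≤ 1
    rw [tsum_div_const, (sortedAddress enc e).tsum_eq, div_self hS.ne']

/-- The constant C cancels in the normalisation, so the evolved weights are those of e' listed in
another order. As the weights of e' are distinct, sorting recovers its canonical list, and the
automorphism preserves common levels, hence overlaps. -/
lemma evolve_sortedCascade (enc : ℕ ≃ Address k) {e e' : Vertex k → ℕ → ℝ}
    (hpos : ∀ v i, 0 < e v i) (hs : Summable (leafWeight e)) (hpos' : ∀ v i, 0 < e' v i)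
    (hs' : Summable (leafWeight e')) (hinj : Function.Injective (leafWeight e'))
    {ψ : ℝ → ℝ} {κ : ℕ → ℝ} {C : ℝ} (hC : 0 < C) {a : Equiv.Perm (Address k)} (ha : IsTreeAut a)
    (h : ∀ i, leafWeight e (sortedAddress enc e i) * Real.exp (ψ (κ i)) =
      C * leafWeight e' (a.symm (sortedAddress enc e i))) :
    EvolutionDefined ψ (sortedCascade enc q e, κ) ∧
      evolve ψ (sortedCascade enc q e, κ) = sortedCascade enc q e' := by
  set addr := sortedAddress enc e with haddr
  set b : ℕ ≃ Address k := addr.trans a.symm with hb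
  set S := ∑' α, leafWeight e α with hSdef
  set S' := ∑' α, leafWeight e' α with hS'def
  have hS : 0 < S :=
    hs.tsum_pos (fun α => (leafWeight_pos hpos α).le) (enc 0) (leafWeight_pos hpos _)
  have hS' : 0 < S' :=
    hs'.tsum_pos (fun α => (leafWeight_pos hpos' α).le) (enc 0) (leafWeight_pos hpos' _)
  have hCS : 0 < C / S := div_pos hC hS
  have hterm : (fun j => (sortedCascade enc q e).1 j * Real.exp (ψ (κ j))) =
      fun j => C / S * leafWeight e' (b j) := by
    funext j
    change leafWeight e (addr j) / S * _ = _
    rw [div_mul_eq_mul_div, h, div_mul_eq_mul_div]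
    rfl
  have hsb : Summable fun j => leafWeight e' (b j) := (b.summable_iff (f := leafWeight e')).2 hs'
  have htsum : ∑' j, (sortedCascade enc q e).1 j * Real.exp (ψ (κ j)) = C / S * S' := by
    rw [hterm, tsum_mul_left, b.tsum_eq]
  have hw : evolvedWeight ψ (sortedCascade enc q e).1 κ = fun i => leafWeight e' (b i) / S' := by
    funext i
    rw [evolvedWeight, htsum, congrFun hterm i, mul_div_mul_left _ _ hCS.ne']
  have hex : ∃ σ, IsDecreasingOrder (evolvedWeight ψ (sortedCascade enc q e).1 κ) σ := by
    rw [hw]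
    exact exists_isDecreasingOrder (hsb.div_const _)
      fun i => div_pos (leafWeight_pos hpos' _) hS'
  refine ⟨⟨?_, ?_, hex⟩, ?_⟩
  · exact hterm ▸ hsb.mul_left _
  · exact htsum ▸ mul_pos hCS hS'
  · have hσ := (isDecreasingOrder_decreasingOrder hex).antitone
    simp only [evolve]
    set σ := decreasingOrder (evolvedWeight ψ (sortedCascade enc q e).1 κ) with hσdef
    have hsorted : sortedAddress enc e' = σ.trans b := by
      refine sortedAddress_eq enc hinj fun m n hmn => ?_
      have := hσ hmn
      simp only [hw] at this
      exact (div_le_div_iff_of_pos_right hS').1 this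
    have hcasc : sortedCascade enc q e' = cascade q e' (σ.trans b) := by
      rw [sortedCascade, hsorted]
    rw [hcasc, hw]
    refine Prod.ext rfl ?_
    funext m n
    change level q (commonLevel (addr (σ m)) (addr (σ n))) =
      level q (commonLevel (b (σ m)) (b (σ n)))
    rw [← ha.commonLevel (b (σ m))]
    simp [hb]

/-- The evolution of a cascade is the cascade of a tree with the same law. -/
lemma exists_evolved_tree (hq : IsCascadeParameter x q) {ρ : Fin k → Measure (ℕ → ℝ)}
    [∀ l, IsProbabilityMeasure (ρ l)] (h : ∀ l, HasPowerLaw (x l) (ρ l)) (enc : ℕ ≃ Address k)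
    {ψ : ℝ → ℝ} (hψ : IsAdmissible ψ) (r : ℕ) :
    ∃ Ψ : (Vertex k → ℕ → ℝ) × (ℕ × ℕ → ℝ) → Vertex k → ℕ → ℝ,
      MeasurePreserving Ψ ((treeLaw ρ).prod (whiteNoise (ℕ × ℕ))) (treeLaw ρ) ∧
      ∀ᵐ z ∂(treeLaw ρ).prod (whiteNoise (ℕ × ℕ)),
        EvolutionDefined ψ (sortedCascade enc q z.1, field q r (sortedCascade enc q z.1).2 z.2) ∧
        evolve ψ (sortedCascade enc q z.1, field q r (sortedCascade enc q z.1).2 z.2) =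
          sortedCascade enc q (Ψ z) := by
  classical
  set γ := gaussianReal 0 1 with hγ
  have hbm := measurable_branchGain hψ.measurable q r
  set J : ℝ → ℝ≥0∞ := fun θ => ∫⁻ t, ENNReal.ofReal (branchGain ψ q r θ t)
    ∂(Measure.pi fun _ : Fin k => γ) with hJ
  have hJm : Measurable J := hbm.ennreal_ofReal.lintegral_prod_right'
  have hJae : ∀ᵐ θ ∂γ, J θ ≠ ∞ := by
    filter_upwards [ae_lt_top hJm (lintegral_branchGain_ne_top hψ hq r)] with θ hθ
    exact hθ.ne
  have hgm : MeasurableSet {θ | J θ ≠ ∞} := (hJm (measurableSet_singleton ∞)).compl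
  -- The mean gain is finite for almost every root variable θ only; on the exceptional null set the
  -- gain is set to 1.
  set W : ℝ → (Fin k → ℝ) → ℝ := fun θ t => if J θ ≠ ∞ then branchGain ψ q r θ t else 1 with hW
  have hWm : Measurable (Function.uncurry W) :=
    Measurable.ite (measurable_fst hgm) hbm measurable_const
  have hWpos : ∀ θ t, 0 < W θ t := fun θ t => by
    simp only [hW]
    split_ifs
    exacts [Real.exp_pos _, one_pos]
  have hWint : ∀ θ, ∫⁻ t, ENNReal.ofReal (W θ t) ∂(Measure.pi fun _ => γ) ≠ ∞ := fun θ => by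
    by_cases hθ : J θ = ∞
    · simp [hW, hθ]
    · simp only [hW, ne_eq, hθ, not_false_eq_true, if_true]
      exact hθ
  obtain ⟨C, Φ, G, -, hCpos, -, hΦm, hΦ, hGm, hG, hid⟩ :=
    exists_marked_evolution h hq.x_pos hq.x_lt_one γ hWm hWpos hWint
  set D := treeLaw fun l => (ρ l).prod (Measure.infinitePi fun _ : ℕ => γ) with hD
  have hM := measurePreserving_markedTree enc ρ
  have hΦ' : MeasurePreserving (fun p : ℝ × (Vertex k → Marked) => Φ p.1 p.2) (γ.prod D)
      (treeLaw ρ) :=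
    measurePreserving_snd.comp ((MeasurePreserving.id γ).skew_product hΦm
      (ae_of_all _ fun θ => (hΦ θ).map_eq))
  have hΨ := hΦ'.comp hM
  refine ⟨_, hΨ, ?_⟩
  have htree := ae_summable_leafWeight h hq.x_strictMono hq.x_pos hq.x_lt_one
  have hGae : ∀ᵐ p ∂γ.prod D, p ∈ G :=
    (Measure.ae_prod_iff_ae_ae hGm).2 (ae_of_all _ hG)
  filter_upwards [Measure.quasiMeasurePreserving_fst.ae htree,
    hΨ.quasiMeasurePreserving.ae htree,
    hΨ.quasiMeasurePreserving.ae (ae_injective_leafWeight h hq.x_pos hq.x_lt_one),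
    hM.quasiMeasurePreserving.ae hGae,
    hM.quasiMeasurePreserving.ae (Measure.quasiMeasurePreserving_fst.ae hJae)]
    with z h1 h2 h3 h4 h5
  obtain ⟨a, ha, hid⟩ := hid _ _ h4
  refine evolve_sortedCascade enc h1.1 h1.2 h2.1 h2.2 h3 (hCpos (markedTree enc z).1) ha fun i => ?_
  have h6 := hid (a.symm (sortedAddress enc z.1 i))
  rw [a.apply_symm_apply] at h6
  rw [exp_field_sortedCascade hq]
  have h7 : ∀ t, W (z.2 (0, 0)) t = branchGain ψ q r (z.2 (0, 0)) t := fun t => if_pos h5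
  rw [h7] at h6
  exact h6

lemma ae_isHierarchical (hq : IsCascadeParameter x q) {ρ : Fin k → Measure (ℕ → ℝ)}
    [∀ l, IsProbabilityMeasure (ρ l)] (enc : ℕ ≃ Address k) {P : Measure OverlapStructure}
    (hP : HasLaw (sortedCascade enc q) P (treeLaw ρ)) : ∀ᵐ p ∂P, IsHierarchical q p.2 := by
  have hm : MeasurableSet {p : OverlapStructure | IsHierarchical q p.2} :=
    measurable_snd (measurableSet_isHierarchical q)
  rw [← hP.map_eq, ae_map_iff hP.aemeasurable hm]
  exact ae_of_all _ fun e => isHierarchical_cascade hq e _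

lemma ae_isMassPartition (hq : IsCascadeParameter x q) {ρ : Fin k → Measure (ℕ → ℝ)}
    [∀ l, IsProbabilityMeasure (ρ l)] (h : ∀ l, HasPowerLaw (x l) (ρ l)) (enc : ℕ ≃ Address k)
    {P : Measure OverlapStructure} (hP : HasLaw (sortedCascade enc q) P (treeLaw ρ)) :
    ∀ᵐ p ∂P, IsMassPartition p.1 := by
  have hm : MeasurableSet {p : OverlapStructure | IsMassPartition p.1} :=
    measurable_fst measurableSet_isMassPartition
  rw [← hP.map_eq, ae_map_iff hP.aemeasurable hm]
  filter_upwards [ae_summable_leafWeight h hq.x_strictMono hq.x_pos hq.x_lt_one] with e he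
  exact isMassPartition_sortedCascade enc q he.1 he.2

/-- The pair of the cascade and its field is the image of a tree and an independent white noise;
there the evolution is the canonical cascade of a tree with the same law. -/
lemma isQuasiStationary_of_hasLaw (hq : IsCascadeParameter x q) {ρ : Fin k → Measure (ℕ → ℝ)}
    [∀ l, IsProbabilityMeasure (ρ l)] (h : ∀ l, HasPowerLaw (x l) (ρ l)) (enc : ℕ ≃ Address k)
    {P : Measure OverlapStructure} (hP : HasLaw (sortedCascade enc q) P (treeLaw ρ))
    {ψ : ℝ → ℝ} (hψ : IsAdmissible ψ) (r : ℕ) : IsQuasiStationary ψ r P := by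
  have hX := measurable_sortedCascade enc q
  have : IsProbabilityMeasure P := hP.isProbabilityMeasure_iff.1 inferInstance
  have hF : Measurable fun z : (Vertex k → ℕ → ℝ) × (ℕ × ℕ → ℝ) =>
      (sortedCascade enc q z.1, field q r (sortedCascade enc q z.1).2 z.2) :=
    (hX.comp measurable_fst).prodMk ((measurable_field q r).comp
      ((hX.comp measurable_fst).snd.prodMk measurable_snd))
  have hjoint : P ⊗ₘ fieldKernel q r = ((treeLaw ρ).prod (whiteNoise (ℕ × ℕ))).map
      fun z => (sortedCascade enc q z.1, field q r (sortedCascade enc q z.1).2 z.2) := by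
    have h1 := Measure.map_prod_map (treeLaw ρ) (whiteNoise (ℕ × ℕ)) hX measurable_id
    rw [hP.map_eq, Measure.map_id] at h1
    rw [compProd_fieldKernel, h1, Measure.map_map
      (measurable_fst.prodMk (measurable_field_snd q r)) (hX.prodMap measurable_id)]
    rfl
  obtain ⟨Ψ, hΨ, hae⟩ := exists_evolved_tree hq h enc hψ r
  refine ⟨fieldKernel q r, inferInstance, ?_, ?_, (measurable_evolve hψ.measurable).aemeasurable,
    ?_⟩
  · filter_upwards [ae_isHierarchical hq enc hP] with p hp
    rw [fieldKernel_apply]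
    exact isCenteredGaussian_field hq r hp
  · rw [hjoint, ae_map_iff hF.aemeasurable (measurableSet_evolutionDefined hψ.measurable)]
    exact hae.mono fun z hz => hz.1
  · rw [hjoint, Measure.map_map (measurable_evolve hψ.measurable) hF]
    refine (Measure.map_congr (hae.mono fun z hz => hz.2)).trans ?_
    have h1 := Measure.map_map (μ := (treeLaw ρ).prod (whiteNoise (ℕ × ℕ))) hX hΨ.measurable
    rw [hΨ.map_eq, hP.map_eq] at h1
    exact h1.symm

end Evolution

end RuelleCascade

theorem theorem2p9 (k : ℕ) (hk : 1 ≤ k) (P : Measure RuelleCascade.OverlapStructure)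
    (hP : RuelleCascade.IsRuelleCascade.{u} k P) :
    RuelleCascade.IsROSt P ∧
    RuelleCascade.IsIndecomposable P ∧
    ∀ ψ : ℝ → ℝ, RuelleCascade.IsAdmissible ψ →
      RuelleCascade.IsRobustlyQuasiStationary ψ P := by
  obtain ⟨x, q, hq, hP⟩ := hP
  obtain ⟨ρ, hρ, hpl, hlaw⟩ := hP.exists_hasLaw hq
  have : Nonempty (Fin k) := ⟨⟨0, hk⟩⟩
  -- Since k ≥ 1, the set of leaves is countably infinite, so it can be enumerated by ℕ.
  obtain ⟨enc⟩ := nonempty_equiv_of_countable (α := ℕ) (β := RuelleCascade.Address k)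
  have hH := RuelleCascade.ae_isHierarchical hq enc (hlaw enc)
  have hqs : ∀ ψ, RuelleCascade.IsAdmissible ψ → ∀ r, RuelleCascade.IsQuasiStationary ψ r P :=
    fun ψ hψ r => RuelleCascade.isQuasiStationary_of_hasLaw hq hpl enc (hlaw enc) hψ r
  exact ⟨⟨(hlaw enc).isProbabilityMeasure_iff.1 inferInstance,
      RuelleCascade.ae_isMassPartition hq hpl enc (hlaw enc),
      hH.mono fun p hp => hp.diag, hH.mono fun p hp => hp.posDef hq⟩,
    hH.mono fun p hp => hp.overlapSet_eq hq,
    fun ψ hψ => ⟨hqs ψ hψ 1, (Set.Ici_infinite 1).mono fun r hr => ⟨hr, hqs ψ hψ r⟩⟩⟩
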